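/- **Theorem 3.2 (Boltzmann-Gibbs principle).** Let $d\in\{1,2,3\}$ and $0<\rho<1$. Write $\mathbb T^d=(\mathbb R/\mathbb Z)^d$, $\mathbb T^d_n=(\mathbb Z/n\mathbb Z)^d$, $\Omega_n=\{0,1\}^{\mathbb T_n^d}$ for $n\ge 1$, let $e_1,\dots,e_d$ be the canonical basis, and let $(\tau_x\eta)_z=\eta_{x+z}$. A cylinder function is a function $\{0,1\}^{\mathbb Z^d}\to\mathbb R$ depending on finitely many coordinates; it is evaluated at $\tau_x\eta$, $\eta\in\Omega_n$, by regarding $\tau_x\eta$ as a periodic configuration on $\mathbb Z^d$. Let $c_1,\dots,c_d$ be cylinder functions such that $c_j\ge \mathfrak c_0$ for some constant $\mathfrak c_0>0$, such that $c_j$ does not depend on $\eta_0$ and $\eta_{e_j}$, and such that for each $j$ there are cylinder functions $h_{j,1},\dots,h_{j,d}$ with $$c_j(\eta)\,[\eta_{e_j}-\eta_0]=\sum_{k=1}^d\{h_{j,k}(\tau_{e_k}\eta)-h_{j,k}(\eta)\}\qquad\text{for all }\eta\in\{0,1\}^{\mathbb Z^d}.$$ Let $(a_n)_{n\ge1}$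 be positive numbers such that $a_n\to\infty$ and $e^{Ca_n}/\sqrt n\to0$ for every $C>0$ (for instance, $a_n\to\infty$ and $a_n\le\sqrt{\log n}$ for all large $n$). Let $\eta^n(t)=(\eta^n_x(t):x\in\mathbb T^d_n)$, $t\ge0$, be the continuous-time Markov chain on $\Omega_n$, with right-continuous trajectories with left limits, whose generator is $$(L_nf)(\eta)=n^2\sum_{x\in\mathbb T_n^d}\sum_{j=1}^d c_j(\tau_x\eta)\,[f(\sigma^{x,x+e_j}\eta)-f(\eta)]+a_n\sum_{x\in\mathbb T^d_n}\ \sum_{y\sim x}(\eta_y-\eta_x)^2\,[f(\sigma^x\eta)-f(\eta)],$$ where $y\sim x$ means that $y$ is a nearest neighbour of $x$ in $\mathbb T^d_n$, $\sigma^{x,y}\eta$ is $\eta$ with the values at $x$ and $y$ exchanged and $\sigma^x\eta$ is $\eta$ with the value at $x$ flipped. Let $\mathbb E_{\mu_n}$ be the expectation for this chain started from the probability measure $\mu_n$ on $\Omega_n$. Assume that for all $n\ge1$ the relative entropy of $\mu_n$ with respect to the Bernoulli product measure $\nu^n_\rho$ of density $\rho$ satisfies $$H_n(\mu_n\,|\,\nu^n_\rho)\le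 R_d(n),\qquad R_1(n)=\sqrt{a_n},\quad R_2(n)=a_n\log n,\quad R_3(n)=a_n\,n .$$ For a cylinder function $f$ let $\tilde f(r)=E_{\nu_r}[f]$, $r\in[0,1]$, where $\nu_r$ is the Bernoulli product measure of density $r$ on $\{0,1\}^{\mathbb Z^d}$, and let $$(\Pi_\rho f)(\eta)=f(\eta)-\tilde f(\rho)-\tilde f'(\rho)\,(\eta_0-\rho).$$ Then, for every $t>0$, every cylinder function $f$ and every continuous $G:\mathbb R_+\times\mathbb T^d\to\mathbb R$ whose first-order space derivatives exist and are continuous on $\mathbb R_+\times\mathbb T^d$, $$\lim_{n\to\infty}\mathbb E_{\mu_n}\Big[\,\Big|\int_0^t\frac1{\sqrt{a_n\,n^d}}\sum_{x\in\mathbb T^d_n}G(s,x/n)\,(\Pi_\rho f)(\tau_x\eta^n(s))\,ds\Big|\,\Big]=0 .$$ -/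

import Mathlib

open MeasureTheory ProbabilityTheory Filter Topology
open scoped ENNReal

noncomputable section

namespace VoterStirring

/-! ### Configurations and lattices -/

/-- Configurations `{0,1}^{ℤ^d}` on the full lattice (`true` is opinion `1`). -/
abbrev Config (d : ℕ) : Type := (Fin d → ℤ) → Bool

/-- The discrete torus `(ℤ/nℤ)^d`. -/
abbrev Torus (d n : ℕ) : Type := Fin d → ZMod n

/-- The state space `Ω_n = {0,1}^{(ℤ/nℤ)^d}`. -/
abbrev TorusConfig (d n : ℕ) : Type := Torus d n → Bool

/-- The real number `1` or `0` attached to an opinion. -/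
def occ (b : Bool) : ℝ := if b then 1 else 0

/-- The `j`-th canonical basis vector (of `ℤ^d` or of the discrete torus). -/
def unitVec {d : ℕ} (R : Type) [Zero R] [One R] (j : Fin d) : Fin d → R := Pi.single j 1

/-- Translations of configurations on `ℤ^d`: `(τ_x η)_z = η_{x+z}`. -/
def shift {d : ℕ} (x : Fin d → ℤ) (η : Config d) : Config d := fun z => η (x + z)

/-- The translate `τ_x η` of a configuration `η` on the discrete torus, viewed as a periodic
configuration on `ℤ^d`, so that functions of configurations on `ℤ^d` can be evaluated at it. -/
def torusTranslate {d n : ℕ} (x : Torus d n) (η : TorusConfig d n) : Config d :=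
  fun z => η (x + fun i => (z i : ZMod n))

/-- The embedding `x ↦ x / n` of the discrete torus into the continuous torus `(ℝ/ℤ)^d`. -/
def scaledPoint {d n : ℕ} [NeZero n] (x : Torus d n) : Fin d → UnitAddCircle :=
  fun i => ZMod.toAddCircle (x i)

/-- A cylinder function depends only on finitely many coordinates. -/
def IsCylinder {d : ℕ} (f : Config d → ℝ) : Prop :=
  ∃ A : Finset (Fin d → ℤ), DependsOn f (A : Set (Fin d → ℤ))

/-! ### The generators -/

/-- The configuration `σ^x η`: the value at `x` is flipped. -/
def flipAt {d n : ℕ} (x : Torus d n) (η : TorusConfig d n) : TorusConfig d n :=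
  Function.update η x (!(η x))

/-- The configuration `σ^{x,y} η`: the values at `x` and `y` are exchanged. -/
def exchange {d n : ℕ} (x y : Torus d n) (η : TorusConfig d n) : TorusConfig d n :=
  fun z => η (Equiv.swap x y z)

/-- The nearest neighbours of `x` in the discrete torus, each counted once. (For `n = 1` the only
point is listed as its own neighbour, where the voter rate `(η_x - η_x)^2` is zero.) -/
def neighbours {d n : ℕ} [NeZero n] (x : Torus d n) : Finset (Torus d n) :=
  Finset.univ.filter fun y => ∃ j : Fin d, y = x + unitVec (ZMod n) j ∨ x = y + unitVec (ZMod n) j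

/-- The generator `L_n^V` of the voter model. -/
def voterGen (d n : ℕ) [NeZero n] :
    (TorusConfig d n → ℝ) →ₗ[ℝ] (TorusConfig d n → ℝ) where
  toFun f := fun η => ∑ x : Torus d n, ∑ y ∈ neighbours x,
    (occ (η y) - occ (η x)) ^ 2 * (f (flipAt x η) - f η)
  map_add' f g := by
    funext η
    simp only [Pi.add_apply, ← Finset.sum_add_distrib]
    exact Finset.sum_congr rfl fun x _ => Finset.sum_congr rfl fun y _ => by ring
  map_smul' r f := by
    funext η
    simp only [Pi.smul_apply, smul_eq_mul, RingHom.id_apply, Finset.mul_sum]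
    exact Finset.sum_congr rfl fun x _ => Finset.sum_congr rfl fun y _ => by ring

/-- The generator `L_n^S` of the speed-change symmetric exclusion process with rates `c`. -/
def exclusionGen {d : ℕ} (c : Fin d → Config d → ℝ) (n : ℕ) [NeZero n] :
    (TorusConfig d n → ℝ) →ₗ[ℝ] (TorusConfig d n → ℝ) where
  toFun f := fun η => ∑ x : Torus d n, ∑ j : Fin d,
    c j (torusTranslate x η) * (f (exchange x (x + unitVec (ZMod n) j) η) - f η)
  map_add' f g := by
    funext η
    simp only [Pi.add_apply, ← Finset.sum_add_distrib]
    exact Finset.sum_congr rfl fun x _ => Finset.sum_congr rfl fun y _ => by ring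
  map_smul' r f := by
    funext η
    simp only [Pi.smul_apply, smul_eq_mul, RingHom.id_apply, Finset.mul_sum]
    exact Finset.sum_congr rfl fun x _ => Finset.sum_congr rfl fun y _ => by ring

/-- The generator `n^2 L_n^S + a L_n^V` of the voter model with stirring. -/
def gen {d : ℕ} (c : Fin d → Config d → ℝ) (a : ℝ) (n : ℕ) [NeZero n] :
    (TorusConfig d n → ℝ) →ₗ[ℝ] (TorusConfig d n → ℝ) :=
  (n : ℝ) ^ 2 • exclusionGen c n + a • voterGen d n

/-! ### Continuous-time Markov chains on a finite state space -/

section Markov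

variable {S : Type} [Fintype S]

/-- The semigroup `e^{tL}` of an operator `L` on the functions on a finite set. -/
def semigroup (L : (S → ℝ) →ₗ[ℝ] (S → ℝ)) (t : ℝ) : (S → ℝ) →L[ℝ] (S → ℝ) :=
  NormedSpace.exp (t • LinearMap.toContinuousLinearMap L)

/-- The transition probabilities `p_t(ξ, ζ) = (e^{tL} 1_{ζ})(ξ)`. -/
def transition [DecidableEq S] (L : (S → ℝ) →ₗ[ℝ] (S → ℝ)) (t : ℝ) (ξ ζ : S) : ℝ :=
  semigroup L t (Pi.single ζ 1) ξ

/-- Under the probability measure `P`, the process `(X t : t ≥ 0)` is the continuous-time Markov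
chain on `S` with generator `L` and initial distribution `μ`: its trajectories are
right-continuous with left limits, and its finite-dimensional distributions are the ones given by
`μ` and the transition probabilities of `L`. Only times `t ≥ 0` matter. -/
structure IsMarkovChain [DecidableEq S] [TopologicalSpace S] [MeasurableSpace S]
    {Ω : Type*} [MeasurableSpace Ω] (L : (S → ℝ) →ₗ[ℝ] (S → ℝ)) (μ : Measure S)
    (P : Measure Ω) (X : ℝ → Ω → S) : Prop where
  measurable : ∀ t, 0 ≤ t → Measurable (X t)
  right_continuous : ∀ ω, ∀ t, 0 ≤ t → ContinuousWithinAt (fun s => X s ω) (Set.Ici t) t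
  left_limits : ∀ ω, ∀ t, 0 < t → ∃ l : S, Tendsto (fun s => X s ω) (𝓝[<] t) (𝓝 l)
  finite_dim : ∀ (m : ℕ) (t : Fin (m + 1) → ℝ) (ξ : Fin (m + 1) → S), Monotone t → t 0 = 0 →
    P {ω | ∀ i, X (t i) ω = ξ i} =
      ENNReal.ofReal (μ.real {ξ 0} *
        ∏ i : Fin m, transition L (t i.succ - t i.castSucc) (ξ i.castSucc) (ξ i.succ))

end Markov

/-! ### Bernoulli measures, entropy scale and projections -/

/-- The Bernoulli distribution with parameter `ρ ∈ [0,1]` on `{0,1}`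
(`ρ` is truncated to `[0,1]` outside this interval). -/
def bern (ρ : ℝ) : Measure Bool :=
  bernoulliMeasure true false (Set.projIcc (0 : ℝ) 1 zero_le_one ρ)

/-- The Bernoulli product measure `ν_ρ^n` on `Ω_n`. -/
def nuTorus (d n : ℕ) [NeZero n] (ρ : ℝ) : Measure (TorusConfig d n) :=
  Measure.pi fun _ => bern ρ

/-- The Bernoulli product measure `ν_ρ` on `{0,1}^{ℤ^d}`. -/
def nu (d : ℕ) (ρ : ℝ) : Measure (Config d) :=
  Measure.infinitePi fun _ => bern ρ

/-- `f̃(ρ) = E_{ν_ρ}[f]`. -/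
def mean {d : ℕ} (f : Config d → ℝ) (ρ : ℝ) : ℝ := ∫ η, f η ∂(nu d ρ)

/-- The operator `(Π_ρ f)(η) = f(η) - f̃(ρ) - f̃'(ρ) (η_0 - ρ)`. -/
def proj {d : ℕ} (ρ : ℝ) (f : Config d → ℝ) (η : Config d) : ℝ :=
  f η - mean f ρ - deriv (mean f) ρ * (occ (η 0) - ρ)

/-- The sequence `R_d(n)`, written as a function of `a = a_n` and `n`, in dimension `d ≥ 1`. -/
def entropyScale (d : ℕ) (a : ℝ) (n : ℕ) : ℝ :=
  if d = 1 then Real.sqrt a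
  else if d = 2 then a * Real.log n
  else a * (n : ℝ) ^ (d - 2)

/-! ### Test functions and fields -/

/-- The class `C^{0,1}(ℝ_+ × 𝕋^d)`: continuous functions on `[0,∞) × 𝕋^d` whose first order
space derivatives exist and are continuous on `[0,∞) × 𝕋^d`. -/
def IsC01 {d : ℕ} (G : ℝ → (Fin d → UnitAddCircle) → ℝ) : Prop :=
  ContinuousOn (fun p : ℝ × (Fin d → UnitAddCircle) => G p.1 p.2) (Set.Ici 0 ×ˢ Set.univ) ∧
  ∀ j : Fin d, ∃ DG : ℝ → (Fin d → UnitAddCircle) → ℝ,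
    ContinuousOn (fun p : ℝ × (Fin d → UnitAddCircle) => DG p.1 p.2) (Set.Ici 0 ×ˢ Set.univ) ∧
    ∀ s, 0 ≤ s → ∀ u : Fin d → UnitAddCircle,
      HasDerivAt (fun h : ℝ => G s (u + Pi.single j (h : UnitAddCircle))) (DG s u) 0

/-- The field `(a n^d)^{-1/2} ∑_x F(x/n) g(τ_x η)`. -/
def localField {d n : ℕ} [NeZero n] (a : ℝ) (F : (Fin d → UnitAddCircle) → ℝ)
    (g : Config d → ℝ) (η : TorusConfig d n) : ℝ :=
  1 / Real.sqrt (a * (n : ℝ) ^ d) *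
    ∑ x : Torus d n, F (scaledPoint x) * g (torusTranslate x η)

end VoterStirring

end

/-!
# The Boltzmann-Gibbs principle for the voter model with stirring

Everything is compared with the Bernoulli product measure of density `ρ`, for which expectations
are finite sums `ev ρ`. Centre the occupation variables, `ω_x = η_x - ρ`. A cylinder function is a
linear combination of products `∏_{z ∈ A} ω_z`, and `Π_ρ` removes the constant and replaces each
`ω_z` by `ω_z - ω_0`: what is left are differences `ω_z - ω_0` and products of at least two factors
(`admissible_proj`).

**Static estimate.** In a field `∑_x G_x ω_x ∏_{b ∈ B} ω_{x+b}` the factor `ω_x` is replaced by its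
average over a box which avoids `x + B`. The difference is a sum over bonds of a flow times a
discrete gradient, and exchanging the two end points of a bond (integration by parts,
`ev_mul_cen_sub_le`) bounds it by the Dirichlet form of the exclusion dynamics plus squared flows.
The squared flows and the squared averages are sums of squares of sub-Gaussian local variables, so
by the entropy inequality their expectation under a density is controlled by its entropy
(`ev_sum_sq_le`, `exists_static_bound`). With a box of sides `L, L ^ 2, …, L ^ 2`, where
`a L ^ (2 d) ≈ n ^ 2`, such a field costs a small multiple of the accelerated Dirichlet form and at
most `C a` times the sum of the entropy and an error `a L n ^ (d - 2)`: this is the notion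
`Admissible`.

**Entropy.** The Bernoulli measure is invariant for the exclusion dynamics, because the rates do
not depend on the exchanged coordinates, but not for the voter dynamics. The defect is the field
`voterField`, quadratic in the `ω_x`, hence again covered by the static estimate; Gronwall's
inequality bounds the entropy at all times (`ent_density_le`).

**Time integrals.** Let `V_s` be the field at time `s`. By the static estimate, applied to `± V_s`
and to `voterField`, the operator `± V_s - R_s + L_n` is dissipative in `L²` for functions
`R_s ≥ 0` of small expectation. A Feynman-Kac inequality, used here in the form of a product
`e^{δL} e^{δU} e^{δL} e^{δU} …` (`eventually_path_exp_le`), bounds the exponential moment of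
`∫ (± V_s - R_s) ds` under the stationary weights, and the Gibbs variational principle on paths
(`sum_path_le_ent_add`) transfers this bound to the chain at the cost of the initial entropy.
Riemann sums along right-continuous trajectories and Fatou's lemma give the time integral
(`IsMarkovChain.lintegral_abs_integral_le`, `exists_field_bound`).

**Conclusion.** The resulting bound is `e^{C a}` times the initial entropy plus the error term,
divided by `n ^ (d / 2)`, hence at most of order `e^{C a} n ^ (-1 / 6)`, which vanishes because
`e^{C a}` grows more slowly than any power of `n` (`bound_le`, `tendsto_exp_div_rpow`). The
largest contribution is that of the error term, about `n ^ (d / 2 - 2 + 1 / d)`, and it is small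
precisely because `d ≤ 3`.
-/

set_option linter.unusedSectionVars false

noncomputable section

namespace VoterStirring

open InformationTheory (klFun klDiv)

/-! ### Expectations under Bernoulli product measures on finite sets -/

section Bernoulli

variable {V : Type} [Fintype V] [DecidableEq V]

/-- The probability that a Bernoulli variable of parameter `ρ` takes the value `b`. -/
def siteWeight (ρ : ℝ) (b : Bool) : ℝ := if b then ρ else 1 - ρ

/-- The probability of a single configuration under the Bernoulli product measure. -/
def weight (ρ : ℝ) (η : V → Bool) : ℝ := ∏ x, siteWeight ρ (η x)

/-- The expectation under the Bernoulli product measure, as a finite sum. -/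
def ev (ρ : ℝ) (F : (V → Bool) → ℝ) : ℝ := ∑ η, weight ρ η * F η

/-- The centred occupation variable. -/
def cen (ρ : ℝ) (b : Bool) : ℝ := occ b - ρ

lemma siteWeight_pos {ρ : ℝ} (h0 : 0 < ρ) (h1 : ρ < 1) (b : Bool) : 0 < siteWeight ρ b := by
  unfold siteWeight; split_ifs <;> linarith

lemma weight_pos {ρ : ℝ} (h0 : 0 < ρ) (h1 : ρ < 1) (η : V → Bool) : 0 < weight ρ η :=
  Finset.prod_pos fun _ _ => siteWeight_pos h0 h1 _

lemma sum_weight (ρ : ℝ) : ∑ η : V → Bool, weight ρ η = 1 := by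
  unfold weight
  rw [← Fintype.prod_sum (fun (_ : V) b => siteWeight ρ b)]
  simp [siteWeight]

lemma abs_cen_le {ρ : ℝ} (h0 : 0 < ρ) (h1 : ρ < 1) (b : Bool) : |cen ρ b| ≤ 1 := by
  unfold cen occ; split_ifs <;> rw [abs_le] <;> constructor <;> linarith

lemma cen_sub_sq_le (ρ : ℝ) (b b' : Bool) : (cen ρ b - cen ρ b') ^ 2 ≤ 1 := by
  have : cen ρ b - cen ρ b' = occ b - occ b' := by unfold cen; ring
  rw [this]
  cases b <;> cases b' <;> simp [occ]

lemma ev_const (ρ : ℝ) (c : ℝ) : ev (V := V) ρ (fun _ => c) = c := by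
  simp [ev, ← Finset.sum_mul, sum_weight]

lemma ev_add (ρ : ℝ) (F G : (V → Bool) → ℝ) :
    ev ρ (fun η => F η + G η) = ev ρ F + ev ρ G := by
  simp [ev, mul_add, Finset.sum_add_distrib]

lemma ev_sub (ρ : ℝ) (F G : (V → Bool) → ℝ) :
    ev ρ (fun η => F η - G η) = ev ρ F - ev ρ G := by
  simp [ev, mul_sub, Finset.sum_sub_distrib]

lemma ev_const_mul (ρ c : ℝ) (F : (V → Bool) → ℝ) :
    ev ρ (fun η => c * F η) = c * ev ρ F := by
  unfold ev; rw [Finset.mul_sum]; exact Finset.sum_congr rfl fun _ _ => by ring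

lemma ev_mul_const (ρ c : ℝ) (F : (V → Bool) → ℝ) :
    ev ρ (fun η => F η * c) = ev ρ F * c := by
  unfold ev; rw [Finset.sum_mul]; exact Finset.sum_congr rfl fun _ _ => by ring

lemma ev_sum {ι : Type*} (ρ : ℝ) (s : Finset ι) (F : ι → (V → Bool) → ℝ) :
    ev ρ (fun η => ∑ i ∈ s, F i η) = ∑ i ∈ s, ev ρ (F i) := by
  unfold ev; rw [Finset.sum_comm]; exact Finset.sum_congr rfl fun _ _ => by rw [Finset.mul_sum]

lemma ev_mono {ρ : ℝ} (h0 : 0 < ρ) (h1 : ρ < 1) {F G : (V → Bool) → ℝ} (h : ∀ η, F η ≤ G η) :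
    ev ρ F ≤ ev ρ G :=
  Finset.sum_le_sum fun η _ => mul_le_mul_of_nonneg_left (h η) (weight_pos h0 h1 η).le

lemma ev_nonneg {ρ : ℝ} (h0 : 0 < ρ) (h1 : ρ < 1) {F : (V → Bool) → ℝ} (h : ∀ η, 0 ≤ F η) :
    0 ≤ ev ρ F :=
  Finset.sum_nonneg fun η _ => mul_nonneg (weight_pos h0 h1 η).le (h η)

/-- Relabelling the sites preserves the product measure. -/
lemma ev_comp_perm (ρ : ℝ) (e : Equiv.Perm V) (F : (V → Bool) → ℝ) :
    ev ρ (fun η => F (fun z => η (e z))) = ev ρ F := by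
  unfold ev
  refine Fintype.sum_equiv (Equiv.arrowCongr e.symm (Equiv.refl Bool)) _ _ fun η => ?_
  have : weight ρ (fun z => η (e z)) = weight ρ η :=
    Fintype.prod_equiv e _ _ fun z => rfl
  rw [← this]
  rfl

lemma ev_mul_of_dependsOn (ρ : ℝ) (S : Finset V) {F G : (V → Bool) → ℝ}
    (hF : DependsOn F (S : Set V)) (hG : DependsOn G ((S : Set V)ᶜ)) :
    ev ρ (fun η => F η * G η) = ev ρ F * ev ρ G := by
  classical
  -- split a configuration into its restrictions to `S` and to the complement
  obtain ⟨p, hp⟩ : ∃ p : V → Prop, ∀ x, p x ↔ x ∈ S := ⟨fun x => x ∈ S, fun _ => Iff.rfl⟩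
  let e := Equiv.piEquivPiSubtypeProd p (fun _ : V => Bool)
  let w1 : ({x // p x} → Bool) → ℝ := fun ξ => ∏ x, siteWeight ρ (ξ x)
  let w2 : ({x // ¬ p x} → Bool) → ℝ := fun ξ => ∏ x, siteWeight ρ (ξ x)
  have hw : ∀ ξ, weight ρ (e.symm ξ) = w1 ξ.1 * w2 ξ.2 := by
    intro ξ
    unfold weight
    rw [← Fintype.prod_subtype_mul_prod_subtype p]
    congr 1
    · refine Finset.prod_congr rfl fun x _ => ?_
      simp [e, Equiv.piEquivPiSubtypeProd, x.2]
    · refine Finset.prod_congr rfl fun x _ => ?_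
      simp [e, Equiv.piEquivPiSubtypeProd, x.2]
  have hF' : ∀ ξ ζ, F (e.symm (ξ, ζ)) = F (e.symm (ξ, fun _ => false)) := fun ξ ζ =>
    hF fun x hx => by
      have : p x := (hp x).2 hx
      simp [e, Equiv.piEquivPiSubtypeProd, this]
  have hG' : ∀ ξ ζ, G (e.symm (ξ, ζ)) = G (e.symm (fun _ => false, ζ)) := fun ξ ζ =>
    hG fun x hx => by
      have : ¬ p x := fun h => hx ((hp x).1 h)
      simp [e, Equiv.piEquivPiSubtypeProd, this]
  have key : ∀ H : (V → Bool) → ℝ, ev ρ H = ∑ ξ, ∑ ζ, w1 ξ * w2 ζ * H (e.symm (ξ, ζ)) := by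
    intro H
    unfold ev
    rw [← Equiv.sum_comp e.symm, Fintype.sum_prod_type]
    exact Finset.sum_congr rfl fun ξ _ => Finset.sum_congr rfl fun ζ _ => by rw [hw]
  have h1 : (∑ ξ, w1 ξ) = 1 := by
    simp only [w1]
    rw [← Fintype.prod_sum (fun (_ : {x // p x}) b => siteWeight ρ b)]
    simp [siteWeight]
  have h2 : (∑ ξ, w2 ξ) = 1 := by
    simp only [w2]
    rw [← Fintype.prod_sum (fun (_ : {x // ¬ p x}) b => siteWeight ρ b)]
    simp [siteWeight]
  have eF : ev ρ F = ∑ ξ, w1 ξ * F (e.symm (ξ, fun _ => false)) := by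
    rw [key]
    refine Finset.sum_congr rfl fun ξ _ => ?_
    calc _ = ∑ ζ, w1 ξ * F (e.symm (ξ, fun _ => false)) * w2 ζ :=
          Finset.sum_congr rfl fun ζ _ => by rw [hF']; ring
      _ = _ := by rw [← Finset.mul_sum, h2, mul_one]
  have eG : ev ρ G = ∑ ζ, w2 ζ * G (e.symm (fun _ => false, ζ)) := by
    rw [key, Finset.sum_comm]
    refine Finset.sum_congr rfl fun ζ _ => ?_
    calc _ = ∑ ξ, w2 ζ * G (e.symm (fun _ => false, ζ)) * w1 ξ :=
          Finset.sum_congr rfl fun ξ _ => by rw [hG']; ring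
      _ = _ := by rw [← Finset.mul_sum, h1, mul_one]
  rw [eF, eG, key, Finset.sum_mul_sum]
  refine Finset.sum_congr rfl fun ξ _ => Finset.sum_congr rfl fun ζ _ => ?_
  rw [hF', hG']; ring

lemma DependsOn.finset_prod {ι : Type*} {c : Finset ι} {F : ι → (V → Bool) → ℝ} {S : Set V}
    (h : ∀ i ∈ c, DependsOn (F i) S) : DependsOn (fun η => ∏ i ∈ c, F i η) S :=
  fun _ _ hx => Finset.prod_congr rfl fun i hi => h i hi hx

lemma DependsOn.finset_sum {ι : Type*} {c : Finset ι} {F : ι → (V → Bool) → ℝ} {S : Set V}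
    (h : ∀ i ∈ c, DependsOn (F i) S) : DependsOn (fun η => ∑ i ∈ c, F i η) S :=
  fun _ _ hx => Finset.sum_congr rfl fun i hi => h i hi hx

/-- Functions of disjoint sets of sites are independent. -/
lemma ev_prod_of_disjoint {ι : Type*} (ρ : ℝ) (c : Finset ι) (S : ι → Finset V)
    (F : ι → (V → Bool) → ℝ) (hF : ∀ i ∈ c, DependsOn (F i) (S i : Set V))
    (hS : ∀ i ∈ c, ∀ j ∈ c, i ≠ j → Disjoint (S i) (S j)) :
    ev ρ (fun η => ∏ i ∈ c, F i η) = ∏ i ∈ c, ev ρ (F i) := by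
  classical
  induction c using Finset.induction_on with
  | empty => simpa using ev_const ρ 1
  | insert i c hi ih =>
    simp only [Finset.prod_insert hi]
    rw [ev_mul_of_dependsOn ρ (S i) (hF i (Finset.mem_insert_self _ _)), ih]
    · exact fun j hj => hF j (Finset.mem_insert_of_mem hj)
    · exact fun j hj k hk => hS j (Finset.mem_insert_of_mem hj) k (Finset.mem_insert_of_mem hk)
    · refine DependsOn.finset_prod fun j hj => (hF j (Finset.mem_insert_of_mem hj)).mono ?_
      have := hS j (Finset.mem_insert_of_mem hj) i (Finset.mem_insert_self _ _)
        (fun h => hi (h ▸ hj))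
      intro x hx hx'
      exact Finset.disjoint_left.1 this hx hx'

lemma ev_site (ρ : ℝ) (x : V) (φ : Bool → ℝ) :
    ev ρ (fun η => φ (η x)) = ρ * φ true + (1 - ρ) * φ false := by
  classical
  have : ∀ η : V → Bool, weight ρ η * φ (η x) =
      ∏ z, (siteWeight ρ (η z) * if z = x then φ (η z) else 1) := by
    intro η
    rw [Finset.prod_mul_distrib, Finset.prod_ite_eq' Finset.univ x]
    simp [weight]
  unfold ev
  rw [Finset.sum_congr rfl fun η _ => this η,
    ← Fintype.prod_sum (fun (z : V) b => siteWeight ρ b * if z = x then φ b else 1),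
    Finset.prod_eq_single x]
  · simp [siteWeight]
  · intro z _ hz; simp [siteWeight, hz]
  · simp

/-- Change of variables under a flip at `x`: the Radon-Nikodym factor of the flipped
measure is `siteWeight ρ (!η x) / siteWeight ρ (η x)`. -/
lemma ev_flip {ρ : ℝ} (h0 : 0 < ρ) (h1 : ρ < 1) (x : V) (F : (V → Bool) → ℝ) :
    ev ρ (fun η => F (Function.update η x (!(η x)))) =
      ev ρ (fun η => siteWeight ρ (!(η x)) / siteWeight ρ (η x) * F η) := by
  have hinv : Function.Involutive (fun η : V → Bool => Function.update η x (!(η x))) := by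
    intro η; simp
  unfold ev
  rw [← Equiv.sum_comp (hinv.toPerm _)]
  refine Finset.sum_congr rfl fun η _ => ?_
  have hw : weight ρ (Function.update η x (!(η x))) * siteWeight ρ (η x) =
      weight ρ η * siteWeight ρ (!(η x)) := by
    unfold weight
    rw [← Finset.mul_prod_erase _ _ (Finset.mem_univ x),
      ← Finset.mul_prod_erase _ (fun z => siteWeight ρ (η z)) (Finset.mem_univ x)]
    have : ∏ z ∈ Finset.univ.erase x, siteWeight ρ (Function.update η x (!(η x)) z) =
        ∏ z ∈ Finset.univ.erase x, siteWeight ρ (η z) :=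
      Finset.prod_congr rfl fun z hz => by
        rw [Function.update_of_ne (Finset.ne_of_mem_erase hz)]
    rw [this]; simp only [Function.update_self]; ring
  have hs := (siteWeight_pos h0 h1 (η x)).ne'
  have e1 : hinv.toPerm _ η = Function.update η x (!(η x)) := rfl
  rw [e1]
  simp only [Function.update_self, Function.update_idem, Bool.not_not, Function.update_eq_self]
  field_simp
  linear_combination F η * hw

end Bernoulli

open scoped Pointwise

/-! ### Entropy inequality and concentration -/

section Entropy

variable {V : Type} [Fintype V] [DecidableEq V]

/-- The relative entropy of the density `f` with respect to the Bernoulli product measure. -/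
def ent (ρ : ℝ) (f : (V → Bool) → ℝ) : ℝ := ev ρ fun η => klFun (f η)

/-- `f` is a probability density with respect to the Bernoulli product measure. -/
structure IsDensity (ρ : ℝ) (f : (V → Bool) → ℝ) : Prop where
  nonneg : ∀ η, 0 ≤ f η
  ev_eq_one : ev ρ f = 1

lemma ent_nonneg {ρ : ℝ} (h0 : 0 < ρ) (h1 : ρ < 1) {f : (V → Bool) → ℝ} (hf : ∀ η, 0 ≤ f η) :
    0 ≤ ent ρ f :=
  ev_nonneg h0 h1 fun η => InformationTheory.klFun_nonneg (hf η)

/-- Young's inequality for the convex conjugate pair `klFun` and `exp - 1`. -/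
lemma mul_le_klFun_add_exp {x : ℝ} (hx : 0 ≤ x) (y : ℝ) :
    x * y ≤ klFun x + Real.exp y - 1 := by
  rw [InformationTheory.klFun_apply]
  rcases hx.eq_or_lt with rfl | hx
  · simpa using (Real.exp_pos y).le
  · have h : Real.exp y = x * Real.exp (y - Real.log x) := by
      rw [Real.exp_sub, Real.exp_log hx]; field_simp
    have := mul_le_mul_of_nonneg_left (Real.add_one_le_exp (y - Real.log x)) hx.le
    rw [h]; linarith

/-- The entropy inequality. -/
lemma entropy_inequality {ρ : ℝ} (h0 : 0 < ρ) (h1 : ρ < 1) {f Ψ : (V → Bool) → ℝ}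
    (hf : IsDensity ρ f) {c : ℝ} (hΨ : ev ρ (fun η => Real.exp (Ψ η)) ≤ Real.exp c) :
    ev ρ (fun η => f η * Ψ η) ≤ ent ρ f + c := by
  have h2 : ev ρ (fun η => f η * (Ψ η - c)) ≤
      ev ρ (fun η => klFun (f η) + Real.exp (-c) * Real.exp (Ψ η) - 1) :=
    ev_mono h0 h1 fun η => by
      have := mul_le_klFun_add_exp (hf.nonneg η) (Ψ η - c)
      rwa [sub_eq_add_neg (Ψ η), add_comm (Ψ η), Real.exp_add, ← sub_eq_neg_add] at this
  rw [ev_sub, ev_add, ev_const_mul, ev_const] at h2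
  simp only [mul_sub] at h2
  rw [ev_sub, ev_mul_const, hf.ev_eq_one] at h2
  have h3 := mul_le_mul_of_nonneg_left hΨ (Real.exp_pos (-c)).le
  rw [← Real.exp_add, neg_add_cancel, Real.exp_zero] at h3
  unfold ent
  linarith

/-- Hoeffding's lemma. -/
lemma ev_exp_le_of_abs_le {ρ : ℝ} (h0 : 0 < ρ) (h1 : ρ < 1) {X : (V → Bool) → ℝ} {M : ℝ}
    (hM : 0 < M) (hX : ∀ η, |X η| ≤ M) (hev : ev ρ X = 0) :
    ev ρ (fun η => Real.exp (X η)) ≤ Real.exp (M ^ 2 / 2) := by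
  have key : ∀ η, Real.exp (X η) ≤ Real.cosh M + X η * (Real.sinh M / M) := by
    intro η
    obtain ⟨ha, hb⟩ := abs_le.1 (hX η)
    have h2 : 0 ≤ (1 + X η / M) / 2 := by
      have : -1 ≤ X η / M := by rw [le_div_iff₀ hM]; linarith
      linarith
    have h3 : 0 ≤ (1 - X η / M) / 2 := by
      have : X η / M ≤ 1 := by rw [div_le_iff₀ hM]; linarith
      linarith
    have h := convexOn_exp.2 (Set.mem_univ M) (Set.mem_univ (-M)) h2 h3 (by ring)
    simp only [smul_eq_mul] at h
    have e : (1 + X η / M) / 2 * M + (1 - X η / M) / 2 * -M = X η := by field_simp; ring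
    rw [e] at h
    refine h.trans (le_of_eq ?_)
    rw [Real.cosh_eq, Real.sinh_eq]; field_simp; ring
  refine (ev_mono h0 h1 key).trans ?_
  rw [ev_add, ev_const, ev_mul_const, hev, zero_mul, add_zero]
  exact Real.cosh_le_exp_half_sq M

lemma exp_mul_sq_eq_integral {θ : ℝ} (hθ : 0 ≤ θ) (x : ℝ) :
    Real.exp (θ * x ^ 2) * √Real.pi =
      ∫ g : ℝ, Real.exp (-g ^ 2) * Real.exp (2 * √θ * g * x) := by
  have h : ∀ g : ℝ, Real.exp (-g ^ 2) * Real.exp (2 * √θ * g * x) =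
      Real.exp (θ * x ^ 2) * Real.exp (-1 * (g - √θ * x) ^ 2) := by
    intro g
    rw [← Real.exp_add, ← Real.exp_add]
    congr 1
    have := Real.sq_sqrt hθ
    linear_combination x ^ 2 * this
  simp_rw [h]
  rw [integral_const_mul, integral_sub_right_eq_self (fun g => Real.exp (-1 * g ^ 2)),
    integral_gaussian, div_one]

lemma integrable_gaussian_mul_exp {θ : ℝ} (hθ : 0 ≤ θ) (x : ℝ) :
    Integrable fun g : ℝ => Real.exp (-g ^ 2) * Real.exp (2 * √θ * g * x) := by
  have h : (fun g : ℝ => Real.exp (-g ^ 2) * Real.exp (2 * √θ * g * x)) =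
      fun g => Real.exp (θ * x ^ 2) * Real.exp (-1 * (g - √θ * x) ^ 2) := by
    funext g
    rw [← Real.exp_add, ← Real.exp_add]
    congr 1
    have := Real.sq_sqrt hθ
    linear_combination x ^ 2 * this
  rw [h]
  exact ((integrable_exp_neg_mul_sq one_pos).comp_sub_right (√θ * x)).const_mul _

/-- Exponential moments of the square of a sub-Gaussian variable. The square is linearized by
an auxiliary Gaussian integration. -/
lemma ev_exp_sq_le {ρ : ℝ} {X : (V → Bool) → ℝ} {s θ : ℝ}
    (hθ : 0 ≤ θ) (hθs : θ * s ≤ 1 / 4)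
    (hX : ∀ t : ℝ, ev ρ (fun η => Real.exp (t * X η)) ≤ Real.exp (s * t ^ 2 / 2)) :
    ev ρ (fun η => Real.exp (θ * X η ^ 2)) ≤ Real.exp (1 / 2) := by
  have hpi : 0 < √Real.pi := Real.sqrt_pos.2 Real.pi_pos
  have hint : ∀ η, Integrable fun g : ℝ =>
      weight ρ η * (Real.exp (-g ^ 2) * Real.exp (2 * √θ * g * X η)) := fun η =>
    (integrable_gaussian_mul_exp hθ _).const_mul _
  have h2 : ev ρ (fun η => Real.exp (θ * X η ^ 2)) * √Real.pi ≤ √(Real.pi / (1 / 2)) := by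
    calc ev ρ (fun η => Real.exp (θ * X η ^ 2)) * √Real.pi
        = ∑ η, ∫ g : ℝ, weight ρ η * (Real.exp (-g ^ 2) * Real.exp (2 * √θ * g * X η)) := by
          unfold ev
          rw [Finset.sum_mul]
          refine Finset.sum_congr rfl fun η _ => ?_
          rw [integral_const_mul, ← exp_mul_sq_eq_integral hθ, mul_assoc]
      _ = ∫ g : ℝ, ∑ η, weight ρ η * (Real.exp (-g ^ 2) * Real.exp (2 * √θ * g * X η)) :=
          (integral_finsetSum _ fun η _ => hint η).symm
      _ ≤ ∫ g : ℝ, Real.exp (-(1 / 2) * g ^ 2) := by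
          refine integral_mono (integrable_finsetSum _ fun η _ => hint η)
            (integrable_exp_neg_mul_sq (by norm_num)) fun g => ?_
          have e : ∑ η, weight ρ η * (Real.exp (-g ^ 2) * Real.exp (2 * √θ * g * X η)) =
              Real.exp (-g ^ 2) * ev ρ (fun η => Real.exp (2 * √θ * g * X η)) := by
            unfold ev; rw [Finset.mul_sum]
            exact Finset.sum_congr rfl fun _ _ => by ring
          simp only [e]
          refine (mul_le_mul_of_nonneg_left (hX _) (Real.exp_pos _).le).trans ?_
          rw [← Real.exp_add]
          refine Real.exp_le_exp.2 ?_
          have := Real.sq_sqrt hθ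
          have h3 : s * (2 * √θ * g) ^ 2 / 2 = 2 * (θ * s) * g ^ 2 := by
            linear_combination 2 * s * g ^ 2 * this
          rw [h3]
          nlinarith [sq_nonneg g]
      _ = √(Real.pi / (1 / 2)) := integral_gaussian _
  have h3 : √(Real.pi / (1 / 2)) = √2 * √Real.pi := by
    rw [← Real.sqrt_mul (by norm_num)]; congr 1; ring
  rw [h3] at h2
  refine (le_of_mul_le_mul_right h2 hpi).trans ?_
  rw [Real.sqrt_le_left (Real.exp_pos _).le, ← Real.exp_nat_mul]
  have := Real.add_one_le_exp (1 : ℝ)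
  norm_num at this ⊢
  exact this

end Entropy

section Coloring

variable {T : Type} [AddCommGroup T] [Fintype T] [DecidableEq T]

/-- Greedy colouring of a Cayley graph. -/
lemma exists_coloring (E : Finset T) (h0 : 0 ∈ E) (hE : ∀ z ∈ E, -z ∈ E) :
    ∃ col : T → Fin E.card, ∀ x y, x ≠ y → y - x ∈ E → col x ≠ col y := by
  have hpos : 0 < E.card := Finset.card_pos.2 ⟨0, h0⟩
  suffices h : ∀ A : Finset T, ∃ col : T → Fin E.card,
      ∀ x ∈ A, ∀ y ∈ A, x ≠ y → y - x ∈ E → col x ≠ col y by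
    obtain ⟨col, hcol⟩ := h Finset.univ
    exact ⟨col, fun x y => hcol x (Finset.mem_univ _) y (Finset.mem_univ _)⟩
  intro A
  induction A using Finset.induction_on with
  | empty => exact ⟨fun _ => ⟨0, hpos⟩, by simp⟩
  | insert a A ha ih =>
    obtain ⟨col, hcol⟩ := ih
    -- the colours already used at the neighbours of `a`
    let used : Finset (Fin E.card) := (E.erase 0).image fun z => col (a + z)
    have hcard : used.card < E.card :=
      Finset.card_image_le.trans_lt (by rw [Finset.card_erase_of_mem h0]; omega)
    obtain ⟨k, hk⟩ : ∃ k, k ∉ used := by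
      by_contra! h
      have : used = Finset.univ := Finset.eq_univ_iff_forall.2 h
      rw [this, Finset.card_univ, Fintype.card_fin] at hcard
      exact lt_irrefl _ hcard
    have hused : ∀ y, y ≠ a → y - a ∈ E → col y ≠ k := by
      intro y hy hyE h
      refine hk (Finset.mem_image.2 ⟨y - a, Finset.mem_erase.2 ⟨sub_ne_zero.2 hy, hyE⟩, ?_⟩)
      rw [add_sub_cancel, h]
    refine ⟨Function.update col a k, fun x hx y hy hxy hE' => ?_⟩
    rcases Finset.mem_insert.1 hx with rfl | hx
    · rw [Function.update_self, Function.update_of_ne hxy.symm]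
      exact (hused y hxy.symm hE').symm
    · rcases Finset.mem_insert.1 hy with rfl | hy
      · rw [Function.update_self, Function.update_of_ne hxy]
        exact hused x hxy (by simpa using hE _ hE')
      · have hxa : x ≠ a := fun h => ha (h ▸ hx)
        have hya : y ≠ a := fun h => ha (h ▸ hy)
        rw [Function.update_of_ne hxa, Function.update_of_ne hya]
        exact hcol x hx y hy hxy hE'

/-- A colouring of the group such that translates of `S` by distinct points of the same colour
are disjoint, with `|S - S|` colours. -/
lemma exists_coloring_disjoint {S : Finset T} (hS : S.Nonempty) :
    ∃ col : T → Fin (S - S).card, ∀ x y, x ≠ y → col x = col y →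
      Disjoint (S.image (x + ·)) (S.image (y + ·)) := by
  obtain ⟨s, hs⟩ := hS
  obtain ⟨col, hcol⟩ := exists_coloring (S - S)
    (Finset.mem_sub.2 ⟨s, hs, s, hs, sub_self s⟩) (fun z hz => by
      obtain ⟨a, ha, b, hb, rfl⟩ := Finset.mem_sub.1 hz
      exact Finset.mem_sub.2 ⟨b, hb, a, ha, by abel⟩)
  refine ⟨col, fun x y hxy hc => ?_⟩
  rw [Finset.disjoint_left]
  intro z hz hz'
  obtain ⟨a, ha, rfl⟩ := Finset.mem_image.1 hz
  obtain ⟨b, hb, h⟩ := Finset.mem_image.1 hz'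
  refine hcol x y hxy (Finset.mem_sub.2 ⟨a, ha, b, hb, ?_⟩) hc
  rw [sub_eq_sub_iff_add_eq_add]
  rw [add_comm a x]; exact h.symm

end Coloring

section Concentration

variable {T : Type} [AddCommGroup T] [Fintype T] [DecidableEq T]

/-- Linear combinations of centred bounded local functions are sub-Gaussian. -/
lemma ev_exp_linear_le {ρ : ℝ} (h0 : 0 < ρ) (h1 : ρ < 1) {S : Finset T} (hS : S.Nonempty)
    {u : T → (T → Bool) → ℝ} {M : ℝ} (hM : 0 < M)
    (hdep : ∀ x, DependsOn (u x) (S.image (x + ·) : Set T))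
    (hu : ∀ x η, |u x η| ≤ M) (hev : ∀ x, ev ρ (u x) = 0) (α : T → ℝ) :
    ev ρ (fun η => Real.exp (∑ x, α x * u x η)) ≤
      Real.exp (((S - S).card * M) ^ 2 * (∑ x, α x ^ 2) / 2) := by
  have hex := exists_coloring_disjoint hS
  have hDpos : 0 < (S - S).card := Finset.card_pos.2 (hS.sub hS)
  generalize (S - S).card = D at hex hDpos ⊢
  obtain ⟨col, hcol⟩ := hex
  have hD0 : (D : ℝ) ≠ 0 := by positivity
  have hclass : ∀ k : Fin D, ev ρ (fun η => Real.exp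
      (∑ x ∈ Finset.univ.filter (fun x => col x = k), (D : ℝ) * (α x * u x η))) ≤
      Real.exp ((D * M) ^ 2 * (∑ x, α x ^ 2) / 2) := by
    intro k
    simp only [Real.exp_sum]
    rw [ev_prod_of_disjoint ρ _ (fun x => S.image (x + ·))]
    · have hle : ∀ x ∈ Finset.univ.filter (fun x => col x = k),
          ev ρ (fun η => Real.exp ((D : ℝ) * (α x * u x η))) ≤
            Real.exp ((D * M) ^ 2 / 2 * α x ^ 2) := by
        intro x _
        by_cases hα : α x = 0
        · simp [hα, ev_const]
        · have := ev_exp_le_of_abs_le h0 h1 (X := fun η => (D : ℝ) * (α x * u x η))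
            (M := D * (|α x| * M)) (by positivity)
            (fun η => by
              rw [abs_mul, abs_mul, abs_of_nonneg (Nat.cast_nonneg D)]
              gcongr; exact hu x η)
            (by rw [ev_const_mul, ev_const_mul, hev, mul_zero, mul_zero])
          refine this.trans (le_of_eq ?_)
          congr 1
          rw [mul_pow, mul_pow, sq_abs]; ring
      refine (Finset.prod_le_prod (fun x _ => ev_nonneg h0 h1 fun η => (Real.exp_pos _).le)
        hle).trans ?_
      rw [← Real.exp_sum, ← Finset.mul_sum]
      refine Real.exp_le_exp.2 ?_
      have : ∑ x ∈ Finset.univ.filter (fun x => col x = k), α x ^ 2 ≤ ∑ x, α x ^ 2 :=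
        Finset.sum_le_sum_of_subset_of_nonneg (Finset.subset_univ _) fun _ _ _ => sq_nonneg _
      calc _ ≤ (D * M) ^ 2 / 2 * ∑ x, α x ^ 2 := by gcongr
        _ = _ := by ring
    · intro x _ η η' h
      have := hdep x h
      simp only [this]
    · intro x hx y hy hxy
      simp only [Finset.mem_filter] at hx hy
      exact hcol x y hxy (hx.2.trans hy.2.symm)
  -- Jensen's inequality over the colours
  have hjensen : ∀ η, Real.exp (∑ x, α x * u x η) ≤ ∑ k : Fin D, (1 / D : ℝ) *
      Real.exp (∑ x ∈ Finset.univ.filter (fun x => col x = k), (D : ℝ) * (α x * u x η)) := by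
    intro η
    have := convexOn_exp.map_sum_le (t := (Finset.univ : Finset (Fin D)))
      (w := fun _ => (1 / D : ℝ))
      (p := fun k => ∑ x ∈ Finset.univ.filter (fun x => col x = k), (D : ℝ) * (α x * u x η))
      (fun _ _ => by positivity) (by simp [hD0]) (fun _ _ => Set.mem_univ _)
    simp only [smul_eq_mul] at this
    refine le_trans (le_of_eq ?_) this
    congr 1
    rw [← Finset.sum_fiberwise Finset.univ col]
    refine Finset.sum_congr rfl fun k _ => ?_
    rw [← Finset.mul_sum]; field_simp
  refine (ev_mono h0 h1 hjensen).trans ?_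
  rw [ev_sum]
  simp only [ev_const_mul]
  refine (Finset.sum_le_sum fun k _ =>
    mul_le_mul_of_nonneg_left (hclass k) (by positivity)).trans (le_of_eq ?_)
  simp [hD0]

/-- Entropy bound for a sum over the group of squares of local sub-Gaussian variables. -/
lemma ev_sum_sq_le {ρ : ℝ} (h0 : 0 < ρ) (h1 : ρ < 1) {S : Finset T} (hS : S.Nonempty)
    {K : T → (T → Bool) → ℝ} {s : ℝ} (hs : 0 < s)
    (hdep : ∀ y, DependsOn (K y) (S.image (y + ·) : Set T))
    (hK : ∀ y, ∀ t : ℝ, ev ρ (fun η => Real.exp (t * K y η)) ≤ Real.exp (s * t ^ 2 / 2))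
    {f : (T → Bool) → ℝ} (hf : IsDensity ρ f) :
    ev ρ (fun η => f η * ∑ y, K y η ^ 2) ≤
      4 * s * ((S - S).card * ent ρ f + Fintype.card T) := by
  obtain ⟨col, hcol⟩ := exists_coloring_disjoint hS
  have hclass : ∀ k : Fin (S - S).card,
      ev ρ (fun η => f η * ∑ y ∈ Finset.univ.filter (fun y => col y = k),
        1 / (4 * s) * K y η ^ 2) ≤
      ent ρ f + (Finset.univ.filter (fun y => col y = k)).card * (1 / 2) := by
    intro k
    refine entropy_inequality h0 h1 hf ?_
    simp only [Real.exp_sum]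
    rw [ev_prod_of_disjoint ρ _ (fun x => S.image (x + ·))]
    · refine (Finset.prod_le_prod (fun x _ => ev_nonneg h0 h1 fun η => (Real.exp_pos _).le)
        (fun y _ => ev_exp_sq_le (by positivity) (by field_simp; norm_num) (hK y))).trans
        (le_of_eq ?_)
      rw [Finset.prod_const, ← Real.exp_nat_mul]
    · intro x _ η η' h
      have := hdep x h
      simp only [this]
    · intro x hx y hy hxy
      simp only [Finset.mem_filter] at hx hy
      exact hcol x y hxy (hx.2.trans hy.2.symm)
  have hsum := Finset.sum_le_sum fun k (_ : k ∈ Finset.univ) => hclass k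
  rw [← ev_sum, Finset.sum_add_distrib, ← Finset.sum_mul, ← Nat.cast_sum,
    ← Finset.card_eq_sum_card_fiberwise (fun _ _ => Finset.mem_univ _)] at hsum
  simp only [← Finset.mul_sum, Finset.sum_fiberwise, Finset.sum_const, Finset.card_univ,
    Fintype.card_fin, nsmul_eq_mul] at hsum
  have e : ∀ η, f η * (1 / (4 * s) * ∑ y, K y η ^ 2) =
      1 / (4 * s) * (f η * ∑ y, K y η ^ 2) := fun η => by ring
  simp only [e] at hsum
  rw [ev_const_mul, one_div, inv_mul_le_iff₀ (by positivity)] at hsum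
  refine hsum.trans ?_
  have : (0 : ℝ) ≤ Fintype.card T := by positivity
  gcongr
  linarith

end Concentration

open scoped Pointwise

/-! ### Dirichlet form and integration by parts -/

section Dirichlet

variable {d n : ℕ} [NeZero n]

/-- The Dirichlet form of the symmetric simple exclusion process on the torus (up to a factor). -/
def dirichlet (ρ : ℝ) (u : TorusConfig d n → ℝ) : ℝ :=
  ∑ y : Torus d n, ∑ k : Fin d,
    ev ρ fun η => (u (exchange y (y + unitVec (ZMod n) k) η) - u η) ^ 2

lemma ev_exchange (ρ : ℝ) (x y : Torus d n) (F : TorusConfig d n → ℝ) :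
    ev ρ (fun η => F (exchange x y η)) = ev ρ F :=
  ev_comp_perm ρ (Equiv.swap x y) F

/-- Integration by parts for the exchange of the values at two sites. -/
lemma ev_mul_cen_sub_le {ρ : ℝ} (h0 : 0 < ρ) (h1 : ρ < 1) {y y' : Torus d n}
    {h : TorusConfig d n → ℝ} (hinv : ∀ η, h (exchange y y' η) = h η) {δ : ℝ} (hδ : 0 < δ)
    (u : TorusConfig d n → ℝ) :
    ev ρ (fun η => h η * (cen ρ (η y) - cen ρ (η y')) * u η ^ 2) ≤
      δ / 2 * ev ρ (fun η => (u (exchange y y' η) - u η) ^ 2) +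
        1 / (2 * δ) * ev ρ (fun η => h η ^ 2 * u η ^ 2) := by
  have e1 : ev ρ (fun η => h η * (cen ρ (η y) - cen ρ (η y')) * u η ^ 2) =
      ev ρ (fun η => -(h η * (cen ρ (η y) - cen ρ (η y')) * u (exchange y y' η) ^ 2)) := by
    rw [← ev_exchange ρ y y']
    congr 1
    funext η
    rw [hinv]
    simp only [exchange, Equiv.swap_apply_left, Equiv.swap_apply_right]
    ring
  have e2 : ev ρ (fun η => h η ^ 2 * u (exchange y y' η) ^ 2) =
      ev ρ (fun η => h η ^ 2 * u η ^ 2) := by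
    rw [← ev_exchange ρ y y' (fun η => h η ^ 2 * u η ^ 2)]
    simp only [hinv]
  have e3 : ev ρ (fun η => h η * (cen ρ (η y) - cen ρ (η y')) * u η ^ 2) =
      ev ρ (fun η => 1 / 2 * (h η * (cen ρ (η y) - cen ρ (η y')) *
        (u η ^ 2 - u (exchange y y' η) ^ 2))) := by
    have : ∀ η, 1 / 2 * (h η * (cen ρ (η y) - cen ρ (η y')) *
        (u η ^ 2 - u (exchange y y' η) ^ 2)) =
        1 / 2 * (h η * (cen ρ (η y) - cen ρ (η y')) * u η ^ 2) +
        1 / 2 * -(h η * (cen ρ (η y) - cen ρ (η y')) * u (exchange y y' η) ^ 2) :=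
      fun η => by ring
    simp only [this]
    rw [ev_add, ev_const_mul, ev_const_mul, ← e1]; ring
  have e4 : δ / 2 * ev ρ (fun η => (u (exchange y y' η) - u η) ^ 2) +
      1 / (2 * δ) * ev ρ (fun η => h η ^ 2 * u η ^ 2) =
      ev ρ (fun η => δ / 2 * (u (exchange y y' η) - u η) ^ 2 +
        (1 / (4 * δ) * (h η ^ 2 * u η ^ 2) +
          1 / (4 * δ) * (h η ^ 2 * u (exchange y y' η) ^ 2))) := by
    rw [ev_add, ev_add, ev_const_mul, ev_const_mul, ev_const_mul, e2]
    field_simp; ring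
  rw [e3, e4]
  refine ev_mono h0 h1 fun η => ?_
  have hc := cen_sub_sq_le ρ (η y) (η y')
  generalize u (exchange y y' η) = v
  generalize u η = w
  generalize cen ρ (η y) - cen ρ (η y') = c at hc ⊢
  generalize h η = k
  have s1 : 1 / 2 * (k * c * (w ^ 2 - v ^ 2)) ≤
      δ / 2 * (v - w) ^ 2 + 1 / (8 * δ) * (k * c * (w + v)) ^ 2 := by
    have : 0 ≤ 1 / (8 * δ) * (2 * δ * (v - w) + k * c * (w + v)) ^ 2 := by positivity
    have e : 1 / (8 * δ) * (2 * δ * (v - w) + k * c * (w + v)) ^ 2 =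
        δ / 2 * (v - w) ^ 2 + 1 / (8 * δ) * (k * c * (w + v)) ^ 2
          - 1 / 2 * (k * c * (w ^ 2 - v ^ 2)) := by
      field_simp; ring
    linarith
  have s2 : (k * c * (w + v)) ^ 2 ≤ 2 * (k ^ 2 * w ^ 2 + k ^ 2 * v ^ 2) := by
    have : (k * c * (w + v)) ^ 2 = c ^ 2 * (k * (w + v)) ^ 2 := by ring
    rw [this]
    calc c ^ 2 * (k * (w + v)) ^ 2 ≤ 1 * (k * (w + v)) ^ 2 := by gcongr
      _ ≤ _ := by nlinarith [sq_nonneg (k * (w - v))]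
  have s3 : 1 / (8 * δ) * (k * c * (w + v)) ^ 2 ≤
      1 / (8 * δ) * (2 * (k ^ 2 * w ^ 2 + k ^ 2 * v ^ 2)) := by gcongr
  have s4 : 1 / (8 * δ) * (2 * (k ^ 2 * w ^ 2 + k ^ 2 * v ^ 2)) =
      1 / (4 * δ) * (k ^ 2 * w ^ 2) + 1 / (4 * δ) * (k ^ 2 * v ^ 2) := by
    field_simp; ring
  linarith

end Dirichlet

/-! ### Averaging kernels on the cyclic group and their flows -/

section Kernels

variable {n : ℕ} [NeZero n]

/-- A nonnegative kernel on `ℤ/nℤ` with supremum at most `M` and mass at most `m`, supported in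
`{0, …, r - 1}`. -/
structure IsKernel (q : ZMod n → ℝ) (M m : ℝ) (r : ℕ) : Prop where
  nonneg : ∀ z, 0 ≤ q z
  le_sup : ∀ z, q z ≤ M
  sum_le : ∑ z, q z ≤ m
  supp : ∀ z, q z ≠ 0 → z.val < r

/-- The uniform probability on `{0, …, l - 1}`. -/
def unif (l : ℕ) (z : ZMod n) : ℝ := if z.val < l then 1 / l else 0

/-- The flow that transports the point mass at `0` to `unif l`. -/
def ramp (l : ℕ) (z : ZMod n) : ℝ := if z.val < l then 1 - (z.val + 1) / l else 0

/-- The convolution of `unif l` with `q`. -/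
def smooth (l : ℕ) (q : ZMod n → ℝ) (z : ZMod n) : ℝ := ∑ w, unif l w * q (z - w)

/-- The triangular kernel, the convolution of `unif l` with itself. -/
def tri (l : ℕ) : ZMod n → ℝ := smooth l (unif l)

/-- The flow that transports the point mass at `0` to `tri l`. -/
def triRamp (l : ℕ) (z : ZMod n) : ℝ := ramp l z + smooth l (ramp l) z

lemma sum_val_lt (l : ℕ) (hl : l ≤ n) (c : ℝ) :
    ∑ z : ZMod n, (if z.val < l then c else 0) = l * c := by
  obtain ⟨k, rfl⟩ : ∃ k, n = k + 1 := ⟨n - 1, by have := NeZero.ne n; omega⟩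
  have : ∑ z : ZMod (k + 1), (if z.val < l then c else 0) =
      ∑ i ∈ Finset.range (k + 1), (if i < l then c else 0) :=
    (Finset.sum_range (fun i => if i < l then c else 0)).symm
  rw [this, ← Finset.sum_filter]
  have : (Finset.range (k + 1)).filter (fun i => i < l) = Finset.range l := by
    ext i; simp; omega
  rw [this]; simp

lemma sum_unif {l : ℕ} (h1 : 1 ≤ l) (hl : l ≤ n) : ∑ z : ZMod n, unif l z = 1 := by
  unfold unif
  rw [sum_val_lt l hl]
  have : (l : ℝ) ≠ 0 := by positivity
  field_simp

lemma isKernel_unif {l : ℕ} (h1 : 1 ≤ l) (hl : l ≤ n) :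
    IsKernel (n := n) (unif l) (1 / l) 1 l where
  nonneg z := by unfold unif; split_ifs <;> positivity
  le_sup z := by unfold unif; split_ifs <;> first | exact le_rfl | positivity
  sum_le := (sum_unif h1 hl).le
  supp z h := by unfold unif at h; by_contra hz; simp [hz] at h

lemma isKernel_ramp {l : ℕ} (h1 : 1 ≤ l) (hl : l ≤ n) :
    IsKernel (n := n) (ramp l) 1 l l := by
  have hlp : (0 : ℝ) < l := by positivity
  have hle : ∀ z : ZMod n, ramp l z ≤ if z.val < l then 1 else 0 := by
    intro z; unfold ramp; split_ifs
    · have : (0 : ℝ) ≤ (z.val + 1) / l := by positivity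
      linarith
    · exact le_rfl
  refine ⟨fun z => ?_, fun z => (hle z).trans ?_, ?_, fun z h => ?_⟩
  · unfold ramp; split_ifs with h
    · have : ((z.val : ℝ) + 1) / l ≤ 1 := by
        rw [div_le_one hlp]; exact_mod_cast h
      linarith
    · exact le_rfl
  · split_ifs <;> norm_num
  · refine (Finset.sum_le_sum fun z _ => hle z).trans ?_
    rw [sum_val_lt l hl]; simp
  · unfold ramp at h; by_contra hz; simp [hz] at h

lemma isKernel_single {r : ℕ} (hr : 1 ≤ r) :
    IsKernel (n := n) (Pi.single 0 1) 1 1 r where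
  nonneg z := by rw [Pi.single_apply]; split_ifs <;> norm_num
  le_sup z := by rw [Pi.single_apply]; split_ifs <;> norm_num
  sum_le := by simp
  supp z h := by
    have : z = 0 := by by_contra hz; simp [hz] at h
    subst this; rw [ZMod.val_zero]; omega

lemma sum_smooth {l : ℕ} (h1 : 1 ≤ l) (hl : l ≤ n) (q : ZMod n → ℝ) :
    ∑ z, smooth l q z = ∑ z, q z := by
  unfold smooth
  rw [Finset.sum_comm]
  have : ∀ w : ZMod n, ∑ z, unif l w * q (z - w) = unif l w * ∑ z, q z := fun w => by
    rw [← Finset.mul_sum, show ∑ z, q (z - w) = ∑ z, q z from Equiv.sum_comp (Equiv.subRight w) q]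
  simp only [this]
  rw [← Finset.sum_mul, sum_unif h1 hl, one_mul]

lemma isKernel_smooth {l r : ℕ} (h1 : 1 ≤ l) (hl : l ≤ n) {q : ZMod n → ℝ} {M m : ℝ}
    (hq : IsKernel q M m (r + 1)) : IsKernel (smooth l q) M m (l + r) where
  nonneg z := Finset.sum_nonneg fun w _ =>
    mul_nonneg ((isKernel_unif h1 hl).nonneg w) (hq.nonneg _)
  le_sup z := by
    calc smooth l q z ≤ ∑ w, unif l w * M := Finset.sum_le_sum fun w _ =>
          mul_le_mul_of_nonneg_left (hq.le_sup _) ((isKernel_unif h1 hl).nonneg w)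
      _ = M := by rw [← Finset.sum_mul, sum_unif h1 hl, one_mul]
  sum_le := by rw [sum_smooth h1 hl]; exact hq.sum_le
  supp z h := by
    obtain ⟨w, _, hw⟩ := Finset.exists_ne_zero_of_sum_ne_zero h
    have a1 := (isKernel_unif h1 hl).supp w (left_ne_zero_of_mul hw)
    have a2 := hq.supp _ (right_ne_zero_of_mul hw)
    have a3 := ZMod.val_add_le w (z - w)
    rw [add_sub_cancel] at a3
    omega

lemma IsKernel.mono {q : ZMod n → ℝ} {M m : ℝ} {r r' : ℕ} (hq : IsKernel q M m r)
    (hr : r ≤ r') : IsKernel q M m r' :=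
  ⟨hq.nonneg, hq.le_sup, hq.sum_le, fun z h => (hq.supp z h).trans_le hr⟩

lemma isKernel_tri {l : ℕ} (h1 : 1 ≤ l) (hl : l ≤ n) :
    IsKernel (n := n) (tri l) (1 / l) 1 (2 * l) :=
  (isKernel_smooth h1 hl ((isKernel_unif h1 hl).mono (Nat.le_succ l))).mono (by omega)

lemma isKernel_triRamp {l : ℕ} (h1 : 1 ≤ l) (hl : l ≤ n) :
    IsKernel (n := n) (triRamp l) 2 (2 * l) (2 * l) := by
  have a := isKernel_ramp (n := n) h1 hl
  have b := isKernel_smooth h1 hl (a.mono (Nat.le_succ l))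
  refine ⟨fun z => add_nonneg (a.nonneg z) (b.nonneg z), fun z => ?_, ?_, fun z h => ?_⟩
  · have := a.le_sup z; have := b.le_sup z; unfold triRamp; linarith
  · unfold triRamp; rw [Finset.sum_add_distrib]
    have := a.sum_le; have := b.sum_le; linarith
  · unfold triRamp at h
    by_contra hz
    have e1 : ramp l z = 0 := by by_contra h'; exact hz ((a.supp z h').trans_le (by omega))
    have e2 : smooth l (ramp l) z = 0 := by
      by_contra h'; exact hz ((b.supp z h').trans_le (by omega))
    exact h (by rw [e1, e2, add_zero])

lemma single_sub_unif {l : ℕ} (h1 : 1 ≤ l) (hl : l < n) (z : ZMod n) :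
    (Pi.single 0 1 : ZMod n → ℝ) z - unif l z = ramp l z - ramp l (z - 1) := by
  have hlp : (l : ℝ) ≠ 0 := by positivity
  have : Fact (1 < n) := ⟨by omega⟩
  by_cases hz : z = 0
  · subst hz
    have hv : ((0 : ZMod n) - 1).val = n - 1 := by
      rw [zero_sub, ZMod.neg_val, ZMod.val_one]; simp
    simp only [unif, ramp, hv, ZMod.val_zero, Pi.single_eq_same]
    have : ¬ (n - 1 < l) := by omega
    simp [this, show 0 < l by omega]
  · have hpos : 1 ≤ z.val := by
      rcases Nat.eq_zero_or_pos z.val with h | h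
      · exact absurd ((ZMod.val_eq_zero z).1 h) hz
      · exact h
    have hv : (z - 1).val = z.val - 1 := by
      rw [ZMod.val_sub (by rw [ZMod.val_one]; exact hpos), ZMod.val_one]
    simp only [unif, ramp, hv, Pi.single_eq_of_ne hz, Nat.cast_sub hpos]
    by_cases a : z.val < l
    · simp only [a, show z.val - 1 < l by omega, if_true]; push_cast; field_simp; ring
    · by_cases b : z.val - 1 < l
      · have : (z.val : ℝ) = l := by exact_mod_cast (show z.val = l by omega)
        simp only [a, b, if_true, if_false, this]; push_cast; field_simp; ring
      · simp [a, b]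

lemma single_sub_tri {l : ℕ} (h1 : 1 ≤ l) (hl : l < n) (z : ZMod n) :
    (Pi.single 0 1 : ZMod n → ℝ) z - tri l z = triRamp l z - triRamp l (z - 1) := by
  have e1 := single_sub_unif h1 hl z
  have e2 : unif l z - tri l z = smooth l (ramp l) z - smooth l (ramp l) (z - 1) := by
    have : unif l z = ∑ w, unif l w * (Pi.single 0 1 : ZMod n → ℝ) (z - w) := by
      rw [Finset.sum_eq_single z]
      · simp
      · intro w _ hw; rw [Pi.single_eq_of_ne (sub_ne_zero.2 hw.symm), mul_zero]
      · simp
    rw [this]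
    unfold tri smooth
    rw [← Finset.sum_sub_distrib, ← Finset.sum_sub_distrib]
    refine Finset.sum_congr rfl fun w _ => ?_
    rw [← mul_sub, ← mul_sub, single_sub_unif h1 hl, show z - 1 - w = z - w - 1 by ring]
  unfold triRamp
  linarith

end Kernels

section ProductKernels

variable {d n : ℕ} [NeZero n]

/-- The product of one-dimensional kernels. -/
def prodKernel (q : Fin d → ZMod n → ℝ) (z : Torus d n) : ℝ := ∏ i, q i (z i)

lemma sum_prodKernel (q : Fin d → ZMod n → ℝ) :
    ∑ z, prodKernel q z = ∏ i, ∑ w, q i w := (Fintype.prod_sum _).symm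

lemma sum_prodKernel_sq_le {q : Fin d → ZMod n → ℝ} {M m : Fin d → ℝ} {r : Fin d → ℕ}
    (hq : ∀ i, IsKernel (q i) (M i) (m i) (r i)) :
    ∑ z, prodKernel q z ^ 2 ≤ ∏ i, (M i * m i) := by
  have : ∀ z, prodKernel q z ^ 2 = prodKernel (fun i w => q i w ^ 2) z := fun z =>
    (Finset.prod_pow _ _ _).symm
  simp only [this]
  rw [sum_prodKernel]
  refine Finset.prod_le_prod (fun i _ => Finset.sum_nonneg fun _ _ => sq_nonneg _) fun i _ => ?_
  have hM : 0 ≤ M i := ((hq i).nonneg 0).trans ((hq i).le_sup 0)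
  calc ∑ w, q i w ^ 2 ≤ ∑ w, M i * q i w := Finset.sum_le_sum fun w _ => by
        rw [sq]; exact mul_le_mul_of_nonneg_right ((hq i).le_sup w) ((hq i).nonneg w)
    _ = M i * ∑ w, q i w := by rw [Finset.mul_sum]
    _ ≤ M i * m i := mul_le_mul_of_nonneg_left (hq i).sum_le hM

/-- The box `∏ {0, …, r_i - 1}` in the torus. -/
def box (r : Fin d → ℕ) : Finset (Torus d n) :=
  Finset.univ.filter fun z => ∀ i, (z i).val < r i

lemma prodKernel_ne_zero {q : Fin d → ZMod n → ℝ} {M m : Fin d → ℝ} {r : Fin d → ℕ}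
    (hq : ∀ i, IsKernel (q i) (M i) (m i) (r i)) {z : Torus d n} (hz : prodKernel q z ≠ 0) :
    z ∈ box r := by
  refine Finset.mem_filter.2 ⟨Finset.mem_univ _, fun i => (hq i).supp _ ?_⟩
  exact Finset.prod_ne_zero_iff.1 hz i (Finset.mem_univ i)

lemma card_box_sub_box_le (r : Fin d → ℕ) :
    (box r - box r : Finset (Torus d n)).card ≤ ∏ i, (2 * r i) := by
  have hsub : (box r - box r : Finset (Torus d n)) ⊆
      (Fintype.piFinset fun i => Finset.Ico (-(r i : ℤ)) (r i)).image
        fun v i => ((v i : ℤ) : ZMod n) := by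
    intro z hz
    obtain ⟨a, ha, b, hb, rfl⟩ := Finset.mem_sub.1 hz
    have ha := (Finset.mem_filter.1 ha).2
    have hb := (Finset.mem_filter.1 hb).2
    refine Finset.mem_image.2 ⟨fun i => (a i).val - (b i).val, ?_, ?_⟩
    · refine Fintype.mem_piFinset.2 fun i => Finset.mem_Ico.2 ?_
      have := ha i; have := hb i
      omega
    · funext i; simp
  refine (Finset.card_le_card hsub).trans (Finset.card_image_le.trans ?_)
  rw [Fintype.card_piFinset]
  refine Finset.prod_le_prod (fun _ _ => Nat.zero_le _) fun i _ => ?_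
  rw [Int.card_Ico]; omega

/-- The kernel of the flow in direction `k`, once the directions before `k` have been averaged. -/
def flowKernel (l : Fin d → ℕ) (k : Fin d) : Torus d n → ℝ :=
  prodKernel fun j => if j < k then tri (l j) else if j = k then triRamp (l j) else Pi.single 0 1

lemma isKernel_flow {l : Fin d → ℕ} (h1 : ∀ i, 1 ≤ l i) (hl : ∀ i, l i ≤ n) (k j : Fin d) :
    IsKernel (n := n)
      (if j < k then tri (l j) else if j = k then triRamp (l j) else Pi.single 0 1)
      (if j < k then 1 / (l j : ℝ) else if j = k then 2 else 1)
      (if j < k then 1 else if j = k then 2 * (l j : ℝ) else 1) (2 * l j) := by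
  split_ifs
  · exact isKernel_tri (h1 j) (hl j)
  · exact isKernel_triRamp (h1 j) (hl j)
  · exact isKernel_single (by have := h1 j; omega)

lemma prod_single_eq_add {l : Fin d → ℕ} (h1 : ∀ i, 1 ≤ l i) (hl : ∀ i, l i < n)
    (z : Torus d n) :
    prodKernel (fun _ => Pi.single 0 1) z = prodKernel (fun i => tri (l i)) z +
      ∑ k, (flowKernel l k z - flowKernel l k (z - unitVec (ZMod n) k)) := by
  have h := Finset.prod_sub_ordered Finset.univ
    (fun i : Fin d => (Pi.single 0 1 : ZMod n → ℝ) (z i))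
    (fun i => (Pi.single 0 1 : ZMod n → ℝ) (z i) - tri (l i) (z i))
  simp only [sub_sub_cancel] at h
  have h2 : ∀ k : Fin d, flowKernel l k z - flowKernel l k (z - unitVec (ZMod n) k) =
      ((Pi.single 0 1 : ZMod n → ℝ) (z k) - tri (l k) (z k)) *
        (∏ j ∈ Finset.univ.filter (fun j => j < k), tri (l j) (z j)) *
        ∏ j ∈ Finset.univ.filter (fun j => k < j), (Pi.single 0 1 : ZMod n → ℝ) (z j) := by
    intro k
    have key : ∀ v : Torus d n, (∀ j, j ≠ k → v j = z j) → flowKernel l k v =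
        triRamp (l k) (v k) * ((∏ j ∈ Finset.univ.filter (fun j => j < k), tri (l j) (z j)) *
        ∏ j ∈ Finset.univ.filter (fun j => k < j), (Pi.single 0 1 : ZMod n → ℝ) (z j)) := by
      intro v hv
      unfold flowKernel prodKernel
      rw [← Finset.mul_prod_erase _ _ (Finset.mem_univ k)]
      congr 1
      · simp
      · rw [Finset.prod_filter, Finset.prod_filter, ← Finset.prod_mul_distrib,
          ← Finset.mul_prod_erase Finset.univ _ (Finset.mem_univ k)]
        simp only [lt_irrefl, if_false, one_mul]
        refine Finset.prod_congr rfl fun j hj => ?_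
        have hjk := Finset.ne_of_mem_erase hj
        rw [hv j hjk]
        rcases lt_or_gt_of_ne hjk with hlt | hlt
        · simp [hlt, hlt.not_gt]
        · simp [hlt, hlt.not_gt, hjk]
    rw [key z (fun _ _ => rfl), key (z - unitVec (ZMod n) k)
      (fun j hj => by simp [unitVec, hj]), ← sub_mul, single_sub_tri (h1 k) (hl k)]
    simp only [Pi.sub_apply, unitVec, Pi.single_eq_same]
    ring
  simp only [h2]
  unfold prodKernel
  rw [h]
  ring

lemma prodKernel_tri {l : Fin d → ℕ} (z : Torus d n) :
    prodKernel (fun i => tri (l i)) z =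
      ∑ w, prodKernel (fun i => unif (l i)) w * prodKernel (fun i => unif (l i)) (z - w) := by
  unfold prodKernel tri smooth
  rw [Fintype.prod_sum]
  refine Finset.sum_congr rfl fun w _ => ?_
  rw [← Finset.prod_mul_distrib]; rfl

/-- Summation by parts: the pairing of `u` and `v` is the pairing of their box averages, up to
gradients of `v` paired with flows of `u`. -/
lemma sum_mul_eq_flow {l : Fin d → ℕ} (h1 : ∀ i, 1 ≤ l i) (hl : ∀ i, l i < n)
    (u v : Torus d n → ℝ) :
    ∑ x, u x * v x =
      (∑ y, ∑ k, (∑ z, flowKernel l k z * u (y - z)) * (v y - v (y + unitVec (ZMod n) k))) +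
      ∑ y, (∑ z, prodKernel (fun i => unif (l i)) z * u (y - z)) *
        ∑ z, prodKernel (fun i => unif (l i)) z * v (y + z) := by
  have hδ : ∑ x, u x * v x =
      ∑ x, ∑ z, prodKernel (fun _ => Pi.single 0 1) z * (u x * v (x + z)) := by
    refine Finset.sum_congr rfl fun x _ => ?_
    rw [Finset.sum_eq_single 0]
    · simp [prodKernel]
    · intro z _ hz
      obtain ⟨i, hi⟩ := Function.ne_iff.1 hz
      have : prodKernel (fun _ => Pi.single 0 1) z = 0 :=
        Finset.prod_eq_zero (Finset.mem_univ i) (Pi.single_eq_of_ne hi _)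
      rw [this, zero_mul]
    · simp
  rw [hδ]
  simp only [prod_single_eq_add h1 hl, add_mul, Finset.sum_add_distrib, Finset.sum_mul]
  rw [add_comm]
  congr 1
  · -- the flow terms
    have : ∀ k : Fin d, ∑ x, ∑ z, (flowKernel l k z - flowKernel l k (z - unitVec (ZMod n) k)) *
        (u x * v (x + z)) = ∑ y, ∑ z, flowKernel l k z * u (y - z) *
          (v y - v (y + unitVec (ZMod n) k)) := by
      intro k
      have e1 : ∀ x, ∑ z, (flowKernel l k z - flowKernel l k (z - unitVec (ZMod n) k)) *
          (u x * v (x + z)) = ∑ z, flowKernel l k z *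
            (u x * (v (x + z) - v (x + z + unitVec (ZMod n) k))) := by
        intro x
        simp only [sub_mul, mul_sub, Finset.sum_sub_distrib]
        congr 1
        rw [← Equiv.sum_comp (Equiv.addRight (unitVec (ZMod n) k))]
        refine Finset.sum_congr rfl fun z _ => ?_
        simp [add_assoc]
      simp only [e1]
      rw [Finset.sum_comm, Finset.sum_comm (s := Finset.univ) (t := Finset.univ)
        (f := fun y z => flowKernel l k z * u (y - z) * (v y - v (y + unitVec (ZMod n) k)))]
      refine Finset.sum_congr rfl fun z _ => ?_
      rw [← Equiv.sum_comp (Equiv.addRight z)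
        (fun y => flowKernel l k z * u (y - z) * (v y - v (y + unitVec (ZMod n) k)))]
      refine Finset.sum_congr rfl fun x _ => ?_
      simp only [Equiv.coe_addRight, add_sub_cancel_right]
      ring
    calc _ = ∑ k : Fin d, ∑ x, ∑ z,
          (flowKernel l k z - flowKernel l k (z - unitVec (ZMod n) k)) * (u x * v (x + z)) := by
            rw [Finset.sum_comm]
            conv_rhs => rw [Finset.sum_comm]
            rw [Finset.sum_comm]
            refine Finset.sum_congr rfl fun x _ => ?_
            rw [Finset.sum_comm]
      _ = _ := by
            simp only [this]
            rw [Finset.sum_comm]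
  · simp only [prodKernel_tri, Finset.sum_mul, Finset.mul_sum]
    -- reindex by the midpoint `y = x + w`
    have e : ∀ x, ∑ z, ∑ w, prodKernel (fun i => unif (l i)) w *
        prodKernel (fun i => unif (l i)) (z - w) * (u x * v (x + z)) =
        ∑ w, ∑ z, prodKernel (fun i => unif (l i)) w *
        prodKernel (fun i => unif (l i)) z * (u x * v (x + w + z)) := by
      intro x
      rw [Finset.sum_comm]
      refine Finset.sum_congr rfl fun w _ => ?_
      rw [← Equiv.sum_comp (Equiv.addRight w)]
      refine Finset.sum_congr rfl fun z _ => ?_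
      simp only [Equiv.coe_addRight, add_sub_cancel_right]
      rw [show x + (z + w) = x + w + z by abel]
    simp only [e]
    rw [Finset.sum_comm]
    have e2 : ∀ w, ∑ x, ∑ z, prodKernel (fun i => unif (l i)) w *
        prodKernel (fun i => unif (l i)) z * (u x * v (x + w + z)) =
        ∑ y, ∑ z, prodKernel (fun i => unif (l i)) w * u (y - w) *
          (prodKernel (fun i => unif (l i)) z * v (y + z)) := by
      intro w
      rw [← Equiv.sum_comp (Equiv.addRight w) (fun y => ∑ z, prodKernel (fun i => unif (l i)) w *
        u (y - w) * (prodKernel (fun i => unif (l i)) z * v (y + z)))]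
      refine Finset.sum_congr rfl fun x _ => Finset.sum_congr rfl fun z _ => ?_
      simp only [Equiv.coe_addRight, add_sub_cancel_right]
      ring
    simp only [e2]
    rw [Finset.sum_comm]

end ProductKernels

open scoped Pointwise

/-! ### The static estimate for quadratic and higher order fields -/

section Static

variable {d n : ℕ} [NeZero n]

lemma ev_cen (ρ : ℝ) {V : Type} [Fintype V] [DecidableEq V] (x : V) :
    ev ρ (fun η => cen ρ (η x)) = 0 := by
  rw [ev_site ρ x (cen ρ)]; simp [cen, occ]; ring

lemma ev_prod_cen (ρ : ℝ) {V ι : Type} [Fintype V] [DecidableEq V] {B : Finset ι}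
    (hB : B.Nonempty) (g : ι → V) (hg : Function.Injective g) :
    ev ρ (fun η : V → Bool => ∏ b ∈ B, cen ρ (η (g b))) = 0 := by
  rw [ev_prod_of_disjoint ρ B (fun b => {g b}) (fun b η => cen ρ (η (g b)))]
  · obtain ⟨b, hb⟩ := hB
    exact Finset.prod_eq_zero hb (ev_cen ρ _)
  · intro b _ η η' h; simp only [h (g b) (by simp)]
  · intro b _ b' _ hbb'
    rw [Finset.disjoint_singleton]; exact fun h => hbb' (hg h)

lemma abs_prod_cen_le {ρ : ℝ} (h0 : 0 < ρ) (h1 : ρ < 1) {ι : Type*} (B : Finset ι)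
    (v : ι → Bool) : |∏ b ∈ B, cen ρ (v b)| ≤ 1 := by
  rw [Finset.abs_prod]
  exact Finset.prod_le_one (fun _ _ => abs_nonneg _) fun _ _ => abs_cen_le h0 h1 _

/-- The local function `g_x ∏_{b ∈ B} ω_{x+b}` in the centred variables `ω`. -/
def localProd (ρ : ℝ) (B : Finset (Torus d n)) (g : Torus d n → ℝ) (x : Torus d n)
    (η : TorusConfig d n) : ℝ := g x * ∏ b ∈ B, cen ρ (η (x + b))

lemma ev_sum_sq_linear_le {ρ : ℝ} (h0 : 0 < ρ) (h1 : ρ < 1) {B S : Finset (Torus d n)}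
    (hB : B.Nonempty) (hS : S.Nonempty) {g : Torus d n → ℝ} {M : ℝ} (hM : 0 < M)
    (hg : ∀ x, |g x| ≤ M) {κ : Torus d n → Torus d n → ℝ} {Φ : ℝ} (hΦ : 0 < Φ)
    (hκ : ∀ y, ∑ x, κ y x ^ 2 ≤ Φ)
    (hdep : ∀ y x, κ y x ≠ 0 → ∀ b ∈ B, x + b ∈ S.image (y + ·))
    {f : TorusConfig d n → ℝ} (hf : IsDensity ρ f) :
    ev ρ (fun η => f η * ∑ y, (∑ x, κ y x * localProd ρ B g x η) ^ 2) ≤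
      4 * (((B - B).card * M) ^ 2 * Φ) *
        ((S - S).card * ent ρ f + Fintype.card (Torus d n)) := by
  have hBB : 0 < (B - B).card := Finset.card_pos.2 (hB.sub hB)
  have hloc : ∀ x, DependsOn (localProd ρ B g x) (B.image (x + ·) : Set (Torus d n)) := by
    intro x η η' h
    unfold localProd
    congr 1
    refine Finset.prod_congr rfl fun b hb => ?_
    rw [h (x + b) (Finset.mem_coe.2 (Finset.mem_image_of_mem _ hb))]
  refine ev_sum_sq_le h0 h1 hS (by positivity) (fun y => ?_) (fun y t => ?_) hf
  · refine DependsOn.finset_sum fun x _ => ?_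
    by_cases hk : κ y x = 0
    · intro η η' _; simp [hk]
    · intro η η' h
      have : localProd ρ B g x η = localProd ρ B g x η' := hloc x fun z hz => h z (by
        obtain ⟨b, hb, rfl⟩ := Finset.mem_image.1 (Finset.mem_coe.1 hz)
        exact hdep y x hk b hb)
      simp only [this]
  · have := ev_exp_linear_le h0 h1 hB hM hloc (fun x η => by
        unfold localProd
        rw [abs_mul]
        calc |g x| * |∏ b ∈ B, cen ρ (η (x + b))| ≤ M * 1 :=
              mul_le_mul (hg x) (abs_prod_cen_le h0 h1 B _) (abs_nonneg _) hM.le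
          _ = M := mul_one M)
      (fun x => by
        unfold localProd
        rw [ev_const_mul, ev_prod_cen ρ hB _ (add_right_injective x), mul_zero])
      (fun x => t * κ y x)
    have e : ∀ η, t * ∑ x, κ y x * localProd ρ B g x η =
        ∑ x, t * κ y x * localProd ρ B g x η := fun η => by
      rw [Finset.mul_sum]; exact Finset.sum_congr rfl fun _ _ => by ring
    simp only [e]
    refine this.trans (Real.exp_le_exp.2 ?_)
    simp only [mul_pow, ← Finset.mul_sum]
    have := hκ y
    calc _ = ((B - B).card * M) ^ 2 * t ^ 2 / 2 * ∑ x, κ y x ^ 2 := by ring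
      _ ≤ ((B - B).card * M) ^ 2 * t ^ 2 / 2 * Φ := by gcongr
      _ = _ := by ring

/-- The contribution of one product kernel, applied to a local function. -/
lemma ev_sum_sq_prodKernel_le {ρ : ℝ} (h0 : 0 < ρ) (h1 : ρ < 1) {B : Finset (Torus d n)}
    (hB : B.Nonempty) {g : Torus d n → ℝ} {M : ℝ} (hM : 0 < M) (hg : ∀ x, |g x| ≤ M)
    {q : Fin d → ZMod n → ℝ} {Ms ms : Fin d → ℝ} {l : Fin d → ℕ} (hl : ∀ i, 1 ≤ l i)
    (hq : ∀ i, IsKernel (q i) (Ms i) (ms i) (2 * l i)) {Φ : ℝ} (hΦ : 0 < Φ)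
    (hΦ' : ∏ i, (Ms i * ms i) ≤ Φ) {f : TorusConfig d n → ℝ} (hf : IsDensity ρ f) :
    ev ρ (fun η => f η * ∑ y, (∑ z, prodKernel q z * localProd ρ B g (y - z) η) ^ 2) ≤
      4 * ((B.card ^ 2 * M) ^ 2 * Φ) *
        (B.card ^ 2 * (∏ i, (4 * l i : ℝ)) * ent ρ f + Fintype.card (Torus d n)) := by
  have hbox : (box (fun i => 2 * l i) : Finset (Torus d n)).Nonempty :=
    ⟨0, Finset.mem_filter.2 ⟨Finset.mem_univ _, fun i => by
      have := hl i
      simp only [Pi.zero_apply, ZMod.val_zero]; omega⟩⟩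
  have h := ev_sum_sq_linear_le h0 h1 hB (hB.sub hbox) hM hg
    (κ := fun y x => prodKernel q (y - x)) hΦ
    (fun y => by
      have := Equiv.sum_comp (Equiv.subLeft y) (fun z => prodKernel q z ^ 2)
      simp only [Equiv.subLeft_apply] at this
      rw [this]
      exact (sum_prodKernel_sq_le hq).trans hΦ')
    (fun y x hk b hb => Finset.mem_image.2 ⟨b - (y - x), Finset.mem_sub.2
      ⟨b, hb, _, prodKernel_ne_zero hq hk, rfl⟩, by abel⟩) hf
  have e : ∀ y η, ∑ z, prodKernel q z * localProd ρ B g (y - z) η =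
      ∑ x, prodKernel q (y - x) * localProd ρ B g x η := by
    intro y η
    rw [← Equiv.sum_comp (Equiv.subLeft y)]
    simp
  simp only [e]
  refine h.trans ?_
  have hc1 : ((B - B).card : ℝ) ≤ (B.card : ℝ) ^ 2 := by
    rw [sq]; exact_mod_cast Finset.card_sub_le
  have hc2 : (((B - box fun i => 2 * l i) - (B - box fun i => 2 * l i)).card : ℝ) ≤
      (B.card : ℝ) ^ 2 * ∏ i, (4 * l i : ℝ) := by
    rw [sub_sub_sub_comm]
    have a1 : ((B - B) - ((box fun i => 2 * l i) - box fun i => 2 * l i)).card ≤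
        (B.card * B.card) * ∏ i, (2 * (2 * l i)) :=
      Finset.card_sub_le.trans (Nat.mul_le_mul Finset.card_sub_le (card_box_sub_box_le _))
    have a2 : ((B.card * B.card * ∏ i, (2 * (2 * l i)) : ℕ) : ℝ) =
        (B.card : ℝ) ^ 2 * ∏ i, (4 * l i : ℝ) := by
      push_cast
      rw [sq]; congr 1
      exact Finset.prod_congr rfl fun i _ => by ring
    rw [← a2]; exact_mod_cast a1
  have := ent_nonneg h0 h1 hf.nonneg
  gcongr

/-- The block average of the centred occupation variables. -/
lemma ev_sum_sq_average_le {ρ : ℝ} (h0 : 0 < ρ) (h1 : ρ < 1) {l : Fin d → ℕ}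
    (hl : ∀ i, 1 ≤ l i) (hln : ∀ i, l i ≤ n) {f : TorusConfig d n → ℝ} (hf : IsDensity ρ f) :
    ev ρ (fun η => f η * ∑ y,
      (∑ z, prodKernel (fun i => unif (l i)) z * cen ρ (η (y + z))) ^ 2) ≤
      4 * (∏ i, (1 / l i : ℝ)) *
        ((∏ i, (4 * l i : ℝ)) * ent ρ f + Fintype.card (Torus d n)) := by
  have hq : ∀ i, IsKernel (n := n) (unif (l i)) (1 / l i) 1 (l i) := fun i =>
    isKernel_unif (hl i) (hln i)
  have hbox : (box l : Finset (Torus d n)).Nonempty :=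
    ⟨0, Finset.mem_filter.2 ⟨Finset.mem_univ _, fun i => by
      have := hl i
      simp only [Pi.zero_apply, ZMod.val_zero]; omega⟩⟩
  have hpos : (0 : ℝ) < ∏ i, (1 / l i : ℝ) := Finset.prod_pos fun i _ => by
    have : (0 : ℝ) < l i := by exact_mod_cast hl i
    positivity
  have h := ev_sum_sq_linear_le h0 h1 (B := {(0 : Torus d n)}) (by simp) hbox one_pos
    (g := fun _ => 1) (by simp)
    (κ := fun y x => prodKernel (fun i => unif (l i)) (x - y)) hpos
    (fun y => by
      have := Equiv.sum_comp (Equiv.subRight y)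
        (fun z => prodKernel (fun i => unif (l i)) z ^ 2)
      simp only [Equiv.subRight_apply] at this
      rw [this]
      exact (sum_prodKernel_sq_le hq).trans (le_of_eq (by simp)))
    (fun y x hk b hb => Finset.mem_image.2 ⟨x - y, prodKernel_ne_zero hq hk, by
      rw [Finset.mem_singleton.1 hb]; abel⟩) hf
  have e : ∀ y (η : TorusConfig d n),
      ∑ z, prodKernel (fun i => unif (l i)) z * cen ρ (η (y + z)) =
      ∑ x, prodKernel (fun i => unif (l i)) (x - y) *
        localProd ρ {(0 : Torus d n)} (fun _ => 1) x η := by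
    intro y η
    rw [← Equiv.sum_comp (Equiv.subRight y)]
    simp [localProd]
  simp only [e]
  refine h.trans ?_
  have hc : ((box l - box l : Finset (Torus d n)).card : ℝ) ≤ ∏ i, (4 * l i : ℝ) := by
    have a1 := card_box_sub_box_le (n := n) l
    calc ((box l - box l : Finset (Torus d n)).card : ℝ) ≤ ((∏ i, (2 * l i) : ℕ) : ℝ) := by
          exact_mod_cast a1
      _ = ∏ i, (2 * l i : ℝ) := by push_cast; rfl
      _ ≤ _ := Finset.prod_le_prod (fun _ _ => by positivity) fun i _ => by
          have : (0 : ℝ) ≤ l i := by positivity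
          linarith
  have := ent_nonneg h0 h1 hf.nonneg
  have hone : (({(0 : Torus d n)} : Finset (Torus d n)) - {0}).card = 1 := by simp
  rw [hone]
  simp only [Nat.cast_one, one_mul, one_pow]
  gcongr

/-- The static estimate: a field `∑_x g_x ω_x ∏_{b ∈ B} ω_{x+b}`, none of the sites of `B` lying
in the box of sides `2 l_i`, is bounded by a small multiple of the Dirichlet form and a
nonnegative function whose expectation is controlled by the entropy. -/
lemma exists_static_bound {ρ : ℝ} (h0 : 0 < ρ) (h1 : ρ < 1) {B : Finset (Torus d n)}
    (hB : B.Nonempty) {l : Fin d → ℕ} (hl : ∀ i, 1 ≤ l i) (hln : ∀ i, l i < n)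
    (havoid : ∀ b ∈ B, ∃ i, 2 * l i < (b i).val) {g : Torus d n → ℝ} {M : ℝ} (hM : 0 < M)
    (hg : ∀ x, |g x| ≤ M) {δ θ Φ : ℝ} (hδ : 0 < δ) (hθ : 0 < θ) (hΦ0 : 0 < Φ)
    (hΦ : ∀ k : Fin d, ∏ j, (if j < k then 1 / (l j : ℝ) else if j = k then 4 * (l j : ℝ) else 1)
      ≤ Φ) :
    ∃ R : TorusConfig d n → ℝ, (∀ η, 0 ≤ R η) ∧
      (∀ u : TorusConfig d n → ℝ,
        ev ρ (fun η => (∑ x, g x * (cen ρ (η x) * ∏ b ∈ B, cen ρ (η (x + b)))) * u η ^ 2) ≤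
          δ / 2 * dirichlet ρ u + ev ρ (fun η => R η * u η ^ 2)) ∧
      ∀ f, IsDensity ρ f → ev ρ (fun η => f η * R η) ≤
        (1 / (2 * δ) * (d * (4 * ((B.card ^ 2 * M) ^ 2 * Φ))) +
          (1 / (2 * θ) * (4 * ((B.card ^ 2 * M) ^ 2 * ∏ i, (1 / l i : ℝ))) +
            θ / 2 * (4 * ∏ i, (1 / l i : ℝ)))) *
        (B.card ^ 2 * (∏ i, (4 * l i : ℝ)) * ent ρ f + Fintype.card (Torus d n)) := by
  have hln' : ∀ i, l i ≤ n := fun i => (hln i).le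
  obtain ⟨h, hh⟩ : ∃ h : Torus d n → Fin d → TorusConfig d n → ℝ, ∀ y k η, h y k η =
      ∑ z, flowKernel l k z * localProd ρ B g (y - z) η := ⟨_, fun _ _ _ => rfl⟩
  obtain ⟨ub, hub⟩ : ∃ ub : Torus d n → TorusConfig d n → ℝ, ∀ y η, ub y η =
      ∑ z, prodKernel (fun i => unif (l i)) z * localProd ρ B g (y - z) η :=
    ⟨_, fun _ _ => rfl⟩
  obtain ⟨ob, hob⟩ : ∃ ob : Torus d n → TorusConfig d n → ℝ, ∀ y η, ob y η =
      ∑ z, prodKernel (fun i => unif (l i)) z * cen ρ (η (y + z)) := ⟨_, fun _ _ => rfl⟩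
  have hdecomp : ∀ η, ∑ x, g x * (cen ρ (η x) * ∏ b ∈ B, cen ρ (η (x + b))) =
      (∑ y, ∑ k, h y k η * (cen ρ (η y) - cen ρ (η (y + unitVec (ZMod n) k)))) +
        ∑ y, ub y η * ob y η := by
    intro η
    simp only [hh, hub, hob]
    rw [← sum_mul_eq_flow hl hln (fun x => localProd ρ B g x η) (fun x => cen ρ (η x))]
    exact Finset.sum_congr rfl fun x _ => by unfold localProd; ring
  -- the flow through a bond does not depend on the values at its two end points
  have hinv : ∀ y k η, h y k (exchange y (y + unitVec (ZMod n) k) η) = h y k η := by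
    intro y k η
    simp only [hh]
    refine Finset.sum_congr rfl fun z _ => ?_
    by_cases hz : flowKernel l k z = 0
    · simp [hz]
    · have hzb := (Finset.mem_filter.1
        (prodKernel_ne_zero (fun j => isKernel_flow hl hln' k j) hz)).2
      congr 1
      unfold localProd
      congr 1
      refine Finset.prod_congr rfl fun b hb => ?_
      obtain ⟨i, hi⟩ := havoid b hb
      have hzi : (z i).val < 2 * l i := hzb i
      have n1 : y - z + b ≠ y := by
        intro e
        have : b = z := by rw [sub_add_eq_add_sub, sub_eq_iff_eq_add] at e; exact add_left_cancel e
        rw [this] at hi; omega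
      have n2 : y - z + b ≠ y + unitVec (ZMod n) k := by
        intro e
        have e' : b = z + unitVec (ZMod n) k := by
          rw [sub_add_eq_add_sub, sub_eq_iff_eq_add, add_assoc] at e
          rw [add_left_cancel e, add_comm]
        have e2 : (b i).val ≤ (z i).val + 1 := by
          rw [e', Pi.add_apply]
          refine (ZMod.val_add_le _ _).trans (Nat.add_le_add_left ?_ _)
          unfold unitVec
          rw [Pi.single_apply]
          split_ifs
          · rw [ZMod.val_one_eq_one_mod]; exact Nat.mod_le _ _
          · simp
        omega
      unfold exchange
      rw [Equiv.swap_apply_of_ne_of_ne n1 n2]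
  refine ⟨fun η => 1 / (2 * δ) * ∑ k, ∑ y, h y k η ^ 2 +
    (1 / (2 * θ) * ∑ y, ub y η ^ 2 + θ / 2 * ∑ y, ob y η ^ 2), fun η => ?_, fun u => ?_,
    fun f hf => ?_⟩
  · have a1 : 0 ≤ ∑ k, ∑ y, h y k η ^ 2 :=
      Finset.sum_nonneg fun _ _ => Finset.sum_nonneg fun _ _ => sq_nonneg _
    have a2 : 0 ≤ ∑ y, ub y η ^ 2 := Finset.sum_nonneg fun _ _ => sq_nonneg _
    have a3 : 0 ≤ ∑ y, ob y η ^ 2 := Finset.sum_nonneg fun _ _ => sq_nonneg _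
    positivity
  · have c1 : ∀ η, (∑ x, g x * (cen ρ (η x) * ∏ b ∈ B, cen ρ (η (x + b)))) * u η ^ 2 =
        (∑ y, ∑ k, h y k η * (cen ρ (η y) - cen ρ (η (y + unitVec (ZMod n) k))) * u η ^ 2) +
          (∑ y, ub y η * ob y η) * u η ^ 2 := by
      intro η; rw [hdecomp, add_mul]; simp only [Finset.sum_mul]
    have c2 : ∀ η, (1 / (2 * δ) * ∑ k, ∑ y, h y k η ^ 2 +
        (1 / (2 * θ) * ∑ y, ub y η ^ 2 + θ / 2 * ∑ y, ob y η ^ 2)) * u η ^ 2 =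
        (∑ y, ∑ k, 1 / (2 * δ) * (h y k η ^ 2 * u η ^ 2)) +
          (1 / (2 * θ) * ∑ y, ub y η ^ 2 + θ / 2 * ∑ y, ob y η ^ 2) * u η ^ 2 := by
      intro η; rw [add_mul, Finset.sum_comm]; congr 1
      simp only [Finset.mul_sum, Finset.sum_mul]
      exact Finset.sum_congr rfl fun _ _ => Finset.sum_congr rfl fun _ _ => by ring
    simp only [c1, c2]
    rw [ev_add, ev_add, ← add_assoc]
    refine add_le_add ?_ (ev_mono h0 h1 fun η => ?_)
    · simp only [ev_sum, ev_const_mul]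
      unfold dirichlet
      simp only [Finset.mul_sum]
      rw [← Finset.sum_add_distrib]
      refine Finset.sum_le_sum fun y _ => ?_
      rw [← Finset.sum_add_distrib]
      exact Finset.sum_le_sum fun k _ => ev_mul_cen_sub_le h0 h1 (hinv y k) hδ u
    · refine mul_le_mul_of_nonneg_right ?_ (sq_nonneg _)
      rw [Finset.mul_sum, Finset.mul_sum, ← Finset.sum_add_distrib]
      refine Finset.sum_le_sum fun y _ => ?_
      have : 0 ≤ 1 / (2 * θ) * (ub y η - θ * ob y η) ^ 2 := by positivity
      have e : 1 / (2 * θ) * (ub y η - θ * ob y η) ^ 2 =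
          1 / (2 * θ) * ub y η ^ 2 + θ / 2 * ob y η ^ 2 - ub y η * ob y η := by
        field_simp; ring
      linarith
  · set X := (B.card ^ 2 * (∏ i, (4 * l i : ℝ)) * ent ρ f + Fintype.card (Torus d n)) with hX
    have hent := ent_nonneg h0 h1 hf.nonneg
    have b1 : ∀ k, ev ρ (fun η => f η * ∑ y, h y k η ^ 2) ≤
        4 * ((B.card ^ 2 * M) ^ 2 * Φ) * X := by
      intro k
      simp only [hh]
      refine ev_sum_sq_prodKernel_le h0 h1 hB hM hg hl (fun j => isKernel_flow hl hln' k j) hΦ0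
        (le_trans (le_of_eq ?_) (hΦ k)) hf
      refine Finset.prod_congr rfl fun j _ => ?_
      split_ifs <;> ring
    have b2 : ev ρ (fun η => f η * ∑ y, ub y η ^ 2) ≤
        4 * ((B.card ^ 2 * M) ^ 2 * ∏ i, (1 / l i : ℝ)) * X := by
      simp only [hub]
      refine ev_sum_sq_prodKernel_le h0 h1 hB hM hg hl
        (fun j => (isKernel_unif (hl j) (hln' j)).mono (by omega))
        (Finset.prod_pos fun i _ => ?_) (le_of_eq ?_) hf
      · have : (0 : ℝ) < l i := by exact_mod_cast hl i
        positivity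
      · simp
    have b3 : ev ρ (fun η => f η * ∑ y, ob y η ^ 2) ≤ 4 * (∏ i, (1 / l i : ℝ)) * X := by
      simp only [hob]
      refine (ev_sum_sq_average_le h0 h1 hl hln' hf).trans ?_
      have hb1 : (1 : ℝ) ≤ (B.card : ℝ) ^ 2 := by
        have : (1 : ℝ) ≤ B.card := by exact_mod_cast hB.card_pos
        nlinarith
      have hp : (0 : ℝ) ≤ ∏ i, (4 * l i : ℝ) := Finset.prod_nonneg fun _ _ => by positivity
      have hp' : (0 : ℝ) ≤ ∏ i, (1 / l i : ℝ) := Finset.prod_nonneg fun _ _ => by positivity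
      rw [hX]
      refine mul_le_mul_of_nonneg_left (add_le_add_left ?_ _) (by positivity)
      refine mul_le_mul_of_nonneg_right ?_ hent
      nlinarith
    have e : ∀ η, f η * (1 / (2 * δ) * ∑ k, ∑ y, h y k η ^ 2 +
        (1 / (2 * θ) * ∑ y, ub y η ^ 2 + θ / 2 * ∑ y, ob y η ^ 2)) =
        1 / (2 * δ) * (∑ k, f η * ∑ y, h y k η ^ 2) +
          (1 / (2 * θ) * (f η * ∑ y, ub y η ^ 2) + θ / 2 * (f η * ∑ y, ob y η ^ 2)) := by
      intro η; rw [← Finset.mul_sum]; ring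
    simp only [e]
    rw [ev_add, ev_add, ev_const_mul, ev_const_mul, ev_const_mul, ev_sum]
    have b1' := Finset.sum_le_sum fun k (_ : k ∈ Finset.univ) => b1 k
    rw [Finset.sum_const, Finset.card_univ, Fintype.card_fin, nsmul_eq_mul] at b1'
    have t1 := mul_le_mul_of_nonneg_left b1' (show 0 ≤ 1 / (2 * δ) by positivity)
    have t2 := mul_le_mul_of_nonneg_left b2 (show 0 ≤ 1 / (2 * θ) by positivity)
    have t3 := mul_le_mul_of_nonneg_left b3 (show 0 ≤ θ / 2 by positivity)
    refine (add_le_add t1 (add_le_add t2 t3)).trans (le_of_eq ?_)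
    ring

end Static

/-! ### Admissible local functions -/

section Admissible

/-- The sides of the averaging box: `L` in the first direction and `L ^ 2` in the others.
Averaging over a short side before the long ones keeps the squared flows of order `L`, while the
box has `L ^ (2 d - 1)` sites. -/
def sides (d L : ℕ) (i : Fin d) : ℕ := if i.val = 0 then L else L ^ 2

/-- The relations between the size `n` of the torus, the acceleration `a` and the block size `L`;
the box leaves a room of `b` sites. -/
structure Scale (d n : ℕ) (a : ℝ) (L b : ℕ) : Prop where
  one_le : 1 ≤ a
  one_le_L : 1 ≤ L
  le_sq : a * (L : ℝ) ^ (2 * d) ≤ (n : ℝ) ^ 2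
  sq_le : (n : ℝ) ^ 2 ≤ 4 ^ d * (a * (L : ℝ) ^ (2 * d))
  room : ∀ i : Fin d, 2 * sides d L i + b < n

/-- The error term in the entropy estimates. -/
def errorTerm (d n : ℕ) (a : ℝ) (L : ℕ) : ℝ := a * L * (n : ℝ) ^ d / (n : ℝ) ^ 2

/-- A local function `g` is admissible if every field `∑_x G_x g(τ_x η)` with `|G| ≤ K a` is
bounded, as a quadratic form, by a small multiple of the accelerated Dirichlet form and a
nonnegative function `R` whose expectation is at most `C a` times entropy plus error term. -/
def Admissible {d : ℕ} (ρ : ℝ) (g : Config d → ℝ) : Prop :=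
  ∀ K : ℝ, 0 < K → ∀ δ : ℝ, 0 < δ → ∃ C : ℝ, 0 < C ∧ ∃ b : ℕ,
    ∀ (n : ℕ) [NeZero n] (a : ℝ) (L : ℕ), Scale d n a L b →
    ∀ G : Torus d n → ℝ, (∀ x, |G x| ≤ K * a) →
    ∃ R : TorusConfig d n → ℝ, (∀ η, 0 ≤ R η) ∧
      (∀ u : TorusConfig d n → ℝ,
        ev ρ (fun η => (∑ x, G x * g (torusTranslate x η)) * u η ^ 2) ≤
          δ * (n : ℝ) ^ 2 * dirichlet ρ u + ev ρ (fun η => R η * u η ^ 2)) ∧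
      ∀ f, IsDensity ρ f → ev ρ (fun η => f η * R η) ≤ C * a * (ent ρ f + errorTerm d n a L)

variable {d : ℕ}

lemma Scale.mono {n : ℕ} {a : ℝ} {L b b' : ℕ} (h : Scale d n a L b') (hb : b ≤ b') :
    Scale d n a L b :=
  ⟨h.one_le, h.one_le_L, h.le_sq, h.sq_le, fun i => by have := h.room i; omega⟩

lemma errorTerm_nonneg {n : ℕ} {a : ℝ} {L : ℕ} (ha : 0 ≤ a) : 0 ≤ errorTerm d n a L := by
  unfold errorTerm; positivity

lemma Admissible.zero {ρ : ℝ} (h0 : 0 < ρ) (h1 : ρ < 1) :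
    Admissible ρ (fun _ : Config d => 0) := by
  intro K _ δ hδ
  refine ⟨1, one_pos, 0, fun n _ a L hs G _ => ⟨fun _ => 0, fun _ => le_rfl, fun u => ?_,
    fun f hf => ?_⟩⟩
  · have : 0 ≤ dirichlet ρ u := Finset.sum_nonneg fun _ _ => Finset.sum_nonneg fun _ _ =>
      ev_nonneg h0 h1 fun _ => sq_nonneg _
    simp only [mul_zero, Finset.sum_const_zero, zero_mul, ev_const]
    positivity
  · have := ent_nonneg h0 h1 hf.nonneg
    have h3 := errorTerm_nonneg (d := d) (n := n) (L := L) (zero_le_one.trans hs.one_le)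
    have := hs.one_le
    simp only [mul_zero, ev_const]
    positivity

lemma Admissible.add {ρ : ℝ} {g g' : Config d → ℝ} (hg : Admissible ρ g)
    (hg' : Admissible ρ g') : Admissible ρ (fun η => g η + g' η) := by
  intro K hK δ hδ
  obtain ⟨C, hC, b, h⟩ := hg K hK (δ / 2) (by positivity)
  obtain ⟨C', hC', b', h'⟩ := hg' K hK (δ / 2) (by positivity)
  refine ⟨C + C', by positivity, max b b', fun n _ a L hs G hG => ?_⟩
  obtain ⟨R, r1, r2, r3⟩ := h n a L (hs.mono (le_max_left _ _)) G hG
  obtain ⟨R', r1', r2', r3'⟩ := h' n a L (hs.mono (le_max_right _ _)) G hG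
  refine ⟨fun η => R η + R' η, fun η => add_nonneg (r1 η) (r1' η), fun u => ?_, fun f hf => ?_⟩
  · have e := r2 u
    have e' := r2' u
    simp only [mul_add, Finset.sum_add_distrib, add_mul]
    rw [ev_add, ev_add]
    linarith
  · have e := r3 f hf
    have e' := r3' f hf
    simp only [mul_add] at e e' ⊢
    rw [ev_add]
    linarith

lemma Admissible.const_mul {ρ : ℝ} {g : Config d → ℝ} (hg : Admissible ρ g) (c : ℝ) :
    Admissible ρ (fun η => c * g η) := by
  intro K hK δ hδ
  obtain ⟨C, hC, b, h⟩ := hg ((|c| + 1) * K) (by positivity) δ hδ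
  refine ⟨C, hC, b, fun n _ a L hs G hG => ?_⟩
  obtain ⟨R, r1, r2, r3⟩ := h n a L hs (fun x => c * G x) fun x => by
    rw [abs_mul, mul_assoc]
    have := hG x
    have := abs_nonneg (G x)
    have := abs_nonneg c
    nlinarith
  refine ⟨R, r1, fun u => ?_, r3⟩
  refine le_trans (le_of_eq ?_) (r2 u)
  congr 1; funext η; congr 1
  exact Finset.sum_congr rfl fun x _ => by ring

lemma Admissible.neg {ρ : ℝ} {g : Config d → ℝ} (hg : Admissible ρ g) :
    Admissible ρ (fun η => -g η) := by
  simpa using hg.const_mul (-1)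

lemma Admissible.sum {ρ : ℝ} (h0 : 0 < ρ) (h1 : ρ < 1) {ι : Type*} (s : Finset ι)
    {g : ι → Config d → ℝ} (hg : ∀ i ∈ s, Admissible ρ (g i)) :
    Admissible ρ (fun η => ∑ i ∈ s, g i η) := by
  classical
  induction s using Finset.induction_on with
  | empty => simpa using Admissible.zero h0 h1
  | insert i s hi ih =>
    simp only [Finset.sum_insert hi]
    exact (hg i (Finset.mem_insert_self _ _)).add
      (ih fun j hj => hg j (Finset.mem_insert_of_mem hj))

lemma one_le_sides {L : ℕ} (hL : 1 ≤ L) (i : Fin d) : 1 ≤ sides d L i := by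
  unfold sides; split_ifs
  · exact hL
  · exact Nat.one_le_pow _ _ hL

/-- The products of the suprema and the masses of the one-dimensional factors of the flow kernels
are at most of order `L`. -/
lemma flow_sup_mass_le (hd3 : d ≤ 3) {L : ℕ} (hL : 1 ≤ L) (k : Fin d) :
    ∏ j, (if j < k then 1 / (sides d L j : ℝ) else if j = k then 4 * (sides d L j : ℝ) else 1)
      ≤ 4 * (L : ℝ) := by
  have hL' : (1 : ℝ) ≤ L := by exact_mod_cast hL
  have hd : d = 0 ∨ d = 1 ∨ d = 2 ∨ d = 3 := by omega
  rcases hd with rfl | rfl | rfl | rfl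
  · exact k.elim0
  · fin_cases k; simp [sides]
  · fin_cases k
    · simp [sides]
    · simp [Fin.prod_univ_succ, sides]
      field_simp; exact le_rfl
  · fin_cases k
    · simp [sides]
    · simp [Fin.prod_univ_succ, sides]
      field_simp; exact le_rfl
    · simp [Fin.prod_univ_succ, sides, Fin.lt_def]
      field_simp; nlinarith

lemma mul_prod_sides (hd1 : 1 ≤ d) (hd3 : d ≤ 3) (L : ℕ) :
    (L : ℝ) * ∏ i, (sides d L i : ℝ) = (L : ℝ) ^ (2 * d) := by
  have hd : d = 1 ∨ d = 2 ∨ d = 3 := by omega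
  rcases hd with rfl | rfl | rfl <;> simp [Fin.prod_univ_succ, sides] <;> ring

lemma prod_four_sides (L : ℕ) :
    ∏ i : Fin d, (4 * sides d L i : ℝ) = 4 ^ d * ∏ i, (sides d L i : ℝ) := by
  rw [Finset.prod_mul_distrib]; simp

/-- The static estimate with the box `sides d L`. -/
lemma exists_scaled_bound (hd1 : 1 ≤ d) (hd3 : d ≤ 3) {ρ : ℝ} (h0 : 0 < ρ) (h1 : ρ < 1)
    {m : ℕ} (hm : 0 < m) {K : ℝ} (hK : 0 < K) {δ : ℝ} (hδ : 0 < δ) :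
    ∃ C : ℝ, 0 < C ∧ ∀ (n : ℕ) [NeZero n] (a : ℝ) (L : ℕ), Scale d n a L 0 →
    ∀ B : Finset (Torus d n), B.card = m → (∀ b ∈ B, ∃ i, 2 * sides d L i < (b i).val) →
    ∀ G : Torus d n → ℝ, (∀ x, |G x| ≤ K * a) →
    ∃ R : TorusConfig d n → ℝ, (∀ η, 0 ≤ R η) ∧
      (∀ u : TorusConfig d n → ℝ,
        ev ρ (fun η => (∑ x, G x * (cen ρ (η x) * ∏ b ∈ B, cen ρ (η (x + b)))) * u η ^ 2) ≤
          δ * (n : ℝ) ^ 2 * dirichlet ρ u + ev ρ (fun η => R η * u η ^ 2)) ∧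
      ∀ f, IsDensity ρ f → ev ρ (fun η => f η * R η) ≤ C * a * (ent ρ f + errorTerm d n a L) := by
  set A : ℝ := 4 * d * ((m : ℝ) ^ 2 * K) ^ 2 / δ + 2 * ((m : ℝ) ^ 2 * K) ^ 2 + 2 with hA
  have hApos : 0 < A := by positivity
  refine ⟨A * (2 * (m : ℝ) ^ 2 * 4 ^ d + (1 + 4 ^ d)), by positivity, ?_⟩
  intro n _ a L hs B hBm havoid G hG
  have ha := hs.one_le
  have ha0 : 0 < a := zero_lt_one.trans_le ha
  have hn : (0 : ℝ) < n := by exact_mod_cast Nat.pos_of_ne_zero (NeZero.ne n)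
  have hL : (0 : ℝ) < L := by exact_mod_cast hs.one_le_L
  have hB : B.Nonempty := Finset.card_pos.1 (hBm ▸ hm)
  obtain ⟨R, r1, r2, r3⟩ := exists_static_bound h0 h1 hB (l := sides d L)
    (fun i => one_le_sides hs.one_le_L i)
    (fun i => by have := hs.room i; omega) havoid (M := K * a) (by positivity) hG
    (δ := 2 * δ * (n : ℝ) ^ 2) (θ := a) (Φ := 4 * L) (by positivity) ha0 (by positivity)
    (flow_sup_mass_le hd3 hs.one_le_L)
  refine ⟨R, r1, fun u => (r2 u).trans (le_of_eq (by ring)), fun f hf => (r3 f hf).trans ?_⟩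
  rw [hBm, prod_four_sides]
  have hvol := mul_prod_sides hd1 hd3 L
  have hprod : ∏ i : Fin d, (1 / (sides d L i : ℝ)) = 1 / ∏ i, (sides d L i : ℝ) := by
    rw [Finset.prod_div_distrib]; simp
  rw [hprod]
  have hvpos : 0 < ∏ i, (sides d L i : ℝ) := Finset.prod_pos fun i _ => by
    exact_mod_cast one_le_sides hs.one_le_L i
  have hcard : (Fintype.card (Torus d n) : ℝ) = (n : ℝ) ^ d := by
    simp [ZMod.card]
  rw [hcard]
  set v := ∏ i, (sides d L i : ℝ) with hv
  have hent := ent_nonneg h0 h1 hf.nonneg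
  set H := ent ρ f with hH
  have s1 := hs.le_sq
  have s2 := hs.sq_le
  rw [← hvol] at s1 s2
  -- the two prefactors: `a² L / n²` for the flows and `a / v` for the averages
  have c1 : (1 / (2 * (2 * δ * (n : ℝ) ^ 2)) * (d * (4 * (((m : ℝ) ^ 2 * (K * a)) ^ 2 * (4 * L)))) +
      (1 / (2 * a) * (4 * (((m : ℝ) ^ 2 * (K * a)) ^ 2 * (1 / v))) + a / 2 * (4 * (1 / v)))) ≤
      A * (a * (a * L / n ^ 2 + 1 / v)) := by
    have e : (1 / (2 * (2 * δ * (n : ℝ) ^ 2)) *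
        (d * (4 * (((m : ℝ) ^ 2 * (K * a)) ^ 2 * (4 * L)))) +
        (1 / (2 * a) * (4 * (((m : ℝ) ^ 2 * (K * a)) ^ 2 * (1 / v))) + a / 2 * (4 * (1 / v)))) =
        (4 * d * ((m : ℝ) ^ 2 * K) ^ 2 / δ) * (a * (a * L / n ^ 2)) +
        (2 * ((m : ℝ) ^ 2 * K) ^ 2 + 2) * (a * (1 / v)) := by
      field_simp; ring
    rw [e]
    have p1 : 0 ≤ a * (a * L / n ^ 2) := by positivity
    have p2 : 0 ≤ a * (1 / v) := by positivity
    have p3 : 0 ≤ 4 * d * ((m : ℝ) ^ 2 * K) ^ 2 / δ := by positivity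
    have p4 : 0 ≤ 2 * ((m : ℝ) ^ 2 * K) ^ 2 + 2 := by positivity
    rw [hA]
    nlinarith [mul_nonneg p3 p2, mul_nonneg p4 p1]
  have c2 : (a * L / n ^ 2 + 1 / v) * v ≤ 2 := by
    have : a * L / n ^ 2 * v ≤ 1 := by
      rw [div_mul_eq_mul_div, div_le_one (by positivity)]
      linarith
    have e : 1 / v * v = 1 := by field_simp
    rw [add_mul, e]; linarith
  have c3 : (a * L / n ^ 2 + 1 / v) * (n : ℝ) ^ d ≤ (1 + 4 ^ d) * errorTerm d n a L := by
    have e : errorTerm d n a L = a * L / n ^ 2 * (n : ℝ) ^ d := by unfold errorTerm; ring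
    have : 1 / v ≤ 4 ^ d * (a * L / n ^ 2) := by
      rw [div_le_iff₀ hvpos, ← mul_div_assoc, div_mul_eq_mul_div, le_div_iff₀ (by positivity)]
      linarith
    rw [e, ← mul_assoc]
    refine mul_le_mul_of_nonneg_right ?_ (by positivity)
    linarith
  have hbase : 0 ≤ (m : ℝ) ^ 2 * (4 ^ d * v) * H + (n : ℝ) ^ d := by positivity
  refine (mul_le_mul_of_nonneg_right c1 hbase).trans ?_
  have herr := errorTerm_nonneg (d := d) (n := n) (L := L) ha0.le
  have c4 : (a * L / n ^ 2 + 1 / v) * ((m : ℝ) ^ 2 * (4 ^ d * v) * H + (n : ℝ) ^ d) ≤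
      2 * (m : ℝ) ^ 2 * 4 ^ d * H + (1 + 4 ^ d) * errorTerm d n a L := by
    have : (m : ℝ) ^ 2 * 4 ^ d * H * ((a * L / n ^ 2 + 1 / v) * v) ≤
        (m : ℝ) ^ 2 * 4 ^ d * H * 2 := mul_le_mul_of_nonneg_left c2 (by positivity)
    calc _ = (m : ℝ) ^ 2 * 4 ^ d * H * ((a * L / n ^ 2 + 1 / v) * v) +
          (a * L / n ^ 2 + 1 / v) * (n : ℝ) ^ d := by ring
      _ ≤ _ := by linarith
  calc _ = A * a * ((a * L / n ^ 2 + 1 / v) *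
        ((m : ℝ) ^ 2 * (4 ^ d * v) * H + (n : ℝ) ^ d)) := by ring
    _ ≤ A * a * (2 * (m : ℝ) ^ 2 * 4 ^ d * H + (1 + 4 ^ d) * errorTerm d n a L) := by gcongr
    _ ≤ A * a * ((2 * (m : ℝ) ^ 2 * 4 ^ d + (1 + 4 ^ d)) * (H + errorTerm d n a L)) := by
        refine mul_le_mul_of_nonneg_left ?_ (by positivity)
        have q1 : 0 ≤ 2 * (m : ℝ) ^ 2 * 4 ^ d * errorTerm d n a L := by positivity
        have q2 : 0 ≤ (1 + (4 : ℝ) ^ d) * H := by positivity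
        linarith
    _ = _ := by ring

/-- Reduction modulo `n` of a lattice point. -/
def toTorus (n : ℕ) (z : Fin d → ℤ) : Torus d n := fun i => (z i : ZMod n)

lemma toTorus_sub (n : ℕ) (z w : Fin d → ℤ) :
    toTorus n (z - w) = toTorus n z - toTorus n w := by
  funext i; simp [toTorus]

lemma toTorus_add (n : ℕ) (z w : Fin d → ℤ) :
    toTorus n (z + w) = toTorus n z + toTorus n w := by
  funext i; simp [toTorus]

lemma torusTranslate_apply {n : ℕ} (x : Torus d n) (η : TorusConfig d n) (z : Fin d → ℤ) :
    torusTranslate x η z = η (x + toTorus n z) := rfl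

/-- A product of at least two centred occupation variables is admissible. The averaged
coordinate is a maximal element of `A`, so that the box attached to it avoids the others. -/
lemma admissible_prod (hd1 : 1 ≤ d) (hd3 : d ≤ 3) {ρ : ℝ} (h0 : 0 < ρ) (h1 : ρ < 1)
    {A : Finset (Fin d → ℤ)} (hA : 2 ≤ A.card) :
    Admissible ρ (fun η : Config d => ∏ z ∈ A, cen ρ (η z)) := by
  intro K hK δ hδ
  obtain ⟨z₀, hz₀⟩ := A.exists_maximal (Finset.card_pos.1 (by omega))
  have hm : 0 < (A.erase z₀).card := by rw [Finset.card_erase_of_mem hz₀.1]; omega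
  obtain ⟨C, hC, h⟩ := exists_scaled_bound hd1 hd3 h0 h1 hm hK hδ
  -- a bound for the differences of coordinates of points of `A`
  let b : ℕ := ∑ z ∈ A, ∑ w ∈ A, ∑ i, (z i - w i).natAbs
  have hb : ∀ z ∈ A, ∀ w ∈ A, ∀ i, (z i - w i).natAbs ≤ b := by
    intro z hz w hw i
    calc (z i - w i).natAbs ≤ ∑ i, (z i - w i).natAbs :=
          Finset.single_le_sum (f := fun i => (z i - w i).natAbs) (fun _ _ => Nat.zero_le _)
            (Finset.mem_univ i)
      _ ≤ ∑ w ∈ A, ∑ i, (z i - w i).natAbs :=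
          Finset.single_le_sum (f := fun w => ∑ i, (z i - w i).natAbs)
            (fun _ _ => Nat.zero_le _) hw
      _ ≤ b := Finset.single_le_sum (f := fun z => ∑ w ∈ A, ∑ i, (z i - w i).natAbs)
            (fun _ _ => Nat.zero_le _) hz
  refine ⟨C, hC, b, fun n _ a L hs G hG => ?_⟩
  have hbn : b < n := by
    have := hs.room ⟨0, hd1⟩; omega
  have hinj : Set.InjOn (fun z => toTorus n (z - z₀)) (A.erase z₀ : Set (Fin d → ℤ)) := by
    intro z hz w hw hzw
    have hz := Finset.mem_of_mem_erase (Finset.mem_coe.1 hz)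
    have hw := Finset.mem_of_mem_erase (Finset.mem_coe.1 hw)
    funext i
    have e : (((z i - z₀ i : ℤ)) : ZMod n) = ((w i - z₀ i : ℤ) : ZMod n) := congrFun hzw i
    rw [ZMod.intCast_eq_intCast_iff_dvd_sub] at e
    have hlt := hb w hw z hz i
    have : w i - z₀ i - (z i - z₀ i) = 0 := by
      refine Int.eq_zero_of_abs_lt_dvd e ?_
      rw [Int.abs_eq_natAbs]
      have : w i - z₀ i - (z i - z₀ i) = w i - z i := by ring
      rw [this]; omega
    omega
  obtain ⟨R, r1, r2, r3⟩ := h n a L (hs.mono (Nat.zero_le _))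
    ((A.erase z₀).image fun z => toTorus n (z - z₀)) (Finset.card_image_of_injOn hinj)
    (fun v hv => by
      obtain ⟨z, hz, rfl⟩ := Finset.mem_image.1 hv
      have hzA := Finset.mem_of_mem_erase hz
      have hne := Finset.ne_of_mem_erase hz
      have hnle : ¬ z₀ ≤ z := fun hle => hne (hz₀.eq_of_le hzA hle).symm
      rw [Pi.le_def] at hnle
      push Not at hnle
      obtain ⟨i, hi⟩ := hnle
      refine ⟨i, ?_⟩
      have hdiff := hb z hzA z₀ hz₀.1 i
      have hroom := hs.room i
      obtain ⟨k, hk⟩ : ∃ k : ℕ, z i - z₀ i = (k : ℤ) - n := ⟨n - (z₀ i - z i).toNat, by omega⟩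
      have hkn : k < n := by omega
      have e : toTorus n (z - z₀) i = (k : ZMod n) := by
        show (((z i - z₀ i : ℤ)) : ZMod n) = _
        rw [hk]; simp
      rw [e, ZMod.val_natCast_of_lt hkn]
      omega)
    (fun x => G (x - toTorus n z₀)) (fun x => hG _)
  refine ⟨R, r1, fun u => ?_, r3⟩
  refine le_trans (le_of_eq ?_) (r2 u)
  congr 1; funext η; congr 1
  symm
  rw [← Equiv.sum_comp (Equiv.addRight (toTorus n z₀))]
  refine Finset.sum_congr rfl fun x _ => ?_
  simp only [Equiv.coe_addRight, add_sub_cancel_right]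
  symm
  congr 1
  rw [← Finset.mul_prod_erase A _ hz₀.1, Finset.prod_image hinj]
  simp only [torusTranslate_apply]
  congr 1
  refine Finset.prod_congr rfl fun z _ => ?_
  rw [toTorus_sub, add_add_sub_cancel]

lemma admissible_gradient_unit {ρ : ℝ} (h0 : 0 < ρ) (h1 : ρ < 1)
    (z : Fin d → ℤ) (k : Fin d) :
    Admissible ρ (fun η : Config d => cen ρ (η (z + unitVec ℤ k)) - cen ρ (η z)) := by
  intro K hK δ hδ
  refine ⟨K ^ 2 / (4 * δ), by positivity, 0, fun n _ a L hs G hG => ?_⟩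
  have ha := hs.one_le
  have ha0 : 0 < a := zero_lt_one.trans_le ha
  have hn : (0 : ℝ) < n := by exact_mod_cast Nat.pos_of_ne_zero (NeZero.ne n)
  have hδ' : 0 < 2 * δ * (n : ℝ) ^ 2 := by positivity
  set G' : Torus d n → ℝ := fun y => -G (y - toTorus n z) with hG'
  refine ⟨fun _ => ∑ y, 1 / (2 * (2 * δ * (n : ℝ) ^ 2)) * G' y ^ 2,
    fun _ => Finset.sum_nonneg fun y _ => by positivity, fun u => ?_, fun f hf => ?_⟩
  · have e : ∀ η : TorusConfig d n, (∑ x, G x * (cen ρ (torusTranslate x η (z + unitVec ℤ k)) -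
        cen ρ (torusTranslate x η z))) * u η ^ 2 =
        ∑ y, G' y * (cen ρ (η y) - cen ρ (η (y + unitVec (ZMod n) k))) * u η ^ 2 := by
      intro η
      rw [Finset.sum_mul, ← Equiv.sum_comp (Equiv.addRight (toTorus n z))
        (fun y => G' y * (cen ρ (η y) - cen ρ (η (y + unitVec (ZMod n) k))) * u η ^ 2)]
      refine Finset.sum_congr rfl fun x _ => ?_
      have hk : toTorus n (unitVec ℤ k) = unitVec (ZMod n) k := by
        funext i
        simp only [toTorus, unitVec, Pi.single_apply]
        split_ifs <;> simp
      simp only [torusTranslate_apply, toTorus_add, hk, Equiv.coe_addRight, hG',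
        add_sub_cancel_right, add_assoc]
      ring
    have e2 : ∀ η : TorusConfig d n, (∑ y, 1 / (2 * (2 * δ * (n : ℝ) ^ 2)) * G' y ^ 2) * u η ^ 2 =
        ∑ y, 1 / (2 * (2 * δ * (n : ℝ) ^ 2)) * (G' y ^ 2 * u η ^ 2) := by
      intro η; rw [Finset.sum_mul]; exact Finset.sum_congr rfl fun _ _ => by ring
    simp only [e, e2]
    rw [ev_sum, ev_sum]
    have hD : ∑ y : Torus d n, 2 * δ * (n : ℝ) ^ 2 / 2 *
        ev ρ (fun η => (u (exchange y (y + unitVec (ZMod n) k) η) - u η) ^ 2) ≤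
        δ * (n : ℝ) ^ 2 * dirichlet ρ u := by
      rw [← Finset.mul_sum, show 2 * δ * (n : ℝ) ^ 2 / 2 = δ * (n : ℝ) ^ 2 by ring]
      refine mul_le_mul_of_nonneg_left ?_ (by positivity)
      refine Finset.sum_le_sum fun y _ => ?_
      exact Finset.single_le_sum (f := fun k => ev ρ (fun η =>
        (u (exchange y (y + unitVec (ZMod n) k) η) - u η) ^ 2))
        (fun _ _ => ev_nonneg h0 h1 fun _ => sq_nonneg _) (Finset.mem_univ k)
    refine le_trans ?_ (add_le_add_left hD _)
    rw [← Finset.sum_add_distrib]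
    refine Finset.sum_le_sum fun y _ => ?_
    have := ev_mul_cen_sub_le h0 h1 (y := y) (y' := y + unitVec (ZMod n) k)
      (h := fun _ => G' y) (fun _ => rfl) hδ' u
    rwa [ev_const_mul ρ (1 / (2 * (2 * δ * (n : ℝ) ^ 2)))]
  · rw [ev_mul_const, hf.ev_eq_one, one_mul]
    have hG2 : ∀ y, G' y ^ 2 ≤ (K * a) ^ 2 := fun y => by
      rw [hG']
      have := hG (y - toTorus n z)
      rw [neg_sq, ← sq_abs]
      gcongr
    have hcard : (Fintype.card (Torus d n) : ℝ) = (n : ℝ) ^ d := by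
      simp [ZMod.card]
    have hL : (1 : ℝ) ≤ L := by exact_mod_cast hs.one_le_L
    calc ∑ y, 1 / (2 * (2 * δ * (n : ℝ) ^ 2)) * G' y ^ 2
        ≤ ∑ _y : Torus d n, 1 / (2 * (2 * δ * (n : ℝ) ^ 2)) * (K * a) ^ 2 :=
          Finset.sum_le_sum fun y _ => mul_le_mul_of_nonneg_left (hG2 y) (by positivity)
      _ = K ^ 2 / (4 * δ) * a * (a * 1 * (n : ℝ) ^ d / n ^ 2) := by
          rw [Finset.sum_const, Finset.card_univ, nsmul_eq_mul, hcard]; field_simp; ring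
      _ ≤ K ^ 2 / (4 * δ) * a * (a * L * (n : ℝ) ^ d / n ^ 2) := by gcongr
      _ ≤ K ^ 2 / (4 * δ) * a * (ent ρ f + errorTerm d n a L) := by
          have := ent_nonneg h0 h1 hf.nonneg
          refine mul_le_mul_of_nonneg_left ?_ (by positivity)
          unfold errorTerm; linarith

/-- Every difference of two occupation variables is admissible. -/
lemma admissible_gradient {ρ : ℝ} (h0 : 0 < ρ) (h1 : ρ < 1) (v : Fin d → ℤ) :
    Admissible ρ (fun η : Config d => cen ρ (η v) - cen ρ (η 0)) := by
  let H : AddSubgroup (Fin d → ℤ) :=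
    { carrier := {v | ∀ z, Admissible ρ (fun η : Config d => cen ρ (η (z + v)) - cen ρ (η z))}
      zero_mem' := fun z => by simpa using Admissible.zero h0 h1
      add_mem' := fun {v w} hv hw z => by
        have := (hv z).add (hw (z + v))
        convert this using 2
        rw [add_assoc]; ring
      neg_mem' := fun {v} hv z => by
        have := (hv (z - v)).neg
        simpa [← sub_eq_add_neg] using this }
  have hunit : ∀ k, unitVec ℤ k ∈ H := fun k z => admissible_gradient_unit h0 h1 z k
  have hv : v ∈ H := by
    have e : v = ∑ k, v k • unitVec ℤ k := by
      funext i
      simp [unitVec, Finset.sum_apply, Pi.single_apply]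
    rw [e]
    exact H.sum_mem fun k _ => H.zsmul_mem (hunit k) _
  simpa using hv 0

end Admissible

/-! ### Expansion of cylinder functions -/

section Cylinder

variable {d : ℕ}

/-- A cylinder function is a linear combination of products of centred occupation variables. -/
lemma exists_expansion (ρ : ℝ) (A : Finset (Fin d → ℤ)) :
    ∀ f : Config d → ℝ, DependsOn f (A : Set (Fin d → ℤ)) →
      ∃ c : Finset (Fin d → ℤ) → ℝ, ∀ η, f η = ∑ B ∈ A.powerset, c B * ∏ z ∈ B, cen ρ (η z) := by
  classical
  induction A using Finset.induction_on with
  | empty =>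
    intro f hf
    refine ⟨fun _ => f fun _ => false, fun η => ?_⟩
    simp only [Finset.powerset_empty, Finset.sum_singleton, Finset.prod_empty, mul_one]
    exact hf fun i hi => absurd hi (by simp)
  | insert w A hw ih =>
    intro f hf
    let F : Bool → Config d → ℝ := fun b η => f (Function.update η w b)
    have hF : ∀ b, DependsOn (F b) (A : Set (Fin d → ℤ)) := by
      intro b η η' h
      refine hf fun i hi => ?_
      by_cases hiw : i = w
      · subst hiw; simp
      · rw [Function.update_of_ne hiw, Function.update_of_ne hiw]
        exact h i (Finset.mem_coe.2 ((Finset.mem_insert.1 (Finset.mem_coe.1 hi)).resolve_left hiw))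
    obtain ⟨c0, hc0⟩ := ih (fun η => (1 - ρ) * F false η + ρ * F true η) (fun η η' h => by
      simp only [hF false h, hF true h])
    obtain ⟨c1, hc1⟩ := ih (fun η => F true η - F false η) (fun η η' h => by
      simp only [hF false h, hF true h])
    refine ⟨fun B => if w ∈ B then c1 (B.erase w) else c0 B, fun η => ?_⟩
    rw [Finset.sum_powerset_insert hw]
    have e0 : ∑ B ∈ A.powerset, (if w ∈ B then c1 (B.erase w) else c0 B) *
        ∏ z ∈ B, cen ρ (η z) = (1 - ρ) * F false η + ρ * F true η := by
      rw [hc0]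
      refine Finset.sum_congr rfl fun B hB => ?_
      rw [if_neg fun h => hw (Finset.mem_powerset.1 hB h)]
    have e1 : ∑ B ∈ A.powerset, (if w ∈ insert w B then c1 ((insert w B).erase w)
        else c0 (insert w B)) * ∏ z ∈ insert w B, cen ρ (η z) =
        cen ρ (η w) * (F true η - F false η) := by
      rw [hc1, Finset.mul_sum]
      refine Finset.sum_congr rfl fun B hB => ?_
      have hwB : w ∉ B := fun h => hw (Finset.mem_powerset.1 hB h)
      rw [if_pos (Finset.mem_insert_self _ _), Finset.erase_insert hwB, Finset.prod_insert hwB]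
      ring
    rw [e0, e1]
    have hη : f η = F (η w) η := by simp [F]
    rw [hη]
    cases η w <;> simp [cen, occ] <;> ring

instance (r : ℝ) : IsProbabilityMeasure (bern r) := by unfold bern; infer_instance

lemma bern_real_true {r : ℝ} (h0 : 0 ≤ r) (h1 : r ≤ 1) : (bern r).real {true} = r := by
  unfold bern
  rw [bernoulliMeasure_real_apply_of_mem_of_notMem _ (measurableSet_singleton _) (by simp)
    (by simp), Set.projIcc_of_mem _ ⟨h0, h1⟩]

lemma bern_real_false {r : ℝ} (h0 : 0 ≤ r) (h1 : r ≤ 1) : (bern r).real {false} = 1 - r := by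
  unfold bern
  rw [bernoulliMeasure_real_apply_of_notMem_of_mem _ (measurableSet_singleton _) (by simp)
    (by simp), Set.projIcc_of_mem _ ⟨h0, h1⟩]

lemma bern_real_singleton {r : ℝ} (h0 : 0 ≤ r) (h1 : r ≤ 1) (b : Bool) :
    (bern r).real {b} = siteWeight r b := by
  cases b
  · simpa [siteWeight] using bern_real_false h0 h1
  · simpa [siteWeight] using bern_real_true h0 h1

lemma integral_cen {ρ r : ℝ} (h0 : 0 ≤ r) (h1 : r ≤ 1) : ∫ b, cen ρ b ∂(bern r) = r - ρ := by
  rw [integral_fintype (Integrable.of_finite)]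
  simp only [Fintype.sum_bool, bern_real_true h0 h1, bern_real_false h0 h1, smul_eq_mul, cen, occ]
  simp; ring

lemma integral_prod_cen {ρ r : ℝ} (h0 : 0 ≤ r) (h1 : r ≤ 1) (B : Finset (Fin d → ℤ)) :
    ∫ η : Config d, ∏ z ∈ B, cen ρ (η z) ∂(nu d r) = (r - ρ) ^ B.card := by
  have h := integral_restrict_infinitePi (μ := fun _ : Fin d → ℤ => bern r) (s := B)
    (f := fun ξ : B → Bool => ∏ z, cen ρ (ξ z)) (measurable_of_finite _).aestronglyMeasurable
  have e : ∀ η : Config d, ∏ z ∈ B, cen ρ (η z) = ∏ z : B, cen ρ (B.restrict η z) := fun η =>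
    (Finset.prod_coe_sort B fun z => cen ρ (η z)).symm
  simp only [e, nu]
  rw [h, integral_fintype_prod_eq_prod (fun _ : B => cen ρ)]
  simp [integral_cen h0 h1]

lemma integrable_prod_cen {ρ r : ℝ} (B : Finset (Fin d → ℤ)) :
    Integrable (fun η : Config d => ∏ z ∈ B, cen ρ (η z)) (nu d r) := by
  have : IsProbabilityMeasure (nu d r) := by unfold nu; infer_instance
  have hm : Measurable (fun η : Config d => ∏ z ∈ B, cen ρ (η z)) :=
    Finset.measurable_prod _ fun z _ => (measurable_of_finite (cen ρ)).comp (measurable_pi_apply z)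
  refine Integrable.of_bound hm.aestronglyMeasurable ((|1 - ρ| + |ρ|) ^ B.card)
    (Eventually.of_forall fun η => ?_)
  rw [Real.norm_eq_abs, Finset.abs_prod]
  rw [← Finset.prod_const]
  refine Finset.prod_le_prod (fun _ _ => abs_nonneg _) fun z _ => ?_
  cases η z
  · simp [cen, occ]
  · simp [cen, occ]

/-- The function `Π_ρ f` is admissible for every cylinder function `f`. -/
lemma admissible_proj (hd1 : 1 ≤ d) (hd3 : d ≤ 3) {ρ : ℝ} (h0 : 0 < ρ) (h1 : ρ < 1)
    {f : Config d → ℝ} (hf : IsCylinder f) : Admissible ρ (proj ρ f) := by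
  obtain ⟨A, hA⟩ := hf
  obtain ⟨c, hc⟩ := exists_expansion ρ A f hA
  have hmean : ∀ r, 0 ≤ r → r ≤ 1 → mean f r = ∑ B ∈ A.powerset, c B * (r - ρ) ^ B.card := by
    intro r hr0 hr1
    unfold mean
    simp only [hc]
    rw [integral_finsetSum _ fun B _ => (integrable_prod_cen B).const_mul _]
    refine Finset.sum_congr rfl fun B _ => ?_
    rw [integral_const_mul, integral_prod_cen hr0 hr1]
  have hmean' : mean f =ᶠ[𝓝 ρ] fun r => ∑ B ∈ A.powerset, c B * (r - ρ) ^ B.card := by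
    filter_upwards [Ioo_mem_nhds h0 h1] with r hr
    exact hmean r hr.1.le hr.2.le
  have hderiv : deriv (mean f) ρ = ∑ B ∈ A.powerset, c B * (if B.card = 1 then 1 else 0) := by
    rw [hmean'.deriv_eq]
    refine HasDerivAt.deriv (HasDerivAt.fun_sum fun B _ => HasDerivAt.const_mul _ ?_)
    have := ((hasDerivAt_id ρ).sub_const ρ).pow B.card
    simp only [id, sub_self, mul_one] at this
    refine this.congr_deriv ?_
    split_ifs with h
    · simp [h]
    · rcases Nat.eq_zero_or_pos B.card with h' | h'
      · simp [h']
      · rw [zero_pow (by omega), mul_zero]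
  have hproj : proj ρ f = fun η => ∑ B ∈ A.powerset, c B * (∏ z ∈ B, cen ρ (η z) -
      0 ^ B.card - (if B.card = 1 then 1 else 0) * cen ρ (η 0)) := by
    funext η
    unfold proj
    rw [hderiv, hmean ρ h0.le h1.le, hc, Finset.sum_mul, ← Finset.sum_sub_distrib,
      ← Finset.sum_sub_distrib]
    refine Finset.sum_congr rfl fun B _ => ?_
    rw [sub_self]; unfold cen; ring
  rw [hproj]
  refine Admissible.sum h0 h1 _ fun B _ => Admissible.const_mul ?_ _
  have hcases : B.card = 0 ∨ B.card = 1 ∨ 2 ≤ B.card := by omega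
  rcases hcases with h | h | h
  · rw [Finset.card_eq_zero] at h
    subst h
    simpa using Admissible.zero (d := d) h0 h1
  · obtain ⟨z, rfl⟩ := Finset.card_eq_one.1 h
    simpa using admissible_gradient h0 h1 z
  · have hne : B.card ≠ 1 := by omega
    have hne0 : B.card ≠ 0 := by omega
    simpa [hne, hne0] using admissible_prod hd1 hd3 h0 h1 h

end Cylinder

/-! ### The generator and the reference measure -/

section Generator

variable {d n : ℕ} [NeZero n]

/-- The exclusion rates are unchanged by the exchange whose rate they are. -/
def RateInvariant (c : Fin d → Config d → ℝ) (n : ℕ) : Prop :=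
  ∀ (j : Fin d) (x : Torus d n) (η : TorusConfig d n),
    c j (torusTranslate x (exchange x (x + unitVec (ZMod n) j) η)) = c j (torusTranslate x η)

/-- The function obtained by applying to the constant `1` the adjoint, in `L²` of the Bernoulli
measure, of the voter generator. It measures the lack of invariance of the Bernoulli measure. -/
def voterField (ρ : ℝ) (η : TorusConfig d n) : ℝ :=
  1 / (ρ * (1 - ρ)) * ∑ x : Torus d n, ∑ y ∈ neighbours x, cen ρ (η x) * cen ρ (η y)

lemma exclusionGen_apply (c : Fin d → Config d → ℝ) (f : TorusConfig d n → ℝ)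
    (η : TorusConfig d n) : exclusionGen c n f η = ∑ x : Torus d n, ∑ j : Fin d,
      c j (torusTranslate x η) * (f (exchange x (x + unitVec (ZMod n) j) η) - f η) := rfl

lemma voterGen_apply (f : TorusConfig d n → ℝ) (η : TorusConfig d n) :
    voterGen d n f η = ∑ x : Torus d n, ∑ y ∈ neighbours x,
      (occ (η y) - occ (η x)) ^ 2 * (f (flipAt x η) - f η) := rfl

lemma gen_apply (c : Fin d → Config d → ℝ) (a : ℝ) (f : TorusConfig d n → ℝ)
    (η : TorusConfig d n) :
    gen c a n f η = (n : ℝ) ^ 2 * exclusionGen c n f η + a * voterGen d n f η := rfl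

lemma toTorus_unitVec (n : ℕ) (k : Fin d) : toTorus n (unitVec ℤ k) = unitVec (ZMod n) k := by
  funext i
  simp only [toTorus, unitVec, Pi.single_apply]
  split_ifs <;> simp

lemma toTorus_eq_iff {z w : Fin d → ℤ} (h : ∀ i, (z i - w i).natAbs < n) :
    toTorus n z = toTorus n w ↔ z = w := by
  refine ⟨fun e => ?_, fun e => by rw [e]⟩
  funext i
  have e' : ((z i : ℤ) : ZMod n) = (w i : ℤ) := congrFun e i
  rw [ZMod.intCast_eq_intCast_iff_dvd_sub] at e'
  have : w i - z i = 0 := by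
    refine Int.eq_zero_of_abs_lt_dvd e' ?_
    rw [Int.abs_eq_natAbs]
    have := h i
    omega
  omega

/-- On a torus larger than the supports of the rates, no site of a support wraps around to one of
the two exchanged sites. -/
lemma exists_rateInvariant {c : Fin d → Config d → ℝ} (hc_cyl : ∀ j, IsCylinder (c j))
    (hc_dep : ∀ j, DependsOn (c j) ({0, unitVec ℤ j}ᶜ : Set (Fin d → ℤ))) :
    ∃ b : ℕ, ∀ (n : ℕ) [NeZero n], b < n → RateInvariant c n := by
  choose A hA using hc_cyl
  let b : ℕ := ∑ j, ∑ z ∈ A j, ∑ i, ((z i).natAbs + 1)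
  have hb : ∀ j, ∀ z ∈ A j, ∀ i, (z i).natAbs + 1 ≤ b := by
    intro j z hz i
    calc (z i).natAbs + 1 ≤ ∑ i, ((z i).natAbs + 1) :=
          Finset.single_le_sum (f := fun i => (z i).natAbs + 1) (fun _ _ => Nat.zero_le _)
            (Finset.mem_univ i)
      _ ≤ ∑ z ∈ A j, ∑ i, ((z i).natAbs + 1) :=
          Finset.single_le_sum (f := fun z => ∑ i, ((z i).natAbs + 1))
            (fun _ _ => Nat.zero_le _) hz
      _ ≤ b := Finset.single_le_sum (f := fun j => ∑ z ∈ A j, ∑ i, ((z i).natAbs + 1))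
            (fun _ _ => Nat.zero_le _) (Finset.mem_univ j)
  refine ⟨b, fun n _ hn j x η => ?_⟩
  have hx0 : ∀ w : Fin d → ℤ, (x + toTorus n w = x) ↔ toTorus n w = toTorus n 0 := fun w => by
    have : toTorus n (0 : Fin d → ℤ) = 0 := by funext i; simp [toTorus]
    rw [this, add_eq_left]
  -- pass through the configuration that agrees with the two in turn
  set ξ := torusTranslate x (exchange x (x + unitVec (ZMod n) j) η) with hξ
  set ζ := torusTranslate x η with hζ
  have hagree : ∀ z ∈ A j, z ∉ ({0, unitVec ℤ j} : Set (Fin d → ℤ)) → ξ z = ζ z := by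
    intro z hz hz'
    simp only [Set.mem_insert_iff, Set.mem_singleton_iff, not_or] at hz'
    rw [hξ, hζ, torusTranslate_apply, torusTranslate_apply]
    unfold exchange
    rw [Equiv.swap_apply_of_ne_of_ne]
    · rw [Ne, hx0, toTorus_eq_iff]
      · exact hz'.1
      · intro i; have := hb j z hz i; simp only [Pi.zero_apply]; omega
    · rw [Ne, ← toTorus_unitVec, add_right_inj, toTorus_eq_iff]
      · exact hz'.2
      · intro i
        have := hb j z hz i
        have h1 : (unitVec ℤ j i : ℤ) = 0 ∨ (unitVec ℤ j i : ℤ) = 1 := by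
          unfold unitVec; rw [Pi.single_apply]; split_ifs <;> simp
        omega
  classical
  let θ : Config d := fun z => if z ∈ ({0, unitVec ℤ j} : Set (Fin d → ℤ)) then ζ z else ξ z
  have h1 : c j ξ = c j θ := hc_dep j fun z hz => by
    have : z ∉ ({0, unitVec ℤ j} : Set (Fin d → ℤ)) := hz
    simp only [θ, if_neg this]
  have h2 : c j θ = c j ζ := hA j fun z hz => by
    by_cases h : z ∈ ({0, unitVec ℤ j} : Set (Fin d → ℤ))
    · simp only [θ, if_pos h]
    · simp only [θ, if_neg h]; exact hagree z hz h
  rw [h1, h2]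

lemma ev_exclusionGen (ρ : ℝ) {c : Fin d → Config d → ℝ} (hc : RateInvariant c n)
    (f : TorusConfig d n → ℝ) : ev ρ (exclusionGen c n f) = 0 := by
  have : exclusionGen c n f = fun η => ∑ x : Torus d n, ∑ j : Fin d,
      c j (torusTranslate x η) * (f (exchange x (x + unitVec (ZMod n) j) η) - f η) := rfl
  rw [this]
  simp only [ev_sum]
  refine Finset.sum_eq_zero fun x _ => Finset.sum_eq_zero fun j _ => ?_
  simp only [mul_sub]
  rw [ev_sub, sub_eq_zero, ← ev_exchange ρ x (x + unitVec (ZMod n) j)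
    (fun η => c j (torusTranslate x η) * f η)]
  simp only [hc j x]

lemma not_mem_neighbours (hn : 2 ≤ n) (x : Torus d n) : x ∉ neighbours x := by
  have : Fact (1 < n) := ⟨by omega⟩
  intro h
  obtain ⟨j, hj⟩ := (Finset.mem_filter.1 h).2
  have : unitVec (ZMod n) j ≠ 0 := by
    unfold unitVec; rw [Ne, Pi.single_eq_zero_iff]; exact one_ne_zero
  rcases hj with hj | hj <;> exact this (left_eq_add.1 hj)

lemma ev_voterGen {ρ : ℝ} (h0 : 0 < ρ) (h1 : ρ < 1) (hn : 2 ≤ n) (f : TorusConfig d n → ℝ) :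
    ev ρ (voterGen d n f) = ev ρ (fun η => voterField ρ η * f η) := by
  have e : voterGen d n f = fun η => ∑ x : Torus d n, ∑ y ∈ neighbours x,
      (occ (η y) - occ (η x)) ^ 2 * (f (flipAt x η) - f η) := rfl
  have e' : (fun η : TorusConfig d n => voterField ρ η * f η) =
      fun η => ∑ x : Torus d n, ∑ y ∈ neighbours x,
        1 / (ρ * (1 - ρ)) * (cen ρ (η x) * cen ρ (η y)) * f η := by
    funext η; unfold voterField
    simp only [Finset.mul_sum, Finset.sum_mul]
  rw [e, e']
  simp only [ev_sum]
  refine Finset.sum_congr rfl fun x _ => Finset.sum_congr rfl fun y hy => ?_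
  have hyx : y ≠ x := fun h => not_mem_neighbours hn x (h ▸ hy)
  simp only [mul_sub]
  rw [ev_sub]
  have e1 : ev ρ (fun η => (occ (η y) - occ (η x)) ^ 2 * f (flipAt x η)) =
      ev ρ (fun η => siteWeight ρ (!(η x)) / siteWeight ρ (η x) *
        ((occ (η y) - occ (!(η x))) ^ 2 * f η)) := by
    rw [← ev_flip h0 h1 x]
    congr 1; funext η
    simp only [Function.update_self, Function.update_of_ne hyx, Bool.not_not]
    rfl
  rw [e1, ← ev_sub]
  congr 1; funext η
  have h2 : 1 - ρ ≠ 0 := by linarith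
  cases η x <;> cases η y <;> simp [siteWeight, occ, cen] <;>
    field_simp <;> simp

lemma ev_gen {ρ : ℝ} (h0 : 0 < ρ) (h1 : ρ < 1) (hn : 2 ≤ n) {c : Fin d → Config d → ℝ}
    (hc : RateInvariant c n) (a : ℝ) (f : TorusConfig d n → ℝ) :
    ev ρ (gen c a n f) = a * ev ρ (fun η => voterField ρ η * f η) := by
  have : gen c a n f =
      fun η => (n : ℝ) ^ 2 * exclusionGen c n f η + a * voterGen d n f η := rfl
  rw [this, ev_add, ev_const_mul, ev_const_mul, ev_exclusionGen ρ hc, ev_voterGen h0 h1 hn]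
  ring

lemma dirichlet_le_ev {ρ : ℝ} (h0 : 0 < ρ) (h1 : ρ < 1) {c : Fin d → Config d → ℝ} {c₀ : ℝ}
    (hc : ∀ j η, c₀ ≤ c j η) (u : TorusConfig d n → ℝ) :
    c₀ * dirichlet ρ u ≤ ev ρ (fun η => ∑ x : Torus d n, ∑ j : Fin d,
      c j (torusTranslate x η) * (u (exchange x (x + unitVec (ZMod n) j) η) - u η) ^ 2) := by
  unfold dirichlet
  simp only [ev_sum, Finset.mul_sum]
  refine Finset.sum_le_sum fun x _ => Finset.sum_le_sum fun j _ => ?_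
  rw [← ev_const_mul]
  exact ev_mono h0 h1 fun η => mul_le_mul_of_nonneg_right (hc j _) (sq_nonneg _)

/-- The quadratic form of the generator. -/
lemma ev_mul_gen_le {ρ : ℝ} (h0 : 0 < ρ) (h1 : ρ < 1) (hn : 2 ≤ n) {c : Fin d → Config d → ℝ}
    {c₀ : ℝ} (hc : RateInvariant c n) (hc₀ : ∀ j η, c₀ ≤ c j η) {a : ℝ} (ha : 0 ≤ a)
    (u : TorusConfig d n → ℝ) :
    ev ρ (fun η => u η * gen c a n u η) ≤
      -(1 / 2 * (c₀ * (n : ℝ) ^ 2 * dirichlet ρ u)) +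
        1 / 2 * (a * ev ρ (fun η => voterField ρ η * u η ^ 2)) := by
  have hpt : ∀ η, u η * gen c a n u η ≤ 1 / 2 * gen c a n (fun η => u η ^ 2) η -
      1 / 2 * (n : ℝ) ^ 2 * ∑ x : Torus d n, ∑ j : Fin d,
        c j (torusTranslate x η) * (u (exchange x (x + unitVec (ZMod n) j) η) - u η) ^ 2 := by
    intro η
    rw [gen_apply, gen_apply]
    have hex : u η * exclusionGen c n u η = 1 / 2 * exclusionGen c n (fun η => u η ^ 2) η -
        1 / 2 * ∑ x : Torus d n, ∑ j : Fin d, c j (torusTranslate x η) *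
          (u (exchange x (x + unitVec (ZMod n) j) η) - u η) ^ 2 := by
      simp only [exclusionGen_apply, Finset.mul_sum, ← Finset.sum_sub_distrib]
      exact Finset.sum_congr rfl fun x _ => Finset.sum_congr rfl fun j _ => by ring
    have hvo : u η * voterGen d n u η ≤ 1 / 2 * voterGen d n (fun η => u η ^ 2) η := by
      simp only [voterGen_apply, Finset.mul_sum]
      refine Finset.sum_le_sum fun x _ => Finset.sum_le_sum fun y _ => ?_
      have : 0 ≤ (occ (η y) - occ (η x)) ^ 2 * (u (flipAt x η) - u η) ^ 2 := by positivity
      nlinarith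
    have hvo' := mul_le_mul_of_nonneg_left hvo ha
    have hex' := congrArg (fun t => (n : ℝ) ^ 2 * t) hex
    linarith
  refine (ev_mono h0 h1 hpt).trans ?_
  rw [ev_sub, ev_const_mul, ev_const_mul, ev_gen h0 h1 hn hc]
  have := mul_le_mul_of_nonneg_left (dirichlet_le_ev h0 h1 hc₀ u)
    (show (0 : ℝ) ≤ 1 / 2 * (n : ℝ) ^ 2 by positivity)
  linarith

lemma mul_log_sub_le {x y : ℝ} (hx : 0 < x) (hy : 0 < y) :
    x * (Real.log y - Real.log x) ≤ (y - x) - (√y - √x) ^ 2 := by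
  have hsx := Real.sqrt_pos.2 hx
  have hsy := Real.sqrt_pos.2 hy
  have e : Real.log y - Real.log x = 2 * Real.log (√y / √x) := by
    rw [Real.log_div hsy.ne' hsx.ne', Real.log_sqrt hy.le, Real.log_sqrt hx.le]; ring
  have h := Real.log_le_sub_one_of_pos (div_pos hsy hsx)
  have qx := Real.sq_sqrt hx.le
  have qy := Real.sq_sqrt hy.le
  rw [e]
  calc x * (2 * Real.log (√y / √x)) ≤ x * (2 * (√y / √x - 1)) := by gcongr
    _ = √x ^ 2 * (2 * (√y / √x - 1)) := by rw [qx]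
    _ = 2 * √x * √y - 2 * √x ^ 2 := by field_simp
    _ = (√y ^ 2 - √x ^ 2) - (√y - √x) ^ 2 := by ring
    _ = _ := by rw [qx, qy]

/-- The entropy production of the generator. -/
lemma ev_mul_gen_log_le {ρ : ℝ} (h0 : 0 < ρ) (h1 : ρ < 1) (hn : 2 ≤ n)
    {c : Fin d → Config d → ℝ} {c₀ : ℝ} (hc : RateInvariant c n) (hc0 : 0 < c₀)
    (hc₀ : ∀ j η, c₀ ≤ c j η) {a : ℝ} (ha : 0 ≤ a)
    {f : TorusConfig d n → ℝ} (hf : ∀ η, 0 < f η) :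
    ev ρ (fun η => f η * gen c a n (fun η => Real.log (f η)) η) ≤
      -(c₀ * (n : ℝ) ^ 2 * dirichlet ρ (fun η => √(f η))) +
        a * ev ρ (fun η => voterField ρ η * f η) := by
  have hpt : ∀ η, f η * gen c a n (fun η => Real.log (f η)) η ≤ gen c a n f η -
      (n : ℝ) ^ 2 * ∑ x : Torus d n, ∑ j : Fin d, c j (torusTranslate x η) *
        (√(f (exchange x (x + unitVec (ZMod n) j) η)) - √(f η)) ^ 2 := by
    intro η
    rw [gen_apply, gen_apply]
    have hex : f η * exclusionGen c n (fun η => Real.log (f η)) η ≤ exclusionGen c n f η -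
        ∑ x : Torus d n, ∑ j : Fin d, c j (torusTranslate x η) *
          (√(f (exchange x (x + unitVec (ZMod n) j) η)) - √(f η)) ^ 2 := by
      simp only [exclusionGen_apply, Finset.mul_sum, ← Finset.sum_sub_distrib]
      refine Finset.sum_le_sum fun x _ => Finset.sum_le_sum fun j _ => ?_
      have hcpos : 0 ≤ c j (torusTranslate x η) := hc0.le.trans (hc₀ j _)
      have := mul_le_mul_of_nonneg_left
        (mul_log_sub_le (hf η) (hf (exchange x (x + unitVec (ZMod n) j) η))) hcpos
      linarith
    have hvo : f η * voterGen d n (fun η => Real.log (f η)) η ≤ voterGen d n f η := by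
      simp only [voterGen_apply, Finset.mul_sum]
      refine Finset.sum_le_sum fun x _ => Finset.sum_le_sum fun y _ => ?_
      have := mul_le_mul_of_nonneg_left ((mul_log_sub_le (hf η) (hf (flipAt x η))).trans
        (sub_le_self _ (sq_nonneg _))) (sq_nonneg (occ (η y) - occ (η x)))
      linarith
    have hvo' := mul_le_mul_of_nonneg_left hvo ha
    have hex' := mul_le_mul_of_nonneg_left hex (sq_nonneg (n : ℝ))
    linarith
  refine (ev_mono h0 h1 hpt).trans ?_
  rw [ev_sub, ev_const_mul, ev_gen h0 h1 hn hc]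
  have := mul_le_mul_of_nonneg_left (dirichlet_le_ev h0 h1 hc₀ (fun η => √(f η)))
    (sq_nonneg (n : ℝ))
  linarith

lemma sum_neighbours (hn : 3 ≤ n) (x : Torus d n) (F : Torus d n → ℝ) :
    ∑ y ∈ neighbours x, F y =
      ∑ j, (F (x + unitVec (ZMod n) j) + F (x - unitVec (ZMod n) j)) := by
  have hf : Fact (1 < n) := ⟨by omega⟩
  have h2 : (2 : ZMod n) ≠ 0 := by
    intro h
    have : ((2 : ℕ) : ZMod n) = 0 := by exact_mod_cast h
    rw [ZMod.natCast_eq_zero_iff] at this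
    have := Nat.le_of_dvd (by norm_num) this
    omega
  let e : Fin d × Bool → Torus d n := fun p =>
    if p.2 then x + unitVec (ZMod n) p.1 else x - unitVec (ZMod n) p.1
  have himage : neighbours x = Finset.univ.image e := by
    ext y
    simp only [neighbours, Finset.mem_filter, Finset.mem_univ, true_and, Finset.mem_image,
      Prod.exists, e]
    constructor
    · rintro ⟨j, hj | hj⟩
      · exact ⟨j, true, by simp [hj]⟩
      · exact ⟨j, false, by simp [hj]⟩
    · rintro ⟨j, b, hb⟩
      refine ⟨j, ?_⟩
      cases b
      · right; rw [← hb]; simp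
      · left; rw [← hb]; simp
  have hinj : Function.Injective e := by
    rintro ⟨j, b⟩ ⟨k, b'⟩ h
    have hj := congrFun h j
    cases b <;> cases b' <;> simp [e, unitVec, Pi.single_apply] at hj ⊢
    · exact hj
    · split_ifs at hj with hjk
      · rw [sub_eq_add_neg, add_right_inj, neg_eq_iff_add_eq_zero] at hj
        exact h2 (by rw [← hj]; norm_num)
      · simp at hj
    · split_ifs at hj with hjk
      · rw [sub_eq_add_neg, add_right_inj, eq_neg_iff_add_eq_zero] at hj
        exact h2 (by rw [← hj]; norm_num)
      · simp at hj
    · exact hj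
  rw [himage, Finset.sum_image hinj.injOn, Fintype.sum_prod_type]
  simp [e]

lemma voterField_eq (ρ : ℝ) (hn : 3 ≤ n) (η : TorusConfig d n) :
    voterField ρ η = 2 / (ρ * (1 - ρ)) * ∑ x : Torus d n,
      ∑ k : Fin d, cen ρ (torusTranslate x η 0) * cen ρ (torusTranslate x η (unitVec ℤ k)) := by
  unfold voterField
  have h00 : ∀ x : Torus d n, x + toTorus n 0 = x := fun x => by
    have : toTorus n (0 : Fin d → ℤ) = 0 := by funext i; simp [toTorus]
    rw [this, add_zero]
  simp only [sum_neighbours hn, torusTranslate_apply, toTorus_unitVec, h00]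
  have : ∑ x : Torus d n, ∑ j, (cen ρ (η x) * cen ρ (η (x + unitVec (ZMod n) j)) +
      cen ρ (η x) * cen ρ (η (x - unitVec (ZMod n) j))) =
      2 * ∑ x : Torus d n, ∑ j, cen ρ (η x) * cen ρ (η (x + unitVec (ZMod n) j)) := by
    simp only [Finset.sum_add_distrib]
    have : ∑ x : Torus d n, ∑ j, cen ρ (η x) * cen ρ (η (x - unitVec (ZMod n) j)) =
        ∑ x : Torus d n, ∑ j, cen ρ (η x) * cen ρ (η (x + unitVec (ZMod n) j)) := by
      rw [Finset.sum_comm]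
      conv_rhs => rw [Finset.sum_comm]
      refine Finset.sum_congr rfl fun j _ => ?_
      rw [← Equiv.sum_comp (Equiv.addRight (unitVec (ZMod n) j))]
      refine Finset.sum_congr rfl fun x _ => ?_
      simp only [Equiv.coe_addRight, add_sub_cancel_right]
      ring
    rw [this]; ring
  rw [this]; ring

end Generator

/-- The voter field is absorbed by the Dirichlet form, up to the entropy. -/
lemma exists_voterField_bound {d : ℕ} (hd1 : 1 ≤ d) (hd3 : d ≤ 3) {ρ : ℝ} (h0 : 0 < ρ)
    (h1 : ρ < 1) {c₀ : ℝ} (hc0 : 0 < c₀) :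
    ∃ C : ℝ, 0 < C ∧ ∃ b : ℕ, ∀ (n : ℕ) [NeZero n] (a : ℝ) (L : ℕ), Scale d n a L b → 3 ≤ n →
    ∃ R : TorusConfig d n → ℝ, (∀ η, 0 ≤ R η) ∧
      (∀ u : TorusConfig d n → ℝ, a * ev ρ (fun η => voterField ρ η * u η ^ 2) ≤
          c₀ / 2 * (n : ℝ) ^ 2 * dirichlet ρ u + ev ρ (fun η => R η * u η ^ 2)) ∧
      ∀ f, IsDensity ρ f → ev ρ (fun η => f η * R η) ≤ C * a * (ent ρ f + errorTerm d n a L) := by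
  have hadm : Admissible ρ
      (fun η : Config d => ∑ k : Fin d, cen ρ (η 0) * cen ρ (η (unitVec ℤ k))) := by
    refine Admissible.sum h0 h1 _ fun k _ => ?_
    have hne : (0 : Fin d → ℤ) ≠ unitVec ℤ k := by
      unfold unitVec; rw [Ne, eq_comm, Pi.single_eq_zero_iff]; exact one_ne_zero
    have := admissible_prod hd1 hd3 h0 h1 (A := {0, unitVec ℤ k})
      (by rw [Finset.card_pair hne])
    simpa only [Finset.prod_pair hne] using this
  have hχ : 0 < ρ * (1 - ρ) := mul_pos h0 (by linarith)
  obtain ⟨C, hC, b, h⟩ := hadm (2 / (ρ * (1 - ρ))) (by positivity) (c₀ / 2) (by positivity)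
  refine ⟨C, hC, b, fun n _ a L hs hn => ?_⟩
  have ha : 0 ≤ a := zero_le_one.trans hs.one_le
  obtain ⟨R, r1, r2, r3⟩ := h n a L hs (fun _ => 2 / (ρ * (1 - ρ)) * a)
    (fun _ => by rw [abs_of_nonneg (by positivity)])
  refine ⟨R, r1, fun u => ?_, r3⟩
  refine le_trans (le_of_eq ?_) (r2 u)
  rw [← ev_const_mul]
  congr 1; funext η
  rw [voterField_eq ρ hn, ← Finset.mul_sum]
  ring

/-! ### Semigroups of Markov generators -/

section Semigroup

variable {S : Type} [Fintype S]

/-- `L` is the generator of a Markov chain with total jump rates at most `r`. -/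
structure IsGenerator (L : (S → ℝ) →ₗ[ℝ] (S → ℝ)) (r : ℝ) : Prop where
  map_one : L (fun _ => 1) = 0
  add_smul_nonneg : ∀ f : S → ℝ, (∀ ξ, 0 ≤ f ξ) → ∀ ξ, 0 ≤ L f ξ + r * f ξ

lemma semigroup_zero (L : (S → ℝ) →ₗ[ℝ] (S → ℝ)) (f : S → ℝ) : semigroup L 0 f = f := by
  simp [semigroup]

lemma hasDerivAt_semigroup (L : (S → ℝ) →ₗ[ℝ] (S → ℝ)) (t : ℝ) :
    HasDerivAt (fun s => semigroup L s)
      (semigroup L t * LinearMap.toContinuousLinearMap L) t :=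
  hasDerivAt_exp_smul_const (LinearMap.toContinuousLinearMap L) t

lemma hasDerivAt_semigroup_apply (L : (S → ℝ) →ₗ[ℝ] (S → ℝ)) (t : ℝ) (f : S → ℝ) (ξ : S) :
    HasDerivAt (fun s => semigroup L s f ξ) (semigroup L t (L f) ξ) t := by
  have h := (hasDerivAt_semigroup L t).clm_apply (hasDerivAt_const t f)
  have h2 := (hasDerivAt_pi.1 h) ξ
  simpa using h2

lemma semigroup_one {L : (S → ℝ) →ₗ[ℝ] (S → ℝ)} (hL : L (fun _ => 1) = 0) (t : ℝ) :
    semigroup L t (fun _ => 1) = fun _ => 1 := by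
  funext ξ
  have h : ∀ s, HasDerivAt (fun s => semigroup L s (fun _ => 1) ξ) 0 s := fun s => by
    have := hasDerivAt_semigroup_apply L s (fun _ => 1) ξ
    rwa [hL, map_zero] at this
  have := is_const_of_deriv_eq_zero (fun s => (h s).differentiableAt) (fun s => (h s).deriv) t 0
  rw [this, semigroup_zero]

/-- The semigroup is positive, with a lower bound on the holding probabilities. -/
lemma exp_mul_le_semigroup {L : (S → ℝ) →ₗ[ℝ] (S → ℝ)} {r : ℝ} (hL : IsGenerator L r) {t : ℝ}
    (ht : 0 ≤ t) {f : S → ℝ} (hf : ∀ ξ, 0 ≤ f ξ) (ξ : S) :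
    Real.exp (-(r * t)) * f ξ ≤ semigroup L t f ξ := by
  set A := LinearMap.toContinuousLinearMap L with hA
  set M : (S → ℝ) →L[ℝ] (S → ℝ) := A + algebraMap ℝ _ r with hM
  have hMf : ∀ g : S → ℝ, ∀ ξ, M g ξ = L g ξ + r * g ξ := by
    intro g ξ
    simp [hM, hA, Algebra.algebraMap_eq_smul_one]
  have hsplit : semigroup L t = Real.exp (-(r * t)) • NormedSpace.exp (t • M) := by
    have e : t • A = algebraMap ℝ ((S → ℝ) →L[ℝ] (S → ℝ)) (-(r * t)) + t • M := by
      rw [hM, smul_add, Algebra.algebraMap_eq_smul_one, Algebra.algebraMap_eq_smul_one, smul_smul]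
      rw [neg_smul, mul_comm t r]; abel
    unfold semigroup
    let +nondep : NormedAlgebra ℚ ((S → ℝ) →L[ℝ] (S → ℝ)) := NormedAlgebra.restrictScalars ℚ ℝ _
    rw [← hA, e, NormedSpace.exp_add_of_commute (Algebra.commutes _ _),
      ← NormedSpace.algebraMap_exp_comm, ← Real.exp_eq_exp_ℝ, Algebra.algebraMap_eq_smul_one,
      smul_mul_assoc, one_mul]
  have hpow : ∀ k : ℕ, ∀ ξ, 0 ≤ ((M ^ k) f) ξ := by
    intro k
    induction k with
    | zero => simpa using hf
    | succ k ih =>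
      intro ξ
      rw [pow_succ', mul_apply_eq_comp, hMf]
      exact hL.add_smul_nonneg _ ih ξ
  have hsum : HasSum (fun k : ℕ => ((k.factorial : ℝ)⁻¹ • (t • M) ^ k) f ξ)
      (NormedSpace.exp (t • M) f ξ) := by
    have h := NormedSpace.exp_series_hasSum_exp' (𝕂 := ℝ) (t • M)
    have h2 := ((ContinuousLinearMap.proj (R := ℝ) (φ := fun _ : S => ℝ) ξ).comp
      (ContinuousLinearMap.apply ℝ (S → ℝ) f)).hasSum h
    simpa using h2
  have hle : f ξ ≤ NormedSpace.exp (t • M) f ξ := by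
    have h0 := le_hasSum hsum 0 fun k _ => by
      rw [smul_pow, smul_smul]
      simp only [smul_apply, Pi.smul_apply, smul_eq_mul]
      exact mul_nonneg (by positivity) (hpow k ξ)
    simpa using h0
  rw [hsplit]
  simp only [smul_apply, Pi.smul_apply, smul_eq_mul]
  exact mul_le_mul_of_nonneg_left hle (Real.exp_pos _).le

lemma semigroup_nonneg {L : (S → ℝ) →ₗ[ℝ] (S → ℝ)} {r : ℝ} (hL : IsGenerator L r) {t : ℝ}
    (ht : 0 ≤ t) {f : S → ℝ} (hf : ∀ ξ, 0 ≤ f ξ) (ξ : S) : 0 ≤ semigroup L t f ξ :=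
  (mul_nonneg (Real.exp_pos _).le (hf ξ)).trans (exp_mul_le_semigroup hL ht hf ξ)

variable [DecidableEq S]

lemma apply_eq_sum_single (A : (S → ℝ) →ₗ[ℝ] (S → ℝ)) (f : S → ℝ) (ξ : S) :
    A f ξ = ∑ ζ, f ζ * A (Pi.single ζ 1) ξ := by
  have e : f = ∑ ζ, f ζ • (Pi.single ζ 1 : S → ℝ) := by
    funext ζ
    simp [Finset.sum_apply, Pi.single_apply]
  conv_lhs => rw [e]
  rw [map_sum, Finset.sum_apply]
  simp

lemma semigroup_eq_sum (L : (S → ℝ) →ₗ[ℝ] (S → ℝ)) (t : ℝ) (f : S → ℝ) (ξ : S) :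
    semigroup L t f ξ = ∑ ζ, transition L t ξ ζ * f ζ := by
  have := apply_eq_sum_single (semigroup L t).toLinearMap f ξ
  simp only [ContinuousLinearMap.coe_coe] at this
  rw [this]
  exact Finset.sum_congr rfl fun ζ _ => mul_comm _ _

lemma transition_nonneg {L : (S → ℝ) →ₗ[ℝ] (S → ℝ)} {r : ℝ} (hL : IsGenerator L r) {t : ℝ}
    (ht : 0 ≤ t) (ξ ζ : S) : 0 ≤ transition L t ξ ζ :=
  semigroup_nonneg hL ht (fun z => by rw [Pi.single_apply]; split_ifs <;> norm_num) ξ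

lemma transition_self_pos {L : (S → ℝ) →ₗ[ℝ] (S → ℝ)} {r : ℝ} (hL : IsGenerator L r) {t : ℝ}
    (ht : 0 ≤ t) (ξ : S) : 0 < transition L t ξ ξ := by
  have := exp_mul_le_semigroup hL ht (f := Pi.single ξ 1)
    (fun z => by rw [Pi.single_apply]; split_ifs <;> norm_num) ξ
  rw [Pi.single_eq_same, mul_one] at this
  exact (Real.exp_pos _).trans_le this

end Semigroup

/-! ### Evolution of the entropy -/

section EntropyEvolution

variable {V : Type} [Fintype V] [DecidableEq V]

/-- The density at time `t` of the chain with generator `L` started from the density `f`. -/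
def density (ρ : ℝ) (L : ((V → Bool) → ℝ) →ₗ[ℝ] ((V → Bool) → ℝ)) (f : (V → Bool) → ℝ) (t : ℝ)
    (ζ : V → Bool) : ℝ :=
  (∑ ξ, weight ρ ξ * f ξ * transition L t ξ ζ) / weight ρ ζ

variable {ρ : ℝ} {L : ((V → Bool) → ℝ) →ₗ[ℝ] ((V → Bool) → ℝ)}

lemma weight_mul_density (h0 : 0 < ρ) (h1 : ρ < 1) (f : (V → Bool) → ℝ) (t : ℝ)
    (ζ : V → Bool) :
    weight ρ ζ * density ρ L f t ζ = ∑ ξ, weight ρ ξ * f ξ * transition L t ξ ζ :=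
  mul_div_cancel₀ _ (weight_pos h0 h1 ζ).ne'

lemma ev_density_mul (h0 : 0 < ρ) (h1 : ρ < 1) (f φ : (V → Bool) → ℝ) (t : ℝ) :
    ev ρ (fun η => density ρ L f t η * φ η) = ev ρ (fun η => f η * semigroup L t φ η) := by
  unfold ev
  simp only [← mul_assoc, weight_mul_density h0 h1, Finset.sum_mul, semigroup_eq_sum,
    Finset.mul_sum]
  exact Finset.sum_comm

lemma isDensity_density (h0 : 0 < ρ) (h1 : ρ < 1) {r : ℝ} (hL : IsGenerator L r)
    {f : (V → Bool) → ℝ} (hf : IsDensity ρ f) {t : ℝ} (ht : 0 ≤ t) :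
    IsDensity ρ (density ρ L f t) where
  nonneg ζ := div_nonneg (Finset.sum_nonneg fun ξ _ => mul_nonneg
    (mul_nonneg (weight_pos h0 h1 ξ).le (hf.nonneg ξ)) (transition_nonneg hL ht ξ ζ))
    (weight_pos h0 h1 ζ).le
  ev_eq_one := by
    have := ev_density_mul (L := L) h0 h1 f (fun _ => 1) t
    rw [semigroup_one hL.map_one] at this
    simpa [hf.ev_eq_one] using this

lemma density_pos (h0 : 0 < ρ) (h1 : ρ < 1) {r : ℝ} (hL : IsGenerator L r)
    {f : (V → Bool) → ℝ} (hf : ∀ ξ, 0 < f ξ) {t : ℝ} (ht : 0 ≤ t) (ζ : V → Bool) :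
    0 < density ρ L f t ζ := by
  refine div_pos ?_ (weight_pos h0 h1 ζ)
  refine Finset.sum_pos' (fun ξ _ => mul_nonneg (mul_nonneg (weight_pos h0 h1 ξ).le (hf ξ).le)
    (transition_nonneg hL ht ξ ζ)) ⟨ζ, Finset.mem_univ _, ?_⟩
  exact mul_pos (mul_pos (weight_pos h0 h1 ζ) (hf ζ)) (transition_self_pos hL ht ζ)

lemma density_zero (h0 : 0 < ρ) (h1 : ρ < 1) (f : (V → Bool) → ℝ) : density ρ L f 0 = f := by
  funext ζ
  unfold density transition
  simp only [semigroup_zero, Pi.single_apply]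
  simp [(weight_pos h0 h1 ζ).ne']

lemma hasDerivAt_density (f : (V → Bool) → ℝ) (t : ℝ) (ζ : V → Bool) :
    HasDerivAt (fun s => density ρ L f s ζ)
      ((∑ ξ, weight ρ ξ * f ξ * semigroup L t (L (Pi.single ζ 1)) ξ) / weight ρ ζ) t := by
  unfold density transition
  exact (HasDerivAt.fun_sum fun ξ _ =>
    (hasDerivAt_semigroup_apply L t (Pi.single ζ 1) ξ).const_mul _).div_const _

/-- The entropy production. -/
lemma hasDerivAt_ent_density (h0 : 0 < ρ) (h1 : ρ < 1) {r : ℝ} (hL : IsGenerator L r)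
    {f : (V → Bool) → ℝ} (hf : ∀ ξ, 0 < f ξ) {t : ℝ} (ht : 0 ≤ t) :
    HasDerivAt (fun s => ent ρ (density ρ L f s))
      (ev ρ fun η => density ρ L f t η * L (fun ζ => Real.log (density ρ L f t ζ)) η) t := by
  have h : HasDerivAt (fun s => ent ρ (density ρ L f s))
      (∑ ζ, weight ρ ζ * (Real.log (density ρ L f t ζ) *
        ((∑ ξ, weight ρ ξ * f ξ * semigroup L t (L (Pi.single ζ 1)) ξ) / weight ρ ζ))) t := by
    unfold ent ev
    refine HasDerivAt.fun_sum fun ζ _ => HasDerivAt.const_mul _ ?_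
    exact (InformationTheory.hasDerivAt_klFun (density_pos h0 h1 hL hf ht ζ).ne').comp t
      (hasDerivAt_density f t ζ)
  refine h.congr_deriv ?_
  rw [ev_density_mul h0 h1]
  set l := fun ζ => Real.log (density ρ L f t ζ) with hl
  have e : ∀ ξ, semigroup L t (L l) ξ =
      ∑ ζ, l ζ * semigroup L t (L (Pi.single ζ 1)) ξ := fun ξ =>
    apply_eq_sum_single ((semigroup L t).toLinearMap.comp L) l ξ
  unfold ev
  simp only [e, Finset.mul_sum]
  rw [Finset.sum_comm]
  refine Finset.sum_congr rfl fun ζ _ => ?_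
  have hw := (weight_pos h0 h1 ζ).ne'
  rw [mul_comm (l ζ), div_mul_eq_mul_div, mul_div_cancel₀ _ hw, Finset.sum_mul]
  exact Finset.sum_congr rfl fun ξ _ => by ring

lemma ent_density_le_of_pos (h0 : 0 < ρ) (h1 : ρ < 1) {r : ℝ} (hL : IsGenerator L r)
    {K κ : ℝ}
    (hprod : ∀ g : (V → Bool) → ℝ, IsDensity ρ g → (∀ η, 0 < g η) →
      ev ρ (fun η => g η * L (fun ζ => Real.log (g ζ)) η) ≤ K * (ent ρ g + κ))
    {f : (V → Bool) → ℝ} (hf : IsDensity ρ f) (hpos : ∀ ξ, 0 < f ξ) {t : ℝ} (ht : 0 ≤ t) :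
    ent ρ (density ρ L f t) + κ ≤ Real.exp (K * t) * (ent ρ f + κ) := by
  set g : ℝ → ℝ := fun s => Real.exp (-(K * s)) * (ent ρ (density ρ L f s) + κ) with hg
  have hder : ∀ s, 0 ≤ s → HasDerivAt g
      (Real.exp (-(K * s)) * -K * (ent ρ (density ρ L f s) + κ) + Real.exp (-(K * s)) *
        ev ρ fun η => density ρ L f s η * L (fun ζ => Real.log (density ρ L f s ζ)) η) s := by
    intro s hs
    have e1 : HasDerivAt (fun s => Real.exp (-(K * s))) (Real.exp (-(K * s)) * -K) s := by
      have := (((hasDerivAt_id s).const_mul K).neg).exp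
      simpa using this
    exact e1.mul ((hasDerivAt_ent_density h0 h1 hL hpos hs).add_const κ)
  have hanti : AntitoneOn g (Set.Ici 0) := by
    refine antitoneOn_of_deriv_nonpos (convex_Ici 0)
      (fun s hs => (hder s hs).continuousAt.continuousWithinAt) (fun s hs => ?_) fun s hs => ?_
    · rw [interior_Ici] at hs
      exact (hder s (le_of_lt hs)).differentiableAt.differentiableWithinAt
    · rw [interior_Ici] at hs
      have hs' : 0 ≤ s := le_of_lt hs
      rw [(hder s hs').deriv]
      have := hprod _ (isDensity_density h0 h1 hL hf hs') (density_pos h0 h1 hL hpos hs')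
      have := mul_le_mul_of_nonneg_left this (Real.exp_pos (-(K * s))).le
      linarith
  have h := hanti Set.self_mem_Ici ht ht
  simp only [hg, mul_zero, neg_zero, Real.exp_zero, one_mul, density_zero h0 h1] at h
  have h2 := mul_le_mul_of_nonneg_left h (Real.exp_pos (K * t)).le
  rwa [← mul_assoc, ← Real.exp_add, add_neg_cancel, Real.exp_zero, one_mul] at h2

/-- Gronwall's inequality for the entropy. -/
lemma ent_density_le (h0 : 0 < ρ) (h1 : ρ < 1) {r : ℝ} (hL : IsGenerator L r) {K κ : ℝ}
    (hprod : ∀ g : (V → Bool) → ℝ, IsDensity ρ g → (∀ η, 0 < g η) →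
      ev ρ (fun η => g η * L (fun ζ => Real.log (g ζ)) η) ≤ K * (ent ρ g + κ))
    {f : (V → Bool) → ℝ} (hf : IsDensity ρ f) {t : ℝ} (ht : 0 ≤ t) :
    ent ρ (density ρ L f t) + κ ≤ Real.exp (K * t) * (ent ρ f + κ) := by
  -- a density which may vanish is mixed with the constant density `1`
  let F : ℝ → (V → Bool) → ℝ := fun ε η => f η + ε * (1 - f η)
  have hFd : ∀ ε ζ, density ρ L (F ε) t ζ =
      density ρ L f t ζ + ε * (density ρ L (fun _ => 1) t ζ - density ρ L f t ζ) := by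
    intro ε ζ
    unfold density
    rw [← sub_div, ← mul_div_assoc, ← add_div, ← Finset.sum_sub_distrib, Finset.mul_sum,
      ← Finset.sum_add_distrib]
    congr 1
    exact Finset.sum_congr rfl fun ξ _ => by simp only [F]; ring
  have hcont : ∀ g g' : (V → Bool) → ℝ,
      Tendsto (fun ε : ℝ => ent ρ (fun η => g η + ε * g' η)) (𝓝[>] 0) (𝓝 (ent ρ g)) := by
    intro g g'
    have : Continuous fun ε : ℝ => ent ρ (fun η => g η + ε * g' η) := by
      unfold ent ev
      have := InformationTheory.continuous_klFun
      fun_prop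
    have h := this.tendsto 0
    simp only [zero_mul, add_zero] at h
    exact h.mono_left nhdsWithin_le_nhds
  have hl := (hcont (density ρ L f t)
    (fun ζ => density ρ L (fun _ => 1) t ζ - density ρ L f t ζ)).add_const κ
  have hr := ((hcont f (fun η => 1 - f η)).add_const κ).const_mul (Real.exp (K * t))
  refine le_of_tendsto_of_tendsto hl hr ?_
  filter_upwards [Ioo_mem_nhdsGT (zero_lt_one (α := ℝ))] with ε hε
  have hFpos : ∀ η, 0 < F ε η := fun η => by
    have : F ε η = (1 - ε) * f η + ε := by simp only [F]; ring
    rw [this]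
    have := mul_nonneg (sub_nonneg.2 hε.2.le) (hf.nonneg η)
    linarith [hε.1]
  have hFden : IsDensity ρ (F ε) := ⟨fun η => (hFpos η).le, by
    simp only [F]
    rw [ev_add, ev_const_mul, ev_sub, ev_const, hf.ev_eq_one]; ring⟩
  have := ent_density_le_of_pos h0 h1 hL hprod hFden hFpos ht
  simpa only [funext (hFd ε)] using this

end EntropyEvolution

/-- The generator of the voter model with stirring is a Markov generator. -/
lemma exists_isGenerator_gen {d n : ℕ} [NeZero n] {c : Fin d → Config d → ℝ}
    (hc : ∀ j η, 0 ≤ c j η) {a : ℝ} (ha : 0 ≤ a) : ∃ r, IsGenerator (gen c a n) r := by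
  -- the total jump rate at `η`
  let q : TorusConfig d n → ℝ := fun η => (n : ℝ) ^ 2 * (∑ x : Torus d n, ∑ j : Fin d,
    c j (torusTranslate x η)) + a * ∑ x : Torus d n, ∑ y ∈ neighbours x,
      (occ (η y) - occ (η x)) ^ 2
  have hq : ∀ η, 0 ≤ q η := fun η => by
    have h1 : 0 ≤ ∑ x : Torus d n, ∑ j : Fin d, c j (torusTranslate x η) :=
      Finset.sum_nonneg fun _ _ => Finset.sum_nonneg fun _ _ => hc _ _
    have h2 : 0 ≤ ∑ x : Torus d n, ∑ y ∈ neighbours x, (occ (η y) - occ (η x)) ^ 2 :=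
      Finset.sum_nonneg fun _ _ => Finset.sum_nonneg fun _ _ => sq_nonneg _
    positivity
  refine ⟨∑ η, q η, ?_, fun f hf η => ?_⟩
  · funext η
    rw [gen_apply, exclusionGen_apply, voterGen_apply]
    simp
  · have hqle : q η ≤ ∑ η, q η := Finset.single_le_sum (fun η _ => hq η) (Finset.mem_univ η)
    have h1 : 0 ≤ (n : ℝ) ^ 2 * (∑ x : Torus d n, ∑ j : Fin d, c j (torusTranslate x η) *
        f (exchange x (x + unitVec (ZMod n) j) η)) := mul_nonneg (sq_nonneg _)
      (Finset.sum_nonneg fun _ _ => Finset.sum_nonneg fun _ _ => mul_nonneg (hc _ _) (hf _))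
    have h2 : 0 ≤ a * ∑ x : Torus d n, ∑ y ∈ neighbours x,
        (occ (η y) - occ (η x)) ^ 2 * f (flipAt x η) := mul_nonneg ha
      (Finset.sum_nonneg fun _ _ => Finset.sum_nonneg fun _ _ =>
        mul_nonneg (sq_nonneg _) (hf _))
    have e : gen c a n f η + q η * f η = (n : ℝ) ^ 2 * (∑ x : Torus d n, ∑ j : Fin d,
        c j (torusTranslate x η) * f (exchange x (x + unitVec (ZMod n) j) η)) +
        a * ∑ x : Torus d n, ∑ y ∈ neighbours x,
          (occ (η y) - occ (η x)) ^ 2 * f (flipAt x η) := by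
      rw [gen_apply, exclusionGen_apply, voterGen_apply]
      simp only [q, mul_sub, Finset.sum_sub_distrib, ← Finset.sum_mul]
      ring
    have := mul_le_mul_of_nonneg_right hqle (hf η)
    linarith

/-! ### Sums over discrete paths -/

section PathSum

variable {S : Type} [Fintype S]

/-- Sums over discrete paths are iterated kernel operators: a property preserved by each of the
kernels is inherited by the function obtained by summing over all path steps. -/
lemma exists_path_sum (Q : ℕ → (S → ℝ) → Prop) (hQ : Q 0 fun _ => 1) (N : ℕ)
    (k : Fin N → S → S → ℝ)
    (hstep : ∀ i j v, Q j v → Q (j + 1) fun x => ∑ y, k i x y * v y) :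
    ∃ v, Q N v ∧ ∀ x, ∑ ξ : Fin N → S,
      ∏ i : Fin N, k i ((Fin.cons x ξ : Fin (N + 1) → S) i.castSucc)
        ((Fin.cons x ξ : Fin (N + 1) → S) i.succ) = v x := by
  induction N with
  | zero => exact ⟨_, hQ, fun x => by simp⟩
  | succ N ih =>
    obtain ⟨v, hv, hsum⟩ := ih (fun i => k i.succ) fun i j v => hstep i.succ j v
    refine ⟨_, hstep 0 N v hv, fun x => ?_⟩
    rw [← (Fin.consEquiv fun _ : Fin (N + 1) => S).sum_comp, Fintype.sum_prod_type]
    refine Finset.sum_congr rfl fun y _ => ?_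
    rw [← hsum y, Finset.mul_sum]
    refine Finset.sum_congr rfl fun ξ _ => ?_
    rw [Fin.prod_univ_succ]
    simp [Fin.consEquiv]

lemma sum_path_eq (N : ℕ) (F : (Fin (N + 1) → S) → ℝ) :
    ∑ ξ, F ξ = ∑ x, ∑ ξ : Fin N → S, F (Fin.cons x ξ) := by
  rw [← (Fin.consEquiv fun _ : Fin (N + 1) => S).sum_comp, Fintype.sum_prod_type]
  rfl

variable [DecidableEq S]

/-- The probability of the steps of a discrete path of the chain observed at times `δ i`. -/
def pathProb (L : (S → ℝ) →ₗ[ℝ] (S → ℝ)) (δ : ℝ) {N : ℕ} (ξ : Fin (N + 1) → S) : ℝ :=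
  ∏ i : Fin N, transition L δ (ξ i.castSucc) (ξ i.succ)

lemma pathProb_nonneg {L : (S → ℝ) →ₗ[ℝ] (S → ℝ)} {r : ℝ} (hL : IsGenerator L r) {δ : ℝ}
    (hδ : 0 ≤ δ) {N : ℕ} (ξ : Fin (N + 1) → S) : 0 ≤ pathProb L δ ξ :=
  Finset.prod_nonneg fun _ _ => transition_nonneg hL hδ _ _

lemma sum_mul_pathProb {L : (S → ℝ) →ₗ[ℝ] (S → ℝ)} {r : ℝ} (hL : IsGenerator L r) (δ : ℝ)
    (N : ℕ) (m : S → ℝ) :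
    ∑ ξ : Fin (N + 1) → S, m (ξ 0) * pathProb L δ ξ = ∑ x, m x := by
  obtain ⟨v, hv, hsum⟩ := exists_path_sum (fun _ v => v = fun _ => 1) rfl N
    (fun _ => transition L δ) fun i j v hv => by
      funext x
      rw [← semigroup_eq_sum, hv, semigroup_one hL.map_one]
  rw [sum_path_eq]
  refine Finset.sum_congr rfl fun x _ => ?_
  simp only [Fin.cons_zero]
  rw [← Finset.mul_sum]
  unfold pathProb
  rw [hsum x, hv, mul_one]

end PathSum

/-! ### The discrete Feynman-Kac and Gibbs inequalities -/

section FeynmanKac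

variable {V : Type} [Fintype V] [DecidableEq V]
variable {ρ : ℝ} {L : ((V → Bool) → ℝ) →ₗ[ℝ] ((V → Bool) → ℝ)}

lemma ev_sq_le_norm_sq (h0 : 0 < ρ) (h1 : ρ < 1) (u : (V → Bool) → ℝ) :
    ev ρ (fun η => u η ^ 2) ≤ ‖u‖ ^ 2 := by
  rw [← ev_const (V := V) ρ (‖u‖ ^ 2)]
  refine ev_mono h0 h1 fun η => ?_
  exact sq_le_sq.2 ((norm_le_pi_norm u η).trans (le_abs_self _))

lemma ev_mul_le_norm_mul (h0 : 0 < ρ) (h1 : ρ < 1) (u v : (V → Bool) → ℝ) :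
    ev ρ (fun η => u η * v η) ≤ ‖u‖ * ‖v‖ := by
  rw [← ev_const (V := V) ρ (‖u‖ * ‖v‖)]
  refine ev_mono h0 h1 fun η => ?_
  refine (le_abs_self _).trans ?_
  rw [abs_mul]
  exact mul_le_mul (norm_le_pi_norm u η) (norm_le_pi_norm v η) (abs_nonneg _) (norm_nonneg _)

lemma exists_norm_sq_le_ev (h0 : 0 < ρ) (h1 : ρ < 1) :
    ∃ κ : ℝ, 0 < κ ∧ ∀ u : (V → Bool) → ℝ, ‖u‖ ^ 2 ≤ κ * ev ρ (fun η => u η ^ 2) := by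
  refine ⟨∑ η : V → Bool, 1 / weight ρ η,
    Finset.sum_pos (fun η _ => one_div_pos.2 (weight_pos h0 h1 η)) Finset.univ_nonempty,
    fun u => ?_⟩
  have hev : 0 ≤ ev ρ (fun η => u η ^ 2) := ev_nonneg h0 h1 fun η => sq_nonneg _
  have hκ : 0 ≤ ∑ η : V → Bool, 1 / weight ρ η :=
    Finset.sum_nonneg fun η _ => (one_div_pos.2 (weight_pos h0 h1 η)).le
  rw [← Real.le_sqrt (norm_nonneg _) (mul_nonneg hκ hev),
    pi_norm_le_iff_of_nonneg (Real.sqrt_nonneg _)]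
  refine fun η => Real.abs_le_sqrt ?_
  have hw := weight_pos h0 h1 η
  have b1 : weight ρ η * u η ^ 2 ≤ ev ρ (fun η => u η ^ 2) :=
    Finset.single_le_sum (f := fun η => weight ρ η * u η ^ 2)
      (fun η _ => mul_nonneg (weight_pos h0 h1 η).le (sq_nonneg _)) (Finset.mem_univ η)
  have b2 : 1 / weight ρ η ≤ ∑ η : V → Bool, 1 / weight ρ η :=
    Finset.single_le_sum (f := fun η => 1 / weight ρ η)
      (fun η _ => (one_div_pos.2 (weight_pos h0 h1 η)).le) (Finset.mem_univ η)
  calc u η ^ 2 = 1 / weight ρ η * (weight ρ η * u η ^ 2) := by field_simp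
    _ ≤ _ := mul_le_mul b2 b1 (mul_nonneg hw.le (sq_nonneg _)) hκ

/-- One step of the discrete Feynman-Kac inequality: if `U + L` is dissipative in `L²`, then
`e^{δL} e^{δU}` almost contracts `L²` for small `δ`, uniformly over bounded `U`. -/
lemma eventually_ev_semigroup_exp_sq_le (h0 : 0 < ρ) (h1 : ρ < 1) {c ε : ℝ} (hc : 0 ≤ c)
    (hε : 0 < ε) :
    ∀ᶠ δ in 𝓝[>] (0 : ℝ), ∀ U : (V → Bool) → ℝ, (∀ η, |U η| ≤ c) →
      (∀ u : (V → Bool) → ℝ,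
        ev ρ (fun η => U η * u η ^ 2) + ev ρ (fun η => u η * L u η) ≤ 0) →
      ∀ u : (V → Bool) → ℝ,
        ev ρ (fun η => semigroup L δ (fun ζ => Real.exp (δ * U ζ) * u ζ) η ^ 2) ≤
          (1 + ε * δ) * ev ρ (fun η => u η ^ 2) := by
  obtain ⟨κ, hκ, hnorm⟩ := exists_norm_sq_le_ev (V := V) h0 h1
  set A := LinearMap.toContinuousLinearMap L with hA
  set e := ε / (9 * κ) with he
  have he0 : 0 < e := by positivity
  have hder : ∀ᶠ δ in 𝓝[>] (0 : ℝ), ‖semigroup L δ - 1 - δ • A‖ ≤ e * δ := by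
    have h := (hasDerivAt_semigroup L 0).isLittleO
    have h2 := (h.def he0).filter_mono (nhdsWithin_le_nhds (s := Set.Ioi 0))
    filter_upwards [h2, self_mem_nhdsWithin] with δ hδ hδ0
    have e1 : semigroup L 0 = 1 := by simp [semigroup]
    rw [e1] at hδ
    simpa [abs_of_pos (Set.mem_Ioi.1 hδ0)] using hδ
  have hsmall : ∀ b : ℝ, 0 < b → ∀ M : ℝ, ∀ᶠ δ in 𝓝[>] (0 : ℝ), δ * M ≤ b := by
    intro b hb M
    have : Tendsto (fun δ : ℝ => δ * M) (𝓝[>] 0) (𝓝 0) := by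
      have : Tendsto (fun δ : ℝ => δ * M) (𝓝 0) (𝓝 (0 * M)) := tendsto_id.mul_const M
      rw [zero_mul] at this
      exact this.mono_left nhdsWithin_le_nhds
    exact this.eventually_le_const hb
  filter_upwards [hder, hsmall 1 one_pos c, hsmall e he0 (c ^ 2 + 2 * c * ‖A‖),
    hsmall e he0 ((‖A‖ + c + 4 * e) ^ 2), self_mem_nhdsWithin] with δ hd hδc hδ1 hδ2 hδ0
  have hδ : 0 < δ := hδ0
  intro U hU hdis u
  have hδU : ∀ η, |δ * U η| ≤ δ * c := fun η => by
    rw [abs_mul, abs_of_pos hδ]; exact mul_le_mul_of_nonneg_left (hU η) hδ.le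
  set w : (V → Bool) → ℝ := fun ζ => Real.exp (δ * U ζ) * u ζ with hw
  set Au : (V → Bool) → ℝ := fun η => L u η + U η * u η with hAu
  -- the remainder of the first order expansion
  set E1 := (semigroup L δ - 1 - δ • A) w with hE1
  set E2 : (V → Bool) → ℝ := fun η => (Real.exp (δ * U η) - 1 - δ * U η) * u η with hE2
  set w' : (V → Bool) → ℝ := fun η => (Real.exp (δ * U η) - 1) * u η with hw'
  have hexp : semigroup L δ w = u + (δ • Au + (E1 + E2 + δ • A w')) := by
    have : w' = w - u := by funext η; simp only [hw', hw, Pi.sub_apply]; ring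
    have hAv : ∀ v, A v = L v := fun v => rfl
    rw [this, map_sub]
    funext η
    simp only [hE1, hE2, hAu, hw, hAv, sub_apply, smul_apply, Pi.add_apply, Pi.sub_apply,
      Pi.smul_apply, smul_eq_mul, one_apply_eq_self]
    ring
  have hpt : ∀ (v : (V → Bool) → ℝ) (b : ℝ), 0 ≤ b → (∀ η, |v η| ≤ b * |u η|) →
      ‖v‖ ≤ b * ‖u‖ := by
    intro v b hb hv
    refine (pi_norm_le_iff_of_nonneg (by positivity)).2 fun η => ?_
    exact (hv η).trans (mul_le_mul_of_nonneg_left (norm_le_pi_norm u η) hb)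
  have hwn : ‖w‖ ≤ 3 * ‖u‖ := hpt w 3 (by norm_num) fun η => by
    rw [hw, abs_mul, abs_of_pos (Real.exp_pos _)]
    refine mul_le_mul_of_nonneg_right ?_ (abs_nonneg _)
    calc Real.exp (δ * U η) ≤ Real.exp 1 :=
          Real.exp_le_exp.2 ((le_abs_self _).trans ((hδU η).trans hδc))
      _ ≤ 3 := Real.exp_one_lt_three.le
  have hE1n : ‖E1‖ ≤ e * δ * (3 * ‖u‖) := ((semigroup L δ - 1 - δ • A).le_opNorm w).trans
    (mul_le_mul hd hwn (norm_nonneg _) (by positivity))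
  have hE2n : ‖E2‖ ≤ (δ * c) ^ 2 * ‖u‖ := hpt E2 _ (sq_nonneg _) fun η => by
    rw [hE2, abs_mul]
    refine mul_le_mul_of_nonneg_right ?_ (abs_nonneg _)
    refine (Real.abs_exp_sub_one_sub_id_le ((hδU η).trans hδc)).trans ?_
    rw [← sq_abs]
    exact pow_le_pow_left₀ (abs_nonneg _) (hδU η) 2
  have hw'n : ‖w'‖ ≤ 2 * (δ * c) * ‖u‖ := hpt w' _ (by positivity) fun η => by
    rw [hw', abs_mul]
    refine mul_le_mul_of_nonneg_right ?_ (abs_nonneg _)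
    refine (Real.abs_exp_sub_one_le ((hδU η).trans hδc)).trans ?_
    exact mul_le_mul_of_nonneg_left (hδU η) (by norm_num)
  set E := E1 + E2 + δ • A w' with hE
  have hEn : ‖E‖ ≤ 4 * e * δ * ‖u‖ := by
    have e3 : ‖δ • A w'‖ ≤ δ * (‖A‖ * (2 * (δ * c) * ‖u‖)) := by
      rw [norm_smul, Real.norm_of_nonneg hδ.le]
      exact mul_le_mul_of_nonneg_left ((A.le_opNorm _).trans
        (mul_le_mul_of_nonneg_left hw'n (norm_nonneg _))) hδ.le
    calc ‖E‖ ≤ ‖E1‖ + ‖E2‖ + ‖δ • A w'‖ := norm_add₃_le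
      _ ≤ e * δ * (3 * ‖u‖) + (δ * c) ^ 2 * ‖u‖ + δ * (‖A‖ * (2 * (δ * c) * ‖u‖)) := by gcongr
      _ = (3 * e + δ * (c ^ 2 + 2 * c * ‖A‖)) * (δ * ‖u‖) := by ring
      _ ≤ (3 * e + e) * (δ * ‖u‖) := by gcongr
      _ = _ := by ring
  have hAun : ‖Au‖ ≤ (‖A‖ + c) * ‖u‖ := by
    have e1 : Au = A u + fun η => U η * u η := rfl
    have e2 : ‖fun η => U η * u η‖ ≤ c * ‖u‖ := hpt _ c hc fun η => by
      rw [abs_mul]; exact mul_le_mul_of_nonneg_right (hU η) (abs_nonneg _)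
    rw [e1, add_mul]
    exact (norm_add_le _ _).trans (add_le_add (A.le_opNorm u) e2)
  have hFn : ‖δ • Au + E‖ ≤ δ * (‖A‖ + c + 4 * e) * ‖u‖ := by
    calc ‖δ • Au + E‖ ≤ δ * ((‖A‖ + c) * ‖u‖) + 4 * e * δ * ‖u‖ := by
          refine (norm_add_le _ _).trans (add_le_add ?_ hEn)
          rw [norm_smul, Real.norm_of_nonneg hδ.le]
          exact mul_le_mul_of_nonneg_left hAun hδ.le
      _ = _ := by ring
  have hAu0 : ev ρ (fun η => u η * Au η) ≤ 0 := by
    have := hdis u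
    rw [← ev_add] at this
    refine le_of_eq_of_le ?_ this
    congr 1; funext η; simp only [hAu]; ring
  have hfinal : ev ρ (fun η => semigroup L δ w η ^ 2) =
      ev ρ (fun η => u η ^ 2) + (2 * δ * ev ρ (fun η => u η * Au η) +
        2 * ev ρ (fun η => u η * E η) + ev ρ (fun η => (δ • Au + E) η ^ 2)) := by
    rw [hexp, ← ev_const_mul, ← ev_const_mul, ← ev_add, ← ev_add, ← ev_add]
    congr 1; funext η
    simp only [Pi.add_apply, Pi.smul_apply, smul_eq_mul]; ring
  rw [hfinal]
  have b1 := ev_mul_le_norm_mul h0 h1 u E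
  have b2 := ev_sq_le_norm_sq h0 h1 (δ • Au + E)
  have b3 : ‖u‖ * ‖E‖ ≤ 4 * e * δ * ‖u‖ ^ 2 := by
    have := mul_le_mul_of_nonneg_left hEn (norm_nonneg u)
    linarith [this]
  have b4 : ‖δ • Au + E‖ ^ 2 ≤ e * δ * ‖u‖ ^ 2 := by
    calc ‖δ • Au + E‖ ^ 2 ≤ (δ * (‖A‖ + c + 4 * e) * ‖u‖) ^ 2 :=
          pow_le_pow_left₀ (norm_nonneg _) hFn 2
      _ = (δ * (‖A‖ + c + 4 * e) ^ 2) * (δ * ‖u‖ ^ 2) := by ring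
      _ ≤ e * (δ * ‖u‖ ^ 2) := by gcongr
      _ = _ := by ring
  have b5 : 9 * e * δ * ‖u‖ ^ 2 ≤ ε * δ * ev ρ (fun η => u η ^ 2) := by
    calc 9 * e * δ * ‖u‖ ^ 2 ≤ 9 * e * δ * (κ * ev ρ (fun η => u η ^ 2)) := by
          have := hnorm u
          gcongr
      _ = _ := by rw [he]; field_simp
  have b6 : δ * ev ρ (fun η => u η * Au η) ≤ 0 := mul_nonpos_of_nonneg_of_nonpos hδ.le hAu0
  nlinarith

/-- The discrete Feynman-Kac inequality: if every `U i + L` is dissipative in `L²`, the exponential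
moment of the Riemann sum of the `U i` along the chain started from the Bernoulli weights is
bounded uniformly in the mesh. -/
lemma eventually_path_exp_le (h0 : 0 < ρ) (h1 : ρ < 1) {c t : ℝ} (hc : 0 ≤ c) (ht : 0 < t) :
    ∀ᶠ N : ℕ in atTop, ∀ U : Fin N → (V → Bool) → ℝ, (∀ i η, |U i η| ≤ c) →
      (∀ i, ∀ u : (V → Bool) → ℝ,
        ev ρ (fun η => U i η * u η ^ 2) + ev ρ (fun η => u η * L u η) ≤ 0) →
      ∑ ξ : Fin (N + 1) → V → Bool, weight ρ (ξ 0) * pathProb L (t / N) ξ *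
        Real.exp (∑ i, t / N * U i (ξ i.succ)) ≤ Real.exp 1 := by
  have hlim : Tendsto (fun N : ℕ => t / N) atTop (𝓝[>] 0) := by
    refine tendsto_nhdsWithin_iff.2 ⟨tendsto_const_div_atTop_nhds_zero_nat t, ?_⟩
    filter_upwards [eventually_gt_atTop 0] with N hN
    exact div_pos ht (by exact_mod_cast hN)
  -- with the excess rate `1 / t` the `N` steps together lose at most a factor `e`
  filter_upwards [hlim.eventually
    (eventually_ev_semigroup_exp_sq_le (L := L) h0 h1 hc (inv_pos.2 ht)),
    eventually_gt_atTop 0] with N hN hN0 U hU hdis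
  have hNpos : (0 : ℝ) < N := by exact_mod_cast hN0
  set δ := t / N with hδ
  obtain ⟨v, hv, hsum⟩ := exists_path_sum
    (fun j v => ev ρ (fun η : V → Bool => v η ^ 2) ≤ (1 + t⁻¹ * δ) ^ j)
    (by simp [ev_const]) N
    (fun i x y => transition L δ x y * Real.exp (δ * U i y)) fun i j v hv => by
      have h := hN (U i) (hU i) (hdis i) v
      simp only [semigroup_eq_sum, ← mul_assoc] at h
      refine h.trans ?_
      rw [pow_succ']
      exact mul_le_mul_of_nonneg_left hv (by positivity)
  have e1 : ∑ ξ : Fin (N + 1) → V → Bool, weight ρ (ξ 0) * pathProb L δ ξ *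
        Real.exp (∑ i, δ * U i (ξ i.succ)) = ev ρ v := by
    rw [sum_path_eq]
    refine Finset.sum_congr rfl fun x _ => ?_
    rw [← hsum x, Finset.mul_sum]
    refine Finset.sum_congr rfl fun ξ _ => ?_
    rw [Fin.cons_zero, mul_assoc]
    unfold pathProb
    rw [Real.exp_sum, ← Finset.prod_mul_distrib]
  have e2 : (1 + t⁻¹ * δ) ^ N ≤ Real.exp 1 := by
    calc (1 + t⁻¹ * δ) ^ N ≤ Real.exp (t⁻¹ * δ) ^ N := by
          refine pow_le_pow_left₀ (by positivity) ?_ N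
          linarith [Real.add_one_le_exp (t⁻¹ * δ)]
      _ = Real.exp 1 := by
          rw [← Real.exp_nat_mul, hδ]; congr 1; field_simp
  have e3 : ev ρ v ≤ ev ρ (fun η => 1 / 2 + 1 / 2 * v η ^ 2) :=
    ev_mono h0 h1 fun η => by nlinarith [sq_nonneg (v η - 1)]
  rw [ev_add, ev_const, ev_const_mul] at e3
  rw [e1]
  have := Real.add_one_le_exp (1 : ℝ)
  linarith [hv.trans e2]

/-- The Gibbs variational inequality on discrete paths: the chain started from the density `f`
is compared to the chain started from the Bernoulli measure. -/
lemma sum_path_le_ent_add (h0 : 0 < ρ) (h1 : ρ < 1) {r : ℝ} (hL : IsGenerator L r)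
    {f : (V → Bool) → ℝ} (hf : ∀ η, 0 ≤ f η) {δ : ℝ} (hδ : 0 ≤ δ) {N : ℕ}
    (Ψ : (Fin (N + 1) → V → Bool) → ℝ) :
    ∑ ξ : Fin (N + 1) → V → Bool, weight ρ (ξ 0) * f (ξ 0) * pathProb L δ ξ * Ψ ξ ≤
      ent ρ f + ∑ ξ : Fin (N + 1) → V → Bool, weight ρ (ξ 0) * pathProb L δ ξ *
        Real.exp (Ψ ξ) := by
  have e1 : ent ρ f = ∑ ξ : Fin (N + 1) → V → Bool,
      weight ρ (ξ 0) * klFun (f (ξ 0)) * pathProb L δ ξ := by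
    rw [sum_mul_pathProb hL δ N (fun x => weight ρ x * klFun (f x))]; rfl
  rw [e1, ← Finset.sum_add_distrib]
  refine Finset.sum_le_sum fun ξ _ => ?_
  have hw : 0 ≤ weight ρ (ξ 0) * pathProb L δ ξ :=
    mul_nonneg (weight_pos h0 h1 _).le (pathProb_nonneg hL hδ ξ)
  have := mul_le_mul_of_nonneg_left (mul_le_klFun_add_exp (hf (ξ 0)) (Ψ ξ)) hw
  nlinarith

end FeynmanKac

/-! ### Riemann sums of right-continuous functions -/

/-- Right-endpoint Riemann sums of a bounded right-continuous function. -/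
lemma tendsto_riemann_sum {g : ℝ → ℝ} {t c : ℝ} (ht : 0 < t)
    (hg : ∀ s ∈ Set.Ico 0 t, ContinuousWithinAt g (Set.Icc s t) s)
    (hc : ∀ s ∈ Set.Icc 0 t, |g s| ≤ c) :
    Tendsto (fun N : ℕ => ∑ i : Fin N, t / N * g (t / N * ((i : ℕ) + 1 : ℕ))) atTop
      (𝓝 (∫ s in (0 : ℝ)..t, g s)) := by
  -- the sums are integrals of step functions
  let φ : ℕ → ℝ → ℝ := fun N s => t / N * (⌈s / (t / N)⌉₊ : ℝ)
  have hsum : ∀ᶠ N : ℕ in atTop, ∫ s in (0 : ℝ)..t, g (φ N s) =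
      ∑ i : Fin N, t / N * g (t / N * ((i : ℕ) + 1 : ℕ)) := by
    filter_upwards [eventually_gt_atTop 0] with N hN
    have hNp : (0 : ℝ) < N := by exact_mod_cast hN
    set δ := t / N with hδ
    have hδ0 : 0 < δ := by positivity
    have hstep : ∀ i : ℕ, Set.EqOn (fun s => g (φ N s)) (fun _ => g (δ * (i + 1 : ℕ)))
        (Set.Ioc (δ * i) (δ * (i + 1 : ℕ))) := by
      intro i s hs
      have : ⌈s / δ⌉₊ = i + 1 := by
        rw [Nat.ceil_eq_iff (Nat.succ_ne_zero i)]
        have h1 : δ * i < s := hs.1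
        have h2 : s ≤ δ * (i + 1 : ℕ) := hs.2
        refine ⟨?_, by rw [div_le_iff₀ hδ0]; linarith⟩
        rw [lt_div_iff₀ hδ0]
        push_cast
        linarith
      simp only [φ, ← hδ, this]
    have hle : ∀ i : ℕ, δ * i ≤ δ * (i + 1 : ℕ) := fun i => by push_cast; nlinarith
    have hint : ∀ i < N, IntervalIntegrable (fun s => g (φ N s)) volume (δ * i)
        (δ * (i + 1 : ℕ)) := fun i _ => by
      rw [intervalIntegrable_iff_integrableOn_Ioc_of_le (hle i)]
      exact (integrableOn_const (by simp)).congr_fun (hstep i).symm measurableSet_Ioc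
    have h := intervalIntegral.sum_integral_adjacent_intervals
      (f := fun s => g (φ N s)) (μ := volume) (a := fun i : ℕ => δ * i) (n := N) hint
    have e0 : δ * ((0 : ℕ) : ℝ) = 0 := by simp
    have eN : δ * (N : ℝ) = t := by rw [hδ]; field_simp
    rw [e0, eN] at h
    rw [← h, Fin.sum_univ_eq_sum_range (fun i => δ * g (δ * (i + 1 : ℕ))) N]
    refine Finset.sum_congr rfl fun i _ => ?_
    rw [intervalIntegral.integral_of_le (hle i),
      setIntegral_congr_fun measurableSet_Ioc (hstep i), setIntegral_const]
    simp only [Measure.real, Real.volume_Ioc, smul_eq_mul]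
    rw [ENNReal.toReal_ofReal (by linarith [hle i])]
    push_cast; ring
  have hφ : ∀ N : ℕ, 0 < N → ∀ s ∈ Set.Ioc 0 t, φ N s ∈ Set.Icc s t ∧ φ N s ≤ s + t / N := by
    intro N hN s hs
    have hNp : (0 : ℝ) < N := by exact_mod_cast hN
    have hδ0 : 0 < t / N := by positivity
    have hq : 0 ≤ s / (t / N) := div_nonneg hs.1.le hδ0.le
    refine ⟨⟨?_, ?_⟩, ?_⟩
    · have := mul_le_mul_of_nonneg_left (Nat.le_ceil (s / (t / N))) hδ0.le
      rwa [mul_div_cancel₀ _ hδ0.ne'] at this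
    · have h1 : ⌈s / (t / N)⌉₊ ≤ N := by
        rw [Nat.ceil_le, div_le_iff₀ hδ0, mul_div_cancel₀ _ hNp.ne']; exact hs.2
      have h2 : (⌈s / (t / N)⌉₊ : ℝ) ≤ N := by exact_mod_cast h1
      calc φ N s ≤ t / N * N := mul_le_mul_of_nonneg_left h2 hδ0.le
        _ = t := by field_simp
    · have := mul_le_mul_of_nonneg_left (Nat.ceil_lt_add_one hq).le hδ0.le
      rwa [mul_add, mul_div_cancel₀ _ hδ0.ne', mul_one] at this
  refine (tendsto_congr' hsum).1 ?_
  refine intervalIntegral.tendsto_integral_filter_of_dominated_convergence (fun _ => c) ?_ ?_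
    intervalIntegrable_const ?_
  · refine Eventually.of_forall fun N => Measurable.aestronglyMeasurable ?_
    have : (fun s => g (φ N s)) = (fun k : ℕ => g (t / N * k)) ∘ fun s => ⌈s / (t / N)⌉₊ := rfl
    rw [this]
    exact (measurable_from_nat).comp (Nat.measurable_ceil.comp (measurable_id.div_const _))
  · filter_upwards [eventually_gt_atTop 0] with N hN
    refine Eventually.of_forall fun s hs => ?_
    rw [Set.uIoc_of_le ht.le] at hs
    have := (hφ N hN s hs).1
    exact hc _ ⟨hs.1.le.trans this.1, this.2⟩
  · have hne : ∀ᵐ s : ℝ, s ≠ t := by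
      simp [ae_iff]
    filter_upwards [hne] with s hst hs
    rw [Set.uIoc_of_le ht.le] at hs
    refine (hg s ⟨hs.1.le, lt_of_le_of_ne hs.2 hst⟩).tendsto.comp
      (tendsto_nhdsWithin_iff.2 ⟨?_, ?_⟩)
    · have hlim : Tendsto (fun N : ℕ => s + t / N) atTop (𝓝 (s + 0)) :=
        (tendsto_const_div_atTop_nhds_zero_nat t).const_add s
      rw [add_zero] at hlim
      refine tendsto_of_tendsto_of_tendsto_of_le_of_le' tendsto_const_nhds hlim ?_ ?_
      · filter_upwards [eventually_gt_atTop 0] with N hN using (hφ N hN s hs).1.1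
      · filter_upwards [eventually_gt_atTop 0] with N hN using (hφ N hN s hs).2
    · filter_upwards [eventually_gt_atTop 0] with N hN using (hφ N hN s hs).1

/-! ### Additive functionals of the chain -/

section Chain

variable {S : Type} [Fintype S] [DecidableEq S] [TopologicalSpace S] [MeasurableSpace S]
  [MeasurableSingletonClass S] {Ω : Type*} [MeasurableSpace Ω]
  {L : (S → ℝ) →ₗ[ℝ] (S → ℝ)} {μ : Measure S} {P : Measure Ω} [IsProbabilityMeasure P]
  {X : ℝ → Ω → S}

lemma integrable_comp_of_finite {S' : Type*} [Finite S'] [MeasurableSpace S']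
    [MeasurableSingletonClass S'] {Y : Ω → S'} (hY : Measurable Y) (φ : S' → ℝ) :
    Integrable (fun ω => φ (Y ω)) P := by
  have : IsProbabilityMeasure (P.map Y) := Measure.isProbabilityMeasure_map hY.aemeasurable
  exact (Integrable.of_finite (μ := P.map Y) (f := φ)).comp_measurable hY

/-- Expectations of functions of the chain observed at finitely many times. -/
lemma IsMarkovChain.integral_path (hX : IsMarkovChain L μ P X) {r : ℝ} (hL : IsGenerator L r)
    {m : ℕ} {t : Fin (m + 1) → ℝ} (ht : Monotone t) (ht0 : t 0 = 0)
    (Ψ : (Fin (m + 1) → S) → ℝ) :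
    ∫ ω, Ψ (fun i => X (t i) ω) ∂P =
      ∑ ξ, μ.real {ξ 0} * (∏ i : Fin m, transition L (t i.succ - t i.castSucc)
        (ξ i.castSucc) (ξ i.succ)) * Ψ ξ := by
  have hY : Measurable fun ω => fun i => X (t i) ω :=
    measurable_pi_lambda _ fun i => hX.measurable _ (ht0 ▸ ht (Fin.zero_le i))
  have : IsProbabilityMeasure (P.map fun ω => fun i => X (t i) ω) :=
    Measure.isProbabilityMeasure_map hY.aemeasurable
  rw [← integral_map (f := Ψ) hY.aemeasurable (by
    exact (Measurable.of_discrete).aestronglyMeasurable), integral_fintype .of_finite]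
  refine Finset.sum_congr rfl fun ξ _ => ?_
  have e : (fun ω => fun i => X (t i) ω) ⁻¹' {ξ} = {ω | ∀ i, X (t i) ω = ξ i} := by
    ext ω; simp [funext_iff]
  rw [smul_eq_mul, Measure.real, Measure.map_apply hY (measurableSet_singleton ξ), e,
    hX.finite_dim m t ξ ht ht0, ENNReal.toReal_ofReal]
  exact mul_nonneg measureReal_nonneg (Finset.prod_nonneg fun i _ =>
    transition_nonneg hL (sub_nonneg.2 (ht (Fin.castSucc_le_succ i))) _ _)

/-- Expectations of functions of the chain observed on a regular grid. -/
lemma IsMarkovChain.integral_grid (hX : IsMarkovChain L μ P X) {r : ℝ} (hL : IsGenerator L r)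
    {δ : ℝ} (hδ : 0 ≤ δ) {N : ℕ} (Ψ : (Fin (N + 1) → S) → ℝ) :
    ∫ ω, Ψ (fun i => X (δ * (i : ℕ)) ω) ∂P =
      ∑ ξ, μ.real {ξ 0} * pathProb L δ ξ * Ψ ξ := by
  have := hX.integral_path hL (t := fun i : Fin (N + 1) => δ * (i : ℕ))
    (fun i j hij => mul_le_mul_of_nonneg_left (by exact_mod_cast hij) hδ) (by simp) Ψ
  rw [this]
  unfold pathProb
  simp only [Fin.val_succ, Fin.val_castSucc, Nat.cast_add, Nat.cast_one, mul_add, mul_one,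
    add_sub_cancel_left]

end Chain

section BernoulliChain

variable {V : Type} [Fintype V] [DecidableEq V] {Ω : Type*} [MeasurableSpace Ω]
  {L : ((V → Bool) → ℝ) →ₗ[ℝ] ((V → Bool) → ℝ)} {μ : Measure (V → Bool)} {P : Measure Ω}
  [IsProbabilityMeasure P] {X : ℝ → Ω → V → Bool} {ρ : ℝ}

/-- Expectations of functions of the chain at a fixed time. -/
lemma IsMarkovChain.integral_apply (hX : IsMarkovChain L μ P X) {r : ℝ} (hL : IsGenerator L r)
    (h0 : 0 < ρ) (h1 : ρ < 1) {f : (V → Bool) → ℝ} (hμ : ∀ η, μ.real {η} = weight ρ η * f η)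
    {s : ℝ} (hs : 0 ≤ s) (φ : (V → Bool) → ℝ) :
    ∫ ω, φ (X s ω) ∂P = ev ρ (fun η => density ρ L f s η * φ η) := by
  have h := hX.integral_grid hL hs (N := 1) (fun ξ => φ (ξ 1))
  simp only [Fin.val_one, Nat.cast_one, mul_one] at h
  rw [h, ev_density_mul h0 h1, sum_path_eq]
  unfold ev
  refine Finset.sum_congr rfl fun x _ => ?_
  beta_reduce
  rw [semigroup_eq_sum, ← (Equiv.funUnique (Fin 1) (V → Bool)).symm.sum_comp, ← mul_assoc, ← hμ,
    Finset.mul_sum]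
  refine Finset.sum_congr rfl fun y _ => ?_
  simp [pathProb, mul_assoc]

/-- Time integrals along the chain, discretized: an observable which is dominated in the sense of
quadratic forms by `-L`, up to an error whose expectation is controlled along the evolution,
has a small time integral. The maximum of the two one-sided sums has a bounded exponential moment
under the Bernoulli weights; the errors `R`, `R'` are integrated under the chain itself. -/
lemma IsMarkovChain.eventually_integral_abs_sum_le (hX : IsMarkovChain L μ P X) {r : ℝ}
    (hL : IsGenerator L r) (h0 : 0 < ρ) (h1 : ρ < 1) {f : (V → Bool) → ℝ} (hf : ∀ η, 0 ≤ f η)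
    (hμ : ∀ η, μ.real {η} = weight ρ η * f η) {t c B : ℝ} (ht : 0 < t) (hc : 0 ≤ c)
    {W R R' : ℝ → (V → Bool) → ℝ} (hWc : ∀ s ∈ Set.Icc 0 t, ∀ η, |W s η| ≤ c)
    (hR : ∀ s ∈ Set.Icc 0 t, ∀ η, 0 ≤ R s η ∧ R s η ≤ c)
    (hR' : ∀ s ∈ Set.Icc 0 t, ∀ η, 0 ≤ R' s η ∧ R' s η ≤ c)
    (hW : ∀ s ∈ Set.Icc 0 t, ∀ u : (V → Bool) → ℝ,
      ev ρ (fun η => (W s η - R s η) * u η ^ 2) + ev ρ (fun η => u η * L u η) ≤ 0)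
    (hW' : ∀ s ∈ Set.Icc 0 t, ∀ u : (V → Bool) → ℝ,
      ev ρ (fun η => (-W s η - R' s η) * u η ^ 2) + ev ρ (fun η => u η * L u η) ≤ 0)
    (hB : ∀ s ∈ Set.Icc 0 t, ev ρ (fun η => density ρ L f s η * (R s η + R' s η)) ≤ B) :
    ∀ᶠ N : ℕ in atTop, ∫ ω, |∑ i : Fin N, t / N * W (t / N * ((i : ℕ) + 1 : ℕ))
      (X (t / N * ((i : ℕ) + 1 : ℕ)) ω)| ∂P ≤ ent ρ f + 2 * Real.exp 1 + t * B := by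
  filter_upwards [eventually_path_exp_le (V := V) (L := L) h0 h1 (c := 2 * c) (by positivity) ht,
    eventually_gt_atTop 0] with N hN hN0
  have hNp : (0 : ℝ) < N := by exact_mod_cast hN0
  set δ := t / N with hδ
  have hδ0 : 0 < δ := by positivity
  have hgrid : ∀ i : Fin N, δ * ((i : ℕ) + 1 : ℕ) ∈ Set.Icc 0 t := fun i => by
    refine ⟨by positivity, ?_⟩
    have : (((i : ℕ) + 1 : ℕ) : ℝ) ≤ N := by exact_mod_cast i.2
    calc δ * ((i : ℕ) + 1 : ℕ) ≤ δ * N := mul_le_mul_of_nonneg_left this hδ0.le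
      _ = t := by rw [hδ]; field_simp
  let s : Fin N → ℝ := fun i => δ * ((i : ℕ) + 1 : ℕ)
  let U : Fin N → (V → Bool) → ℝ := fun i η => W (s i) η - R (s i) η
  let U' : Fin N → (V → Bool) → ℝ := fun i η => -W (s i) η - R' (s i) η
  let A : (Fin (N + 1) → V → Bool) → ℝ := fun ξ => ∑ i, δ * U i (ξ i.succ)
  let A' : (Fin (N + 1) → V → Bool) → ℝ := fun ξ => ∑ i, δ * U' i (ξ i.succ)
  have hA := hN U (fun i η => by
    have b1 := abs_le.1 (hWc _ (hgrid i) η)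
    have b2 := hR _ (hgrid i) η
    exact abs_le.2 ⟨by simp only [U, s]; linarith, by simp only [U, s]; linarith⟩)
    fun i => hW _ (hgrid i)
  have hA' := hN U' (fun i η => by
    have b1 := abs_le.1 (hWc _ (hgrid i) η)
    have b2 := hR' _ (hgrid i) η
    exact abs_le.2 ⟨by simp only [U', s]; linarith, by simp only [U', s]; linarith⟩)
    fun i => hW' _ (hgrid i)
  have hmax : ∫ ω, max (A fun i => X (δ * (i : ℕ)) ω) (A' fun i => X (δ * (i : ℕ)) ω) ∂P ≤
      ent ρ f + 2 * Real.exp 1 := by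
    rw [hX.integral_grid hL hδ0.le (fun ξ => max (A ξ) (A' ξ))]
    simp only [hμ]
    refine (sum_path_le_ent_add h0 h1 hL hf hδ0.le _).trans ?_
    have : ∀ ξ : Fin (N + 1) → V → Bool, weight ρ (ξ 0) * pathProb L δ ξ *
        Real.exp (max (A ξ) (A' ξ)) ≤ weight ρ (ξ 0) * pathProb L δ ξ * Real.exp (A ξ) +
          weight ρ (ξ 0) * pathProb L δ ξ * Real.exp (A' ξ) := fun ξ => by
      rw [← mul_add]
      refine mul_le_mul_of_nonneg_left ?_
        (mul_nonneg (weight_pos h0 h1 _).le (pathProb_nonneg hL hδ0.le ξ))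
      rcases max_choice (A ξ) (A' ξ) with h | h <;> rw [h]
      · linarith [Real.exp_pos (A' ξ)]
      · linarith [Real.exp_pos (A ξ)]
    have h := Finset.sum_le_sum fun ξ (_ : ξ ∈ Finset.univ) => this ξ
    rw [Finset.sum_add_distrib] at h
    linarith
  have hmeas : Measurable fun ω => fun i : Fin (N + 1) => X (δ * (i : ℕ)) ω :=
    measurable_pi_lambda _ fun i => hX.measurable _ (by positivity)
  have hXi : ∀ i : Fin N, Measurable (X (s i)) := fun i => hX.measurable _ (hgrid i).1
  -- `|w| ≤ max (w - p) (-w - q) + (p + q)` for `p, q ≥ 0`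
  have hpt : ∀ ω, |∑ i : Fin N, δ * W (s i) (X (s i) ω)| ≤
      max (A fun i => X (δ * (i : ℕ)) ω) (A' fun i => X (δ * (i : ℕ)) ω) +
        ∑ i, δ * (R (s i) (X (s i) ω) + R' (s i) (X (s i) ω)) := by
    intro ω
    have eA : (A fun i => X (δ * (i : ℕ)) ω) = ∑ i : Fin N, δ * W (s i) (X (s i) ω) -
        ∑ i : Fin N, δ * R (s i) (X (s i) ω) := by
      rw [← Finset.sum_sub_distrib]
      refine Finset.sum_congr rfl fun i _ => ?_
      simp only [U, s, Fin.val_succ]; ring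
    have eA' : (A' fun i => X (δ * (i : ℕ)) ω) = -∑ i : Fin N, δ * W (s i) (X (s i) ω) -
        ∑ i : Fin N, δ * R' (s i) (X (s i) ω) := by
      rw [← Finset.sum_neg_distrib, ← Finset.sum_sub_distrib]
      refine Finset.sum_congr rfl fun i _ => ?_
      simp only [U', s, Fin.val_succ]; ring
    have b1 : 0 ≤ ∑ i : Fin N, δ * R (s i) (X (s i) ω) :=
      Finset.sum_nonneg fun i _ => mul_nonneg hδ0.le (hR _ (hgrid i) _).1
    have b2 : 0 ≤ ∑ i : Fin N, δ * R' (s i) (X (s i) ω) :=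
      Finset.sum_nonneg fun i _ => mul_nonneg hδ0.le (hR' _ (hgrid i) _).1
    simp only [mul_add, Finset.sum_add_distrib]
    have m1 := le_max_left (A fun i => X (δ * (i : ℕ)) ω) (A' fun i => X (δ * (i : ℕ)) ω)
    have m2 := le_max_right (A fun i => X (δ * (i : ℕ)) ω) (A' fun i => X (δ * (i : ℕ)) ω)
    refine abs_le.2 ⟨?_, ?_⟩ <;> linarith
  have hi1 : Integrable (fun ω => max (A fun i => X (δ * (i : ℕ)) ω)
      (A' fun i => X (δ * (i : ℕ)) ω)) P :=
    integrable_comp_of_finite hmeas (fun ξ => max (A ξ) (A' ξ))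
  have hi2 : ∀ i ∈ (Finset.univ : Finset (Fin N)),
      Integrable (fun ω => δ * (R (s i) (X (s i) ω) + R' (s i) (X (s i) ω))) P := fun i _ =>
    integrable_comp_of_finite (hXi i) fun η => δ * (R (s i) η + R' (s i) η)
  have hi3 : Integrable (fun ω => |∑ i : Fin N, δ * W (s i) (X (s i) ω)|) P :=
    (integrable_finsetSum _ fun i _ =>
      integrable_comp_of_finite (hXi i) fun η => δ * W (s i) η).abs
  have hRsum : ∫ ω, ∑ i, δ * (R (s i) (X (s i) ω) + R' (s i) (X (s i) ω)) ∂P ≤ t * B := by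
    rw [integral_finsetSum _ hi2]
    calc ∑ i : Fin N, ∫ ω, δ * (R (s i) (X (s i) ω) + R' (s i) (X (s i) ω)) ∂P
        ≤ ∑ _i : Fin N, δ * B := by
          refine Finset.sum_le_sum fun i _ => ?_
          rw [integral_const_mul]
          refine mul_le_mul_of_nonneg_left ?_ hδ0.le
          rw [hX.integral_apply hL h0 h1 hμ (hgrid i).1 fun η => R (s i) η + R' (s i) η]
          exact hB _ (hgrid i)
      _ = t * B := by
          rw [Finset.sum_const, Finset.card_univ, Fintype.card_fin, nsmul_eq_mul, hδ]
          field_simp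
  calc ∫ ω, |∑ i : Fin N, δ * W (s i) (X (s i) ω)| ∂P
      ≤ ∫ ω, (max (A fun i => X (δ * (i : ℕ)) ω) (A' fun i => X (δ * (i : ℕ)) ω) +
        ∑ i, δ * (R (s i) (X (s i) ω) + R' (s i) (X (s i) ω))) ∂P :=
        integral_mono hi3 (hi1.add (integrable_finsetSum _ hi2)) hpt
    _ ≤ _ := by
        rw [integral_add hi1 (integrable_finsetSum _ hi2)]
        exact add_le_add hmax hRsum

/-- The estimate of `eventually_integral_abs_sum_le` passes from Riemann sums to time integrals. -/
lemma IsMarkovChain.lintegral_abs_integral_le (hX : IsMarkovChain L μ P X) {r : ℝ}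
    (hL : IsGenerator L r) (h0 : 0 < ρ) (h1 : ρ < 1) {f : (V → Bool) → ℝ} (hf : ∀ η, 0 ≤ f η)
    (hμ : ∀ η, μ.real {η} = weight ρ η * f η) {t c B : ℝ} (ht : 0 < t) (hc : 0 ≤ c)
    {W R R' : ℝ → (V → Bool) → ℝ} (hWc : ∀ s ∈ Set.Icc 0 t, ∀ η, |W s η| ≤ c)
    (hWcont : ∀ η, ContinuousOn (fun s => W s η) (Set.Icc 0 t))
    (hR : ∀ s ∈ Set.Icc 0 t, ∀ η, 0 ≤ R s η ∧ R s η ≤ c)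
    (hR' : ∀ s ∈ Set.Icc 0 t, ∀ η, 0 ≤ R' s η ∧ R' s η ≤ c)
    (hW : ∀ s ∈ Set.Icc 0 t, ∀ u : (V → Bool) → ℝ,
      ev ρ (fun η => (W s η - R s η) * u η ^ 2) + ev ρ (fun η => u η * L u η) ≤ 0)
    (hW' : ∀ s ∈ Set.Icc 0 t, ∀ u : (V → Bool) → ℝ,
      ev ρ (fun η => (-W s η - R' s η) * u η ^ 2) + ev ρ (fun η => u η * L u η) ≤ 0)
    (hB : ∀ s ∈ Set.Icc 0 t, ev ρ (fun η => density ρ L f s η * (R s η + R' s η)) ≤ B) :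
    ∫⁻ ω, ENNReal.ofReal |∫ s in (0 : ℝ)..t, W s (X s ω)| ∂P ≤
      ENNReal.ofReal (ent ρ f + 2 * Real.exp 1 + t * B) := by
  let F : ℕ → Ω → ℝ := fun N ω => ∑ i : Fin N, t / N * W (t / N * ((i : ℕ) + 1 : ℕ))
      (X (t / N * ((i : ℕ) + 1 : ℕ)) ω)
  have hXm : ∀ (N : ℕ) (i : Fin N), Measurable (X (t / N * ((i : ℕ) + 1 : ℕ))) := fun N i =>
    hX.measurable _ (by positivity)
  have hFm : ∀ N, Measurable (F N) := fun N => Finset.measurable_sum _ fun i _ =>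
    (Measurable.of_discrete (f := fun η => t / N * W (t / N * ((i : ℕ) + 1 : ℕ)) η)).comp
      (hXm N i)
  have hFi : ∀ N, Integrable (F N) P := fun N => integrable_finsetSum _ fun i _ =>
    integrable_comp_of_finite (hXm N i) fun η => t / N * W (t / N * ((i : ℕ) + 1 : ℕ)) η
  have hlim : ∀ ω, Tendsto (fun N => ENNReal.ofReal |F N ω|) atTop
      (𝓝 (ENNReal.ofReal |∫ s in (0 : ℝ)..t, W s (X s ω)|)) := by
    intro ω
    refine ENNReal.tendsto_ofReal (Tendsto.abs ?_)
    refine tendsto_riemann_sum (g := fun s => W s (X s ω)) ht (fun s hs => ?_)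
      fun s hs => hWc s hs _
    -- the trajectory is constant on a right neighbourhood of `s`
    have hconst : ∀ᶠ s' in 𝓝[Set.Icc s t] s, X s' ω = X s ω := by
      have h := hX.right_continuous ω s hs.1
      have := h (isOpen_discrete {X s ω} |>.mem_nhds rfl)
      exact nhdsWithin_mono s Set.Icc_subset_Ici_self this
    have hcont : ContinuousWithinAt (fun s' => W s' (X s ω)) (Set.Icc s t) s :=
      (hWcont (X s ω) s ⟨hs.1, hs.2.le⟩).mono (Set.Icc_subset_Icc_left hs.1)
    exact hcont.congr_of_eventuallyEq (hconst.mono fun s' h => by simp only [h]) rfl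
  have hbound := hX.eventually_integral_abs_sum_le hL h0 h1 hf hμ ht hc hWc hR hR' hW hW' hB
  calc ∫⁻ ω, ENNReal.ofReal |∫ s in (0 : ℝ)..t, W s (X s ω)| ∂P
      = ∫⁻ ω, liminf (fun N => ENNReal.ofReal |F N ω|) atTop ∂P :=
        lintegral_congr fun ω => (hlim ω).liminf_eq.symm
    _ ≤ liminf (fun N => ∫⁻ ω, ENNReal.ofReal |F N ω| ∂P) atTop :=
        lintegral_liminf_le fun N => (hFm N).abs.ennreal_ofReal
    _ ≤ _ := by
        refine liminf_le_of_frequently_le' (Eventually.frequently ?_)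
        filter_upwards [hbound] with N hN
        rw [← ofReal_integral_eq_lintegral_ofReal (hFi N).abs
          (Eventually.of_forall fun ω => abs_nonneg _)]
        exact ENNReal.ofReal_le_ofReal hN

end BernoulliChain

/-! ### Time integrals of fields of the voter model with stirring -/

section Field

variable {V : Type} [Fintype V] [DecidableEq V] {ρ : ℝ}

/-- The density of the point mass at a configuration. -/
lemma isDensity_pointMass (h0 : 0 < ρ) (h1 : ρ < 1) (η : V → Bool) :
    IsDensity ρ fun ζ => if ζ = η then 1 / weight ρ η else 0 where
  nonneg ζ := by
    have := weight_pos h0 h1 η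
    split_ifs <;> positivity
  ev_eq_one := by simp [ev, (weight_pos h0 h1 η).ne']

/-- A function whose expectations under densities are controlled by the entropy is bounded, as is
seen by testing against point masses. -/
lemma le_of_ev_density_le (h0 : 0 < ρ) (h1 : ρ < 1) {R : (V → Bool) → ℝ} {K κ : ℝ}
    (h : ∀ f, IsDensity ρ f → ev ρ (fun η => f η * R η) ≤ K * (ent ρ f + κ)) (η : V → Bool) :
    R η ≤ ∑ η : V → Bool,
      |K * (ent ρ (fun ζ => if ζ = η then 1 / weight ρ η else 0) + κ)| := by
  have h2 := h _ (isDensity_pointMass h0 h1 η)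
  have e : ev ρ (fun ζ => (if ζ = η then 1 / weight ρ η else 0) * R ζ) = R η := by
    have := (weight_pos h0 h1 η).ne'
    simp [ev]
    field_simp
  rw [e] at h2
  exact h2.trans ((le_abs_self _).trans (Finset.single_le_sum
    (f := fun η => |K * (ent ρ (fun ζ => if ζ = η then 1 / weight ρ η else 0) + κ)|)
    (fun _ _ => abs_nonneg _) (Finset.mem_univ η)))

lemma nuTorus_singleton {d n : ℕ} [NeZero n] (h0 : 0 < ρ) (h1 : ρ < 1) (η : TorusConfig d n) :
    nuTorus d n ρ {η} = ENNReal.ofReal (weight ρ η) := by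
  unfold nuTorus weight
  rw [Measure.pi_singleton, ENNReal.ofReal_prod_of_nonneg fun x _ => by
    rw [← bern_real_singleton h0.le h1.le]; exact measureReal_nonneg]
  refine Finset.prod_congr rfl fun x _ => ?_
  rw [← bern_real_singleton h0.le h1.le, ofReal_measureReal]

/-- The entropy of the density of a measure is its relative entropy. -/
lemma ent_le_of_klDiv_le {d n : ℕ} [NeZero n] (h0 : 0 < ρ) (h1 : ρ < 1)
    {μ : Measure (TorusConfig d n)} [IsProbabilityMeasure μ] {H : ℝ} (hH : 0 ≤ H)
    (h : klDiv μ (nuTorus d n ρ) ≤ ENNReal.ofReal H) :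
    ent ρ (fun η => μ.real {η} / weight ρ η) ≤ H := by
  have : IsProbabilityMeasure (nuTorus d n ρ) := by unfold nuTorus; infer_instance
  have hac : μ ≪ nuTorus d n ρ := by
    intro s hs
    have : s = ∅ := by
      refine Set.eq_empty_of_forall_notMem fun η hη => ?_
      have h2 := measure_mono_null (Set.singleton_subset_iff.2 hη) hs
      rw [nuTorus_singleton h0 h1, ENNReal.ofReal_eq_zero] at h2
      exact absurd (weight_pos h0 h1 η) (not_lt.2 h2)
    rw [this, measure_empty]
  have hrn : ∀ η, (μ.rnDeriv (nuTorus d n ρ) η).toReal = μ.real {η} / weight ρ η := by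
    intro η
    have : μ.HaveLebesgueDecomposition (nuTorus d n ρ) :=
      Measure.haveLebesgueDecomposition_of_sigmaFinite μ _
    have h2 := Measure.setLIntegral_rnDeriv hac {η}
    rw [lintegral_singleton, nuTorus_singleton h0 h1] at h2
    rw [Measure.real, ← h2, ENNReal.toReal_mul, ENNReal.toReal_ofReal (weight_pos h0 h1 η).le,
      mul_div_cancel_right₀ _ (weight_pos h0 h1 η).ne']
  rw [InformationTheory.klDiv_eq_lintegral_klFun_of_ac hac, lintegral_fintype] at h
  simp only [hrn, nuTorus_singleton h0 h1] at h
  have hk : ∀ η : TorusConfig d n, 0 ≤ klFun (μ.real {η} / weight ρ η) := fun η =>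
    InformationTheory.klFun_nonneg (div_nonneg measureReal_nonneg (weight_pos h0 h1 η).le)
  simp only [← ENNReal.ofReal_mul (hk _)] at h
  rw [← ENNReal.ofReal_sum_of_nonneg fun η _ => mul_nonneg (hk η) (weight_pos h0 h1 η).le,
    ENNReal.ofReal_le_ofReal_iff hH] at h
  unfold ent ev
  simpa only [mul_comm, Function.comp] using h

/-- The time integral of the field of a projected cylinder function is controlled by the initial
entropy, with a constant which depends neither on the size of the torus nor on the speed of the
voter dynamics. -/
theorem exists_field_bound {d : ℕ} (hd1 : 1 ≤ d) (hd3 : d ≤ 3) (h0 : 0 < ρ) (h1 : ρ < 1)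
    {c : Fin d → Config d → ℝ} (hc_cyl : ∀ j, IsCylinder (c j)) {c₀ : ℝ} (hc0 : 0 < c₀)
    (hc₀ : ∀ j η, c₀ ≤ c j η)
    (hc_dep : ∀ j, DependsOn (c j) ({0, unitVec ℤ j}ᶜ : Set (Fin d → ℤ)))
    {f : Config d → ℝ} (hf : IsCylinder f) :
    ∃ C : ℝ, 0 < C ∧ ∃ b : ℕ, ∀ (n : ℕ) [NeZero n] (a : ℝ) (L : ℕ), Scale d n a L b →
      ∀ (μ : Measure (TorusConfig d n)) [IsProbabilityMeasure μ] (H : ℝ), 0 ≤ H →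
      klDiv μ (nuTorus d n ρ) ≤ ENNReal.ofReal H →
      ∀ {Ω : Type*} [MeasurableSpace Ω] (P : Measure Ω) [IsProbabilityMeasure P]
        (X : ℝ → Ω → TorusConfig d n), IsMarkovChain (gen c a n) μ P X →
      ∀ (t : ℝ), 0 < t → ∀ G : ℝ → (Fin d → UnitAddCircle) → ℝ,
      (∀ u, ContinuousOn (fun s => G s u) (Set.Icc 0 t)) →
      (∀ s ∈ Set.Icc 0 t, ∀ u, |G s u| ≤ a) →
      ∫⁻ ω, ENNReal.ofReal |∫ s in (0 : ℝ)..t, localField a (G s) (proj ρ f) (X s ω)| ∂P ≤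
        ENNReal.ofReal (1 / √(a * (n : ℝ) ^ d) * (H + 2 * Real.exp 1 +
          t * (C * a * (Real.exp (C * a * t) * (H + errorTerm d n a L))))) := by
  obtain ⟨C₁, hC₁, b₁, hfield⟩ := admissible_proj hd1 hd3 h0 h1 hf 1 one_pos (c₀ / 4)
    (by positivity)
  obtain ⟨C₂, hC₂, b₂, hvoter⟩ := exists_voterField_bound hd1 hd3 h0 h1 hc0
  obtain ⟨b₃, hrate⟩ := exists_rateInvariant hc_cyl hc_dep
  refine ⟨2 * C₁ + C₂, by positivity, b₁ + b₂ + b₃ + 3,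
    fun n _ a L hS μ _ H hH hkl Ω _ P _ X hX t ht G hGc hGa => ?_⟩
  have hS₁ : Scale d n a L b₁ := hS.mono (by omega)
  have hS₂ : Scale d n a L b₂ := hS.mono (by omega)
  have hroom : b₁ + b₂ + b₃ + 3 < n := by
    have := hS.room ⟨0, by omega⟩
    omega
  have ha : 0 ≤ a := zero_le_one.trans hS.one_le
  have hrn := hrate n (by omega)
  obtain ⟨r, hL⟩ := exists_isGenerator_gen (n := n) (fun j η => hc0.le.trans (hc₀ j η)) ha
  obtain ⟨RJ, hRJ, hRJu, hRJf⟩ := hvoter n a L hS₂ (by omega)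
  set κ := errorTerm d n a L with hκ
  have hκ0 : 0 ≤ κ := errorTerm_nonneg ha
  have hfp : ∀ s ∈ Set.Icc 0 t, ∃ R : TorusConfig d n → ℝ, (∀ η, 0 ≤ R η) ∧
      (∀ u : TorusConfig d n → ℝ, ev ρ (fun η => (∑ x, G s (scaledPoint x) *
        proj ρ f (torusTranslate x η)) * u η ^ 2) ≤
          c₀ / 4 * (n : ℝ) ^ 2 * dirichlet ρ u + ev ρ (fun η => R η * u η ^ 2)) ∧
      ∀ g, IsDensity ρ g → ev ρ (fun η => g η * R η) ≤ C₁ * a * (ent ρ g + κ) := fun s hs =>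
    hfield n a L hS₁ (fun x => G s (scaledPoint x)) fun x => by rw [one_mul]; exact hGa s hs _
  have hfm : ∀ s ∈ Set.Icc 0 t, ∃ R : TorusConfig d n → ℝ, (∀ η, 0 ≤ R η) ∧
      (∀ u : TorusConfig d n → ℝ, ev ρ (fun η => (∑ x, -G s (scaledPoint x) *
        proj ρ f (torusTranslate x η)) * u η ^ 2) ≤
          c₀ / 4 * (n : ℝ) ^ 2 * dirichlet ρ u + ev ρ (fun η => R η * u η ^ 2)) ∧
      ∀ g, IsDensity ρ g → ev ρ (fun η => g η * R η) ≤ C₁ * a * (ent ρ g + κ) := fun s hs =>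
    hfield n a L hS₁ (fun x => -G s (scaledPoint x)) fun x => by
      rw [one_mul, abs_neg]; exact hGa s hs _
  choose! R hR0 hRu hRf using hfp
  choose! R' hR'0 hR'u hR'f using hfm
  let W : ℝ → TorusConfig d n → ℝ := fun s η =>
    ∑ x, G s (scaledPoint x) * proj ρ f (torusTranslate x η)
  -- Gronwall's inequality along the evolution
  have hent : ∀ g : TorusConfig d n → ℝ, IsDensity ρ g → (∀ η, 0 < g η) →
      ev ρ (fun η => g η * gen c a n (fun ζ => Real.log (g ζ)) η) ≤
        C₂ * a * (ent ρ g + κ) := by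
    intro g hg hpos
    have b1 := ev_mul_gen_log_le h0 h1 (by omega) hrn hc0 hc₀ ha hpos
    have b2 := hRJu fun η => √(g η)
    simp only [Real.sq_sqrt (hpos _).le] at b2
    have b3 := hRJf g hg
    have b4 : 0 ≤ c₀ * (n : ℝ) ^ 2 * dirichlet ρ (fun η => √(g η)) := by
      have : 0 ≤ dirichlet ρ (fun η : TorusConfig d n => √(g η)) := by
        unfold dirichlet
        exact Finset.sum_nonneg fun x _ => Finset.sum_nonneg fun j _ =>
          ev_nonneg h0 h1 fun η => sq_nonneg _
      positivity
    simp only [mul_comm (g _) (RJ _)] at b3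
    linarith
  set f₀ : TorusConfig d n → ℝ := fun η => μ.real {η} / weight ρ η with hf₀
  have hμ : ∀ η, μ.real {η} = weight ρ η * f₀ η := fun η =>
    (mul_div_cancel₀ _ (weight_pos h0 h1 η).ne').symm
  have hf₀d : IsDensity ρ f₀ := by
    refine ⟨fun η => div_nonneg measureReal_nonneg (weight_pos h0 h1 η).le, ?_⟩
    unfold ev
    simp only [← hμ]
    have : (1 : ℝ) = μ.real Set.univ := by simp
    rw [this, ← Finset.coe_univ, ← sum_measureReal_singleton]
  have hH₀ : ent ρ f₀ ≤ H := ent_le_of_klDiv_le h0 h1 hH hkl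
  have hgron : ∀ s ∈ Set.Icc 0 t, ent ρ (density ρ (gen c a n) f₀ s) + κ ≤
      Real.exp ((2 * C₁ + C₂) * a * t) * (H + κ) := by
    intro s hs
    refine (ent_density_le h0 h1 hL hent hf₀d hs.1).trans ?_
    refine mul_le_mul (Real.exp_le_exp.2 ?_) (by linarith)
      (add_nonneg (ent_nonneg h0 h1 hf₀d.nonneg) hκ0) (Real.exp_pos _).le
    exact mul_le_mul (by nlinarith) hs.2 hs.1 (by positivity)
  -- a uniform bound on all the observables involved
  set cR : ℝ → ℝ := fun K => ∑ η : TorusConfig d n,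
      |K * a * (ent ρ (fun ζ => if ζ = η then 1 / weight ρ η else 0) + κ)| with hcR
  have hcR0 : ∀ K, 0 ≤ cR K := fun K => Finset.sum_nonneg fun _ _ => abs_nonneg _
  set cW : ℝ := ∑ η : TorusConfig d n, ∑ x : Torus d n, a * |proj ρ f (torusTranslate x η)|
    with hcW
  have hWη : ∀ s ∈ Set.Icc 0 t, ∀ η, |W s η| ≤ cW := by
    intro s hs η
    calc |W s η| ≤ ∑ x, |G s (scaledPoint x) * proj ρ f (torusTranslate x η)| :=
          Finset.abs_sum_le_sum_abs _ _
      _ ≤ ∑ x, a * |proj ρ f (torusTranslate x η)| := Finset.sum_le_sum fun x _ => by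
          rw [abs_mul]; exact mul_le_mul_of_nonneg_right (hGa s hs _) (abs_nonneg _)
      _ ≤ cW := Finset.single_le_sum
          (f := fun η : TorusConfig d n => ∑ x : Torus d n, a * |proj ρ f (torusTranslate x η)|)
          (fun η _ => Finset.sum_nonneg fun x _ => mul_nonneg ha (abs_nonneg _))
          (Finset.mem_univ η)
  have hcW0 : 0 ≤ cW := (abs_nonneg _).trans (hWη 0 ⟨le_rfl, ht.le⟩ fun _ => true)
  have hRc : ∀ s ∈ Set.Icc 0 t, ∀ η, R s η ≤ cR C₁ := fun s hs η =>
    le_of_ev_density_le h0 h1 (hRf s hs) η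
  have hR'c : ∀ s ∈ Set.Icc 0 t, ∀ η, R' s η ≤ cR C₁ := fun s hs η =>
    le_of_ev_density_le h0 h1 (hR'f s hs) η
  have hRJc : ∀ η, RJ η ≤ cR C₂ := le_of_ev_density_le h0 h1 hRJf
  have hquad : ∀ (U Q : TorusConfig d n → ℝ) (u : TorusConfig d n → ℝ),
      ev ρ (fun η => U η * u η ^ 2) ≤ c₀ / 4 * (n : ℝ) ^ 2 * dirichlet ρ u +
        ev ρ (fun η => Q η * u η ^ 2) →
      ev ρ (fun η => (U η - (Q η + 1 / 2 * RJ η)) * u η ^ 2) +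
        ev ρ (fun η => u η * gen c a n u η) ≤ 0 := by
    intro U Q u hU
    have b1 := ev_mul_gen_le h0 h1 (by omega) hrn hc₀ ha u
    have b2 := hRJu u
    have e : ev ρ (fun η => (U η - (Q η + 1 / 2 * RJ η)) * u η ^ 2) =
        ev ρ (fun η => U η * u η ^ 2) - (ev ρ (fun η => Q η * u η ^ 2) +
          1 / 2 * ev ρ (fun η => RJ η * u η ^ 2)) := by
      rw [← ev_const_mul, ← ev_add, ← ev_sub]
      congr 1; funext η; ring
    rw [e]
    linarith
  have hmain := hX.lintegral_abs_integral_le hL h0 h1 hf₀d.nonneg hμ ht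
    (c := cW + cR C₁ + cR C₂) (by linarith [hcR0 C₁, hcR0 C₂])
    (B := (2 * C₁ + C₂) * a * (Real.exp ((2 * C₁ + C₂) * a * t) * (H + κ)))
    (W := W) (R := fun s η => R s η + 1 / 2 * RJ η) (R' := fun s η => R' s η + 1 / 2 * RJ η)
    (fun s hs η => (hWη s hs η).trans (by linarith [hcR0 C₁, hcR0 C₂]))
    (fun η => continuousOn_finsetSum _ fun x _ => (hGc _).mul continuousOn_const)
    (fun s hs η => by
      have := hR0 s hs η; have := hRc s hs η; have := hRJ η; have := hRJc η
      constructor <;> linarith)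
    (fun s hs η => by
      have := hR'0 s hs η; have := hR'c s hs η; have := hRJ η; have := hRJc η
      constructor <;> linarith)
    (fun s hs u => hquad (W s) (R s) u (hRu s hs u))
    (fun s hs u => hquad (fun η => -W s η) (R' s) u (by
      have := hR'u s hs u
      simpa only [W, neg_mul, Finset.sum_neg_distrib] using this))
    (fun s hs => by
      have hd := isDensity_density h0 h1 hL hf₀d hs.1
      set g := density ρ (gen c a n) f₀ s with hg
      have e : ev ρ (fun η => g η * (R s η + 1 / 2 * RJ η + (R' s η + 1 / 2 * RJ η))) =
          ev ρ (fun η => g η * R s η) + ev ρ (fun η => g η * R' s η) +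
            ev ρ (fun η => g η * RJ η) := by
        rw [← ev_add, ← ev_add]
        congr 1; funext η; ring
      rw [e]
      have b1 := hRf s hs g hd
      have b2 := hR'f s hs g hd
      have b3 := hRJf g hd
      have b4 := mul_le_mul_of_nonneg_left (hgron s hs)
        (show 0 ≤ (2 * C₁ + C₂) * a by positivity)
      linarith)
  have hk : 0 ≤ 1 / √(a * (n : ℝ) ^ d) := by positivity
  have hloc : ∀ ω, ENNReal.ofReal
      |∫ s in (0 : ℝ)..t, localField a (G s) (proj ρ f) (X s ω)| =
      ENNReal.ofReal (1 / √(a * (n : ℝ) ^ d)) *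
        ENNReal.ofReal |∫ s in (0 : ℝ)..t, W s (X s ω)| := by
    intro ω
    rw [← ENNReal.ofReal_mul hk]
    congr 1
    have : ∀ s, localField a (G s) (proj ρ f) (X s ω) =
        1 / √(a * (n : ℝ) ^ d) * W s (X s ω) := fun s => rfl
    simp only [this]
    rw [intervalIntegral.integral_const_mul, abs_mul, abs_of_nonneg hk]
  simp only [hloc]
  rw [lintegral_const_mul' _ _ ENNReal.ofReal_ne_top, ENNReal.ofReal_mul hk]
  refine mul_le_mul_right (hmain.trans (ENNReal.ofReal_le_ofReal ?_)) _
  linarith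

end Field

/-! ### Choice of the block size and asymptotics -/

section Asymptotics

lemma sides_le_pow {d L : ℕ} (hL : 1 ≤ L) (i : Fin d) : sides d L i ≤ L ^ d := by
  unfold sides
  have hi := i.2
  split_ifs with h
  · exact Nat.le_self_pow (by omega) L
  · exact Nat.pow_le_pow_right hL (by omega)

/-- The block size is the integer part of `(n ^ 2 / a) ^ (1 / (2 d))`. -/
lemma exists_scale {d n : ℕ} (hd : 1 ≤ d) {a : ℝ} {b : ℕ} (ha : 16 ≤ a) (han : a ≤ (n : ℝ) ^ 2)
    (hb : 2 * b < n) : ∃ L, Scale d n a L b := by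
  have ha0 : 0 < a := by linarith
  have hq : 1 ≤ (n : ℝ) ^ 2 / a := by rwa [one_le_div ha0]
  set y : ℝ := ((n : ℝ) ^ 2 / a) ^ ((2 * d : ℕ) : ℝ)⁻¹ with hy
  have hyd : y ^ (2 * d) = (n : ℝ) ^ 2 / a :=
    Real.rpow_inv_natCast_pow (by positivity) (by omega)
  have hy1 : 1 ≤ y := Real.one_le_rpow hq (by positivity)
  set L := ⌊y⌋₊ with hL
  have hLy : (L : ℝ) ≤ y := Nat.floor_le (by linarith)
  have hyL : y < L + 1 := Nat.lt_floor_add_one y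
  have hL1 : 1 ≤ L := Nat.one_le_floor_iff y |>.2 hy1
  have hL1' : (1 : ℝ) ≤ L := by exact_mod_cast hL1
  have hle : a * (L : ℝ) ^ (2 * d) ≤ (n : ℝ) ^ 2 := by
    calc a * (L : ℝ) ^ (2 * d) ≤ a * y ^ (2 * d) := by gcongr
      _ = (n : ℝ) ^ 2 := by rw [hyd]; field_simp
  refine ⟨L, by linarith, hL1, hle, ?_, fun i => ?_⟩
  · calc (n : ℝ) ^ 2 = a * y ^ (2 * d) := by rw [hyd]; field_simp
      _ ≤ a * (2 * (L : ℝ)) ^ (2 * d) := by gcongr; linarith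
      _ = 4 ^ d * (a * (L : ℝ) ^ (2 * d)) := by rw [mul_pow, pow_mul]; norm_num; ring
  · have h1 : (4 * (L : ℝ) ^ d) ^ 2 ≤ (n : ℝ) ^ 2 := by
      have h2 : (0 : ℝ) ≤ (L : ℝ) ^ (2 * d) := by positivity
      calc (4 * (L : ℝ) ^ d) ^ 2 = 16 * (L : ℝ) ^ (2 * d) := by rw [mul_pow, ← pow_mul]; ring
        _ ≤ a * (L : ℝ) ^ (2 * d) := by gcongr
        _ ≤ _ := hle
    have h2 : 4 * (L : ℝ) ^ d ≤ n := (pow_le_pow_iff_left₀ (by positivity) (by positivity) two_ne_zero).1 h1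
    have h3 : 4 * L ^ d ≤ n := by exact_mod_cast h2
    have h4 := sides_le_pow hL1 i
    omega

lemma entropyScale_nonneg {d : ℕ} {a : ℝ} (ha : 0 ≤ a) {n : ℕ} :
    0 ≤ entropyScale d a n := by
  unfold entropyScale
  have := Real.log_natCast_nonneg n
  split_ifs <;> positivity

/-- With `s = n ^ (1 / 6)`, the initial entropy and the error term are at most of order
`a s ^ (3 d - 1)`, that is, of order `a n ^ (d / 2 - 1 / 6)`. -/
lemma entropyScale_add_errorTerm_le {d n : ℕ} (hd1 : 1 ≤ d) (hd3 : d ≤ 3) {a : ℝ} {L b : ℕ}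
    (hS : Scale d n a L b) {s : ℝ} (hs : 1 ≤ s) (hsn : s ^ 6 = n) :
    (1 + entropyScale d a n + errorTerm d n a L) * s ≤ 8 * a * s ^ (3 * d) := by
  have ha := hS.one_le
  have ha0 : 0 < a := by linarith
  have hs0 : 0 < s := by linarith
  have hLn : (L : ℝ) ^ d ≤ s ^ 6 := by
    refine (pow_le_pow_iff_left₀ (by positivity) (by positivity) two_ne_zero).1 ?_
    rw [hsn, ← pow_mul, mul_comm d 2]
    have : (0 : ℝ) ≤ (L : ℝ) ^ (2 * d) := by positivity
    nlinarith [hS.le_sq]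
  have hpow : ∀ i j : ℕ, i ≤ j → s ^ i ≤ s ^ j := fun i j h => pow_le_pow_right₀ hs h
  have key : ∀ (k : ℕ) (H E : ℝ), H ≤ 6 * (a * s ^ k) → E ≤ a * s ^ k →
      (1 + H + E) * s ≤ 8 * a * s ^ (k + 1) := by
    intro k H E hH hE
    have h1 : 1 ≤ a * s ^ k := one_le_mul_of_one_le_of_one_le ha (one_le_pow₀ hs)
    calc (1 + H + E) * s ≤ (8 * (a * s ^ k)) * s := by gcongr; linarith
      _ = _ := by ring
  have hs6 : (0 : ℝ) < s ^ 6 := by positivity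
  interval_cases d
  · refine key 2 _ _ ?_ ?_
    · have h1 : √a ≤ a := by rw [Real.sqrt_le_left ha0.le]; nlinarith
      have h2 : a * 1 ≤ a * s ^ 2 := by gcongr; exact one_le_pow₀ hs
      simp only [entropyScale, if_true]
      linarith
    · unfold errorTerm
      rw [← hsn, div_le_iff₀ (by positivity)]
      rw [pow_one] at hLn
      have h3 := hpow 12 14 (by norm_num)
      calc a * L * (s ^ 6) ^ 1 ≤ a * s ^ 6 * (s ^ 6) ^ 1 := by gcongr
        _ = a * s ^ 12 := by ring
        _ ≤ a * s ^ 14 := by gcongr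
        _ = _ := by ring
  · refine key 5 _ _ ?_ ?_
    · have h1 : Real.log s ≤ s := (Real.log_le_sub_one_of_pos hs0).trans (by linarith)
      have h2 := hpow 1 5 (by norm_num)
      rw [pow_one] at h2
      simp only [entropyScale]
      norm_num
      rw [← hsn, Real.log_pow]
      calc a * (((6 : ℕ) : ℝ) * Real.log s) ≤ a * (((6 : ℕ) : ℝ) * s ^ 5) := by
            gcongr; exact h1.trans h2
        _ = _ := by push_cast; ring
    · unfold errorTerm
      rw [← hsn, div_le_iff₀ (by positivity)]
      have hL3 : (L : ℝ) ≤ s ^ 3 := by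
        refine (pow_le_pow_iff_left₀ (by positivity) (by positivity) two_ne_zero).1 ?_
        rwa [← pow_mul]
      have h3 := hpow 15 17 (by norm_num)
      calc a * L * (s ^ 6) ^ 2 ≤ a * s ^ 3 * (s ^ 6) ^ 2 := by gcongr
        _ = a * s ^ 15 := by ring
        _ ≤ a * s ^ 17 := by gcongr
        _ = _ := by ring
  · refine key 8 _ _ ?_ ?_
    · have h2 := hpow 6 8 (by norm_num)
      simp only [entropyScale]
      norm_num
      rw [← hsn]
      have : a * s ^ 6 ≤ a * s ^ 8 := by gcongr
      have : 0 ≤ a * s ^ 8 := by positivity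
      linarith
    · unfold errorTerm
      rw [← hsn, div_le_iff₀ (by positivity)]
      have hL2 : (L : ℝ) ≤ s ^ 2 := by
        refine (pow_le_pow_iff_left₀ (by positivity) (by positivity) (n := 3) (by norm_num)).1 ?_
        rwa [← pow_mul]
      calc a * L * (s ^ 6) ^ 3 ≤ a * s ^ 2 * (s ^ 6) ^ 3 := by gcongr
        _ = _ := by ring

/-- The bound of `exists_field_bound` is of order `e^{(C t + 2) a} / s`, where `s = n ^ (1 / 6)`. -/
lemma bound_le {d n : ℕ} (hd1 : 1 ≤ d) (hd3 : d ≤ 3) {a : ℝ} {L b : ℕ}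
    (hS : Scale d n a L b) {C t : ℝ} (hC : 0 < C) (ht : 0 < t) {s : ℝ} (hs : 1 ≤ s)
    (hsn : s ^ 6 = n) :
    1 / √(a * (n : ℝ) ^ d) * (entropyScale d a n + 2 * Real.exp 1 +
      t * (C * a * (Real.exp (C * a * t) * (entropyScale d a n + errorTerm d n a L)))) ≤
      8 * (6 + t * C) * (Real.exp ((C * t + 2) * a) / s) := by
  have ha := hS.one_le
  have ha0 : 0 < a := by linarith
  have hs0 : 0 < s := by linarith
  have hH : 0 ≤ entropyScale d a n := entropyScale_nonneg ha0.le
  have hE : 0 ≤ errorTerm d n a L := errorTerm_nonneg ha0.le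
  have hmain := entropyScale_add_errorTerm_le hd1 hd3 hS hs hsn
  set H := entropyScale d a n
  set E := errorTerm d n a L
  have hsq : s ^ (3 * d) ≤ √(a * (n : ℝ) ^ d) := by
    refine Real.le_sqrt_of_sq_le ?_
    have e : (s ^ (3 * d)) ^ 2 = (n : ℝ) ^ d := by rw [← hsn]; ring
    rw [e]
    exact le_mul_of_one_le_left (by positivity) ha
  have hexp : a ≤ Real.exp a := by linarith [Real.add_one_le_exp a]
  have hx1 : 1 ≤ Real.exp a := ha.trans hexp
  have hx2 : 1 ≤ Real.exp (C * a * t) := Real.one_le_exp (by positivity)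
  have h1 : H + 2 * Real.exp 1 + t * (C * a * (Real.exp (C * a * t) * (H + E))) ≤
      (6 + t * C) * (Real.exp a * Real.exp (C * a * t)) * (1 + H + E) := by
    have b1 : H + 2 * Real.exp 1 ≤ 6 * (1 + H + E) := by
      linarith [Real.exp_one_lt_three]
    have b2 : 6 * (1 + H + E) ≤ 6 * (Real.exp a * Real.exp (C * a * t)) * (1 + H + E) := by
      have : 1 ≤ Real.exp a * Real.exp (C * a * t) := one_le_mul_of_one_le_of_one_le hx1 hx2
      gcongr
      linarith
    have b3 : t * (C * a * (Real.exp (C * a * t) * (H + E))) ≤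
        t * (C * Real.exp a * (Real.exp (C * a * t) * (1 + H + E))) := by
      gcongr
      linarith
    linarith
  calc 1 / √(a * (n : ℝ) ^ d) *
        (H + 2 * Real.exp 1 + t * (C * a * (Real.exp (C * a * t) * (H + E))))
      ≤ 1 / s ^ (3 * d) * ((6 + t * C) * (Real.exp a * Real.exp (C * a * t)) * (1 + H + E)) := by
        gcongr
    _ = (6 + t * C) * (Real.exp a * Real.exp (C * a * t)) * ((1 + H + E) * s) /
          (s ^ (3 * d) * s) := by field_simp
    _ ≤ (6 + t * C) * (Real.exp a * Real.exp (C * a * t)) * (8 * Real.exp a * s ^ (3 * d)) /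
          (s ^ (3 * d) * s) := by
        have : 8 * a * s ^ (3 * d) ≤ 8 * Real.exp a * s ^ (3 * d) := by gcongr
        exact div_le_div_of_nonneg_right (mul_le_mul_of_nonneg_left (hmain.trans this)
          (by positivity)) (by positivity)
    _ = 8 * (6 + t * C) * ((Real.exp a * Real.exp (C * a * t) * Real.exp a) / s) := by
        field_simp
    _ = _ := by rw [← Real.exp_add, ← Real.exp_add]; ring_nf

lemma tendsto_exp_div_rpow {a : ℕ+ → ℝ}
    (ha_growth : ∀ C : ℝ, 0 < C →
      Tendsto (fun n : ℕ+ => Real.exp (C * a n) / Real.sqrt (n : ℝ)) atTop (𝓝 0))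
    {C : ℝ} (hC : 0 < C) :
    Tendsto (fun n : ℕ+ => Real.exp (C * a n) / ((n : ℕ) : ℝ) ^ (1 / 6 : ℝ)) atTop (𝓝 0) := by
  have h := (ha_growth (3 * C) (by positivity)).rpow_const (p := 1 / 3) (Or.inr (by norm_num))
  rw [Real.zero_rpow (by norm_num)] at h
  refine h.congr fun n => ?_
  rw [Real.div_rpow (Real.exp_pos _).le (Real.sqrt_nonneg _), ← Real.exp_mul, Real.sqrt_eq_rpow,
    ← Real.rpow_mul (by positivity)]
  have e1 : 3 * C * a n * (1 / 3) = C * a n := by ring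
  have e2 : (1 / 2 * (1 / 3) : ℝ) = 1 / 6 := by norm_num
  rw [e1, e2]

end Asymptotics

end VoterStirring

end

open VoterStirring in
theorem theorem3p2 (d : ℕ) (hd1 : 1 ≤ d) (hd3 : d ≤ 3) (ρ : ℝ) (hρ0 : 0 < ρ) (hρ1 : ρ < 1)
    -- the exclusion rates: strictly positive cylinder functions, not depending on the
    -- exchanged coordinates, subject to the gradient condition
    (c : Fin d → Config d → ℝ)
    (hc_cyl : ∀ j, IsCylinder (c j))
    (hc_pos : ∃ c₀ : ℝ, 0 < c₀ ∧ ∀ j η, c₀ ≤ c j η)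
    (hc_dep : ∀ j, DependsOn (c j) ({0, unitVec ℤ j}ᶜ : Set (Fin d → ℤ)))
    (hc_grad : ∀ j, ∃ h : Fin d → Config d → ℝ, (∀ k, IsCylinder (h k)) ∧
      ∀ η, c j η * (occ (η (unitVec ℤ j)) - occ (η 0)) =
        ∑ k, (h k (shift (unitVec ℤ k) η) - h k η))
    -- the acceleration of the voter dynamics
    (a : ℕ+ → ℝ) (ha_pos : ∀ n, 0 < a n) (ha_lim : Tendsto a atTop atTop)
    (ha_growth : ∀ C : ℝ, 0 < C →
      Tendsto (fun n : ℕ+ => Real.exp (C * a n) / Real.sqrt (n : ℝ)) atTop (𝓝 0))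
    -- the initial distributions
    (μ : ∀ n : ℕ+, Measure (TorusConfig d n)) [∀ n, IsProbabilityMeasure (μ n)]
    (hμ : ∀ n : ℕ+, InformationTheory.klDiv (μ n) (nuTorus d n ρ) ≤
      ENNReal.ofReal (entropyScale d (a n) n))
    -- the voter models with stirring
    {Ω : ℕ+ → Type*} [∀ n, MeasurableSpace (Ω n)] (P : ∀ n, Measure (Ω n))
    [∀ n, IsProbabilityMeasure (P n)] (X : ∀ n : ℕ+, ℝ → Ω n → TorusConfig d n)
    (hX : ∀ n : ℕ+, IsMarkovChain (gen c (a n) n) (μ n) (P n) (X n))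
    -- the time, the test function and the cylinder function
    (t : ℝ) (ht : 0 < t) (G : ℝ → (Fin d → UnitAddCircle) → ℝ) (hG : IsC01 G)
    (f : Config d → ℝ) (hf : IsCylinder f) :
    Tendsto (fun n : ℕ+ =>
      ∫⁻ ω, ENNReal.ofReal |∫ s in (0 : ℝ)..t, localField (a n) (G s) (proj ρ f) (X n s ω)| ∂(P n))
      atTop (𝓝 0) := by
  obtain ⟨c₀, hc0, hc₀⟩ := hc_pos
  obtain ⟨C, hC, b, hbound⟩ := exists_field_bound hd1 hd3 hρ0 hρ1 hc_cyl hc0 hc₀ hc_dep hf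
  -- a continuous test function is bounded up to time `t`, hence eventually by `a n`
  have hGcont : ContinuousOn (fun p : ℝ × (Fin d → UnitAddCircle) => G p.1 p.2)
      (Set.Icc 0 t ×ˢ Set.univ) :=
    hG.1.mono (Set.prod_mono Set.Icc_subset_Ici_self le_rfl)
  obtain ⟨M, hM⟩ := (isCompact_Icc.prod isCompact_univ).exists_bound_of_continuousOn hGcont
  have hlim := ENNReal.tendsto_ofReal
    ((tendsto_exp_div_rpow ha_growth (C := C * t + 2) (by positivity)).const_mul
      (8 * (6 + t * C)))
  rw [mul_zero, ENNReal.ofReal_zero] at hlim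
  refine tendsto_of_tendsto_of_tendsto_of_le_of_le' tendsto_const_nhds hlim
    (Eventually.of_forall fun n => zero_le) ?_
  filter_upwards [ha_lim.eventually_ge_atTop M, ha_lim.eventually_ge_atTop 16,
    (ha_growth 1 one_pos).eventually_le_const one_pos,
    eventually_ge_atTop (⟨2 * b + 1, Nat.succ_pos _⟩ : ℕ+)] with n hn1 hn2 hn3 hn4
  have hn1' : (1 : ℝ) ≤ (n : ℕ) := by exact_mod_cast n.2
  have hb : 2 * b < (n : ℕ) := hn4
  have han : a n ≤ ((n : ℕ) : ℝ) ^ 2 := by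
    have hsq : 0 < √((n : ℕ) : ℝ) := Real.sqrt_pos.2 (by linarith)
    rw [div_le_one hsq, one_mul] at hn3
    have h1 : √((n : ℕ) : ℝ) ≤ (n : ℕ) := by
      rw [Real.sqrt_le_left (by linarith)]; nlinarith
    nlinarith [Real.add_one_le_exp (a n)]
  obtain ⟨L, hS⟩ := exists_scale hd1 hn2 han hb
  refine (hbound n (a n) L hS (μ n) _ (entropyScale_nonneg (ha_pos n).le) (hμ n) (P n) (X n)
    (hX n) t ht G (fun u => ?_) fun s hs u => ?_).trans (ENNReal.ofReal_le_ofReal ?_)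
  · exact hGcont.comp (Continuous.prodMk_left u).continuousOn fun s hs => ⟨hs, Set.mem_univ _⟩
  · exact (hM (s, u) ⟨hs, Set.mem_univ _⟩).trans hn1
  · refine bound_le hd1 hd3 hS hC ht (Real.one_le_rpow hn1' (by norm_num)) ?_
    rw [← Real.rpow_natCast, ← Real.rpow_mul (by positivity)]
    norm_num
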